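/- **Setting.** Let $T,L\in(0,\infty)$, $Q=(0,T)\times(0,L)$, $x_0\in(0,L)$, $u_\infty\in[0,\infty)$, $u_0,u_L\in\mathbb R$, and let $u_m,u_M,\alpha\in C[0,L]$ satisfy $\alpha\ge 1$ and $u_M\le\alpha u_m$ on $[0,L]$, $0<u_m(x)<u_M(x)$ for $x\in[0,L]\setminus\{x_0\}$, $u_m(x_0)=u_M(x_0)=0$ and $\int_0^L\frac{dx}{u_M(x)}=+\infty$. Let $$U=\{u\in W^{1,\infty}(0,L):\ u_m\le u\le u_M \text{ on }[0,L],\ u(0)=u_0,\ u(L)=u_L,\ |u_x|\le u_\infty \text{ a.e. in }(0,L)\}$$ (elements of $W^{1,\infty}(0,L)$ being identified with their continuous representatives on $[0,L]$), and assume that $U\neq\emptyset$. For $u\in U$ let $H^1_u(0,L)$ be the space of all $y\in L^2(0,L)$ that are locally absolutely continuous in $[0,L]\setminus\{x_0\}$ with $\sqrt u\,y_x\in L^2(0,L)$ and $y(0)=y(L)=0$, with the norm $(\|y\|_{L^2}^2+\|\sqrt u\,y_x\|_{L^2}^2)^{1/2}$, and let $(H^1_u(0,L))'$ be its dual, into which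 $L^2(0,L)$ is embedded by $\langle h,v\rangle=\int_0^L hv\,dx$. Let $H^2_u(0,L)=\{y\in H^1_u(0,L):\ uy_x\in H^1(0,L)\}$, with the norm $(\|y\|_{H^1_u}^2+\|(uy_x)_x\|_{L^2}^2)^{1/2}$. Given $y_0\in L^2(0,L)$, $f\in L^2(Q)$ and $u\in U$, a *state* corresponding to $u$ is a solution of $$y_t-(uy_x)_x=f\ \text{ in }Q,\qquad y(0,\cdot)=y_0\ \text{ in }(0,L),\qquad y(t,0)=y(t,L)=0\ \text{ in }(0,T),$$ that is, a function $y\in C([0,T];L^2(0,L))\cap L^2(0,T;H^1_u(0,L))\cap W^{1,2}([0,T];(H^1_u(0,L))')$ with $y(0)=y_0$ and $$\int_0^T\Big\langle \frac{dy}{dt}(t),\psi(t)\Big\rangle dt+\int_Q u\,y_x\psi_x\,dx\,dt=\int_Q f\psi\,dx\,dt\qquad\text{for all }\psi\in L^2(0,T;H^1_u(0,L)).$$ Let $\lambda_1,\lambda_2,\lambda_3,M_f,M_T,M\ge 0$ with at least one $\lambda_i>0$. Problem $(P)$ is to minimize over $u\in U$ the functional $$J(u)=\frac{\lambda_1}{2}\Big(\int_Q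 u\,y^u_x\,dx\,dt-M_f\Big)^2+\frac{\lambda_2}{2}\Big(\int_0^L y^u(T,x)\,dx-M_T\Big)^2+\frac{\lambda_3}{2}\Big(\int_Q y^u\,dx\,dt-M\Big)^2,$$ where $y^u$ is the state corresponding to $u$. **Theorem 2.5.** Let $y_0\in L^2(0,L)$ with $y_0\ge 0$ a.e. on $(0,L)$, and $f\in L^2(Q)$ with $f\ge 0$ a.e. on $Q$. Then every $u\in U$ has exactly one state $y^u$, so that $J$ is well defined on $U$, and $(P)$ has at least one solution: there is $u\in U$ with $J(u)\le J(v)$ for all $v\in U$. The corresponding state satisfies $$y\in C([0,T];L^2(0,L))\cap L^2(0,T;H^1_u(0,L))\cap W^{1,2}([0,T];(H^1_u(0,L))').$$ If in addition $y_0\in H^1_u(0,L)$, then $$y\in W^{1,2}([0,T];L^2(0,L))\cap L^2(0,T;H^2_u(0,L))\cap L^\infty(0,T;H^1_u(0,L)).$$ -/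

import Mathlib

open Set MeasureTheory

noncomputable section

namespace DegenerateDiffusion

/-- The space `L²(0,L)` of real functions. -/
abbrev L2 (L : ℝ) : Type := Lp ℝ 2 (volume.restrict (Ioo (0 : ℝ) L))

/-- `w` is the weak derivative of `u` on the interval `(0,L)`, tested against smooth functions
with compact support in `(0,L)`. -/
def HasWeakDeriv (L : ℝ) (u w : ℝ → ℝ) : Prop :=
  ∀ φ : ℝ → ℝ, ContDiff ℝ (⊤ : ℕ∞) φ → HasCompactSupport φ → tsupport φ ⊆ Ioo 0 L →
    ∫ x in Ioo 0 L, u x * deriv φ x = - ∫ x in Ioo 0 L, w x * φ x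

/-- `g` is a representative of the class `y ∈ L²(0,L)` that is locally absolutely continuous in
`[0,L] \ {x₀}`, i.e. absolutely continuous on each compact interval contained in that set. -/
def IsACRep (L x₀ : ℝ) (y : L2 L) (g : ℝ → ℝ) : Prop :=
  (∀ a b : ℝ, 0 ≤ a → a ≤ b → b ≤ L → x₀ ∉ Icc a b → AbsolutelyContinuousOnInterval g a b) ∧
  y =ᵐ[volume.restrict (Ioo 0 L)] g

open Classical in
/-- The spatial derivative `y_x` of a class `y ∈ L²(0,L)` having a representative that is locally
absolutely continuous in `[0,L] \ {x₀}`; up to null sets it does not depend on the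
representative (`IsACRep.deriv_ae_eq`). Without such a representative the value is irrelevant. -/
def spaceDeriv (L x₀ : ℝ) (y : L2 L) : ℝ → ℝ :=
  if h : ∃ g, IsACRep L x₀ y g then deriv h.choose else 0

theorem IsACRep.continuousOn {L x₀ : ℝ} {y : L2 L} {g : ℝ → ℝ} (hg : IsACRep L x₀ y g) :
    ContinuousOn g (Ioo 0 L \ {x₀}) := by
  have hopen : IsOpen (Ioo 0 L \ {x₀}) := isOpen_Ioo.sdiff isClosed_singleton
  intro x hx
  obtain ⟨ε, hε, hb⟩ := Metric.isOpen_iff.1 hopen x hx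
  have hsub : Icc (x - ε / 2) (x + ε / 2) ⊆ Ioo 0 L \ {x₀} := by
    intro z hz
    apply hb
    rw [Metric.mem_ball, Real.dist_eq, abs_lt]
    constructor <;> linarith [hz.1, hz.2]
  have hl := hsub (left_mem_Icc.2 (by linarith : x - ε / 2 ≤ x + ε / 2))
  have hr := hsub (right_mem_Icc.2 (by linarith : x - ε / 2 ≤ x + ε / 2))
  have hac := hg.1 (x - ε / 2) (x + ε / 2) hl.1.1.le (by linarith) hr.1.2.le
    (fun h => (hsub h).2 rfl)
  have hc := hac.continuousOn
  rw [uIcc_of_le (by linarith)] at hc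
  exact (hc.continuousAt (Icc_mem_nhds (by linarith) (by linarith))).continuousWithinAt

/-- Two locally absolutely continuous representatives of the same class have the same derivative
almost everywhere. -/
theorem IsACRep.deriv_ae_eq' {L x₀ : ℝ} {y : L2 L} {g h : ℝ → ℝ} (hg : IsACRep L x₀ y g)
    (hh : IsACRep L x₀ y h) : deriv g =ᵐ[volume.restrict (Ioo 0 L)] deriv h := by
  have hopen : IsOpen (Ioo 0 L \ {x₀}) := isOpen_Ioo.sdiff isClosed_singleton
  have hae : g =ᵐ[volume.restrict (Ioo 0 L)] h := hg.2.symm.trans hh.2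
  have heq : EqOn g h (Ioo 0 L \ {x₀}) :=
    Measure.eqOn_open_of_ae_eq (ae_restrict_of_ae_restrict_of_subset sdiff_subset hae) hopen
      hg.continuousOn hh.continuousOn
  have h0 : ∀ᵐ x ∂(volume.restrict (Ioo 0 L)), x ≠ x₀ :=
    ae_restrict_of_ae (Measure.ae_ne volume x₀)
  filter_upwards [ae_restrict_mem measurableSet_Ioo, h0] with x hx hx0
  exact (heq.eventuallyEq_of_mem (hopen.mem_nhds ⟨hx, hx0⟩)).deriv_eq

theorem IsACRep.deriv_ae_eq {L x₀ : ℝ} {y : L2 L} {g : ℝ → ℝ} (hg : IsACRep L x₀ y g) :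
    spaceDeriv L x₀ y =ᵐ[volume.restrict (Ioo 0 L)] deriv g := by
  have h : ∃ g, IsACRep L x₀ y g := ⟨g, hg⟩
  rw [spaceDeriv, dif_pos h]
  exact h.choose_spec.deriv_ae_eq' hg

theorem IsACRep.ae_differentiableAt {L x₀ : ℝ} {y : L2 L} {g : ℝ → ℝ}
    (hg : IsACRep L x₀ y g) :
    ∀ᵐ x ∂(volume.restrict (Ioo 0 L)), DifferentiableAt ℝ g x := by
  have key : ∀ᵐ x ∂(volume : Measure ℝ), ∀ p q : ℚ, 0 ≤ (p : ℝ) → (p : ℝ) ≤ q → (q : ℝ) ≤ L →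
      x₀ ∉ Icc (p : ℝ) q → x ∈ uIcc (p : ℝ) q → DifferentiableAt ℝ g x := by
    rw [ae_all_iff]; intro p
    rw [ae_all_iff]; intro q
    by_cases h : 0 ≤ (p : ℝ) ∧ (p : ℝ) ≤ q ∧ (q : ℝ) ≤ L ∧ x₀ ∉ Icc (p : ℝ) q
    · filter_upwards [(hg.1 p q h.1 h.2.1 h.2.2.1 h.2.2.2).ae_differentiableAt] with x hx
      intro _ _ _ _ hxm
      exact hx hxm
    · refine Filter.Eventually.of_forall fun x h1 h2 h3 h4 => absurd ⟨h1, h2, h3, h4⟩ h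
  have hopen : IsOpen (Ioo 0 L \ {x₀}) := isOpen_Ioo.sdiff isClosed_singleton
  have h0 : ∀ᵐ x ∂(volume.restrict (Ioo 0 L)), x ≠ x₀ :=
    ae_restrict_of_ae (Measure.ae_ne volume x₀)
  filter_upwards [ae_restrict_mem measurableSet_Ioo, h0, ae_restrict_of_ae key] with x hx hx0 hk
  obtain ⟨ε, hε, hb⟩ := Metric.isOpen_iff.1 hopen x ⟨hx, hx0⟩
  obtain ⟨p, hp1, hp2⟩ := exists_rat_btwn (by linarith : x - ε < x)
  obtain ⟨q, hq1, hq2⟩ := exists_rat_btwn (by linarith : x < x + ε)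
  have hsub : Icc (p : ℝ) q ⊆ Ioo 0 L \ {x₀} := by
    intro z hz
    apply hb
    rw [Metric.mem_ball, Real.dist_eq, abs_lt]
    constructor <;> linarith [hz.1, hz.2]
  have hpq : (p : ℝ) ≤ q := by linarith
  have hl := hsub (left_mem_Icc.2 hpq)
  have hr := hsub (right_mem_Icc.2 hpq)
  refine hk p q hl.1.1.le hpq hr.1.2.le (fun h => (hsub h).2 rfl) ?_
  rw [uIcc_of_le hpq]
  exact ⟨hp2.le, hq1.le⟩

theorem IsACRep.add {L x₀ : ℝ} {y z : L2 L} {g h : ℝ → ℝ} (hg : IsACRep L x₀ y g)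
    (hh : IsACRep L x₀ z h) : IsACRep L x₀ (y + z) (g + h) :=
  ⟨fun a b h1 h2 h3 h4 => (hg.1 a b h1 h2 h3 h4).add (hh.1 a b h1 h2 h3 h4),
    (Lp.coeFn_add y z).trans (hg.2.add hh.2)⟩

theorem IsACRep.smul {L x₀ : ℝ} {y : L2 L} {g : ℝ → ℝ} (c : ℝ) (hg : IsACRep L x₀ y g) :
    IsACRep L x₀ (c • y) (fun x => c * g x) :=
  ⟨fun a b h1 h2 h3 h4 => (hg.1 a b h1 h2 h3 h4).const_mul c, by
    filter_upwards [Lp.coeFn_smul c y, hg.2] with x h1 h2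
    rw [h1, Pi.smul_apply, h2, smul_eq_mul]⟩

theorem IsACRep.zero (L x₀ : ℝ) : IsACRep L x₀ (0 : L2 L) (fun _ => 0) :=
  ⟨fun _ _ _ _ _ _ =>
    (LipschitzWith.const (0 : ℝ)).lipschitzOnWith.absolutelyContinuousOnInterval,
    Lp.coeFn_zero _ _ _⟩

theorem IsACRep.spaceDeriv_add {L x₀ : ℝ} {y z : L2 L} {g h : ℝ → ℝ} (hg : IsACRep L x₀ y g)
    (hh : IsACRep L x₀ z h) :
    ∀ᵐ x ∂(volume.restrict (Ioo 0 L)),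
      spaceDeriv L x₀ (y + z) x = spaceDeriv L x₀ y x + spaceDeriv L x₀ z x := by
  filter_upwards [hg.deriv_ae_eq, hh.deriv_ae_eq, (hg.add hh).deriv_ae_eq,
    hg.ae_differentiableAt, hh.ae_differentiableAt] with x h1 h2 h3 h4 h5
  rw [h1, h2, h3, deriv_add h4 h5]

theorem IsACRep.spaceDeriv_smul {L x₀ : ℝ} {y : L2 L} {g : ℝ → ℝ} (c : ℝ)
    (hg : IsACRep L x₀ y g) :
    ∀ᵐ x ∂(volume.restrict (Ioo 0 L)),
      spaceDeriv L x₀ (c • y) x = c * spaceDeriv L x₀ y x := by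
  filter_upwards [hg.deriv_ae_eq, (hg.smul c).deriv_ae_eq,
    hg.ae_differentiableAt] with x h1 h2 h4
  rw [h1, h2, deriv_const_mul c h4]

theorem spaceDeriv_zero (L x₀ : ℝ) :
    ∀ᵐ x ∂(volume.restrict (Ioo 0 L)), spaceDeriv L x₀ (0 : L2 L) x = 0 := by
  filter_upwards [(IsACRep.zero L x₀).deriv_ae_eq] with x h1
  rw [h1, deriv_const]

/-- The weighted space `H¹_u(0,L)` of all `y ∈ L²(0,L)` that are locally absolutely continuous in
`[0,L] \ {x₀}` with `√u y_x ∈ L²(0,L)` and `y(0) = y(L) = 0`. The element `y` is recorded as the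
pair `(y, √u y_x)` in the Hilbert sum `L²(0,L) ⊕ L²(0,L)`, so that the inherited norm is
`(‖y‖² + ‖√u y_x‖²)^(1/2)`. -/
def H1 (L x₀ : ℝ) (u : ℝ → ℝ) : Submodule ℝ (WithLp 2 (L2 L × L2 L)) where
  carrier := {p | (∃ g, IsACRep L x₀ p.fst g ∧ g 0 = 0 ∧ g L = 0) ∧
    p.snd =ᵐ[volume.restrict (Ioo 0 L)] fun x => √(u x) * spaceDeriv L x₀ p.fst x}
  zero_mem' := by
    refine ⟨⟨_, IsACRep.zero L x₀, rfl, rfl⟩, ?_⟩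
    filter_upwards [spaceDeriv_zero L x₀, Lp.coeFn_zero ℝ 2 (volume.restrict (Ioo 0 L))]
      with x h1 h2
    simp only [WithLp.zero_fst, WithLp.zero_snd]
    rw [h1, h2]; simp
  add_mem' := by
    rintro p q ⟨⟨g, hg, hg0, hgL⟩, hp⟩ ⟨⟨h, hh, hh0, hhL⟩, hq⟩
    refine ⟨⟨g + h, hg.add hh, by simp [hg0, hh0], by simp [hgL, hhL]⟩, ?_⟩
    filter_upwards [hg.spaceDeriv_add hh, hp, hq, Lp.coeFn_add p.snd q.snd] with x h1 h2 h3 h4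
    simp only [WithLp.add_fst, WithLp.add_snd]
    rw [h1, h4, Pi.add_apply, h2, h3]; ring
  smul_mem' := by
    rintro c p ⟨⟨g, hg, hg0, hgL⟩, hp⟩
    refine ⟨⟨_, hg.smul c, by simp [hg0], by simp [hgL]⟩, ?_⟩
    filter_upwards [hg.spaceDeriv_smul c, hp, Lp.coeFn_smul c p.snd] with x h1 h2 h4
    simp only [WithLp.smul_fst, WithLp.smul_snd]
    rw [h1, h4, Pi.smul_apply, h2, smul_eq_mul]; ring

/-- The continuous inclusion `H¹_u(0,L) → L²(0,L)`. -/
def toL2 {L x₀ : ℝ} {u : ℝ → ℝ} : H1 L x₀ u →L[ℝ] L2 L :=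
  (WithLp.fstL 2 ℝ (L2 L) (L2 L)).comp (H1 L x₀ u).subtypeL

theorem exists_rep {L x₀ : ℝ} {u : ℝ → ℝ} (v : H1 L x₀ u) :
    ∃ g, IsACRep L x₀ (toL2 v) g := by
  obtain ⟨⟨g, hg, -, -⟩, -⟩ := v.2
  exact ⟨g, hg⟩

/-- The dual space `(H¹_u(0,L))'`. -/
abbrev H1Dual (L x₀ : ℝ) (u : ℝ → ℝ) : Type := StrongDual ℝ (H1 L x₀ u)

/-- The embedding `L²(0,L) → (H¹_u(0,L))'`, `⟨h, v⟩ = ∫₀ᴸ h v dx`. -/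
def toDual {L x₀ : ℝ} {u : ℝ → ℝ} (h : L2 L) : H1Dual L x₀ u :=
  (innerSL ℝ h).comp toL2

/-- The space `H²_u(0,L)` of all `y ∈ H¹_u(0,L)` with `u y_x ∈ H¹(0,L)`. The element `y` is
recorded as the pair `(y, (u y_x)_x)` in the Hilbert sum `H¹_u(0,L) ⊕ L²(0,L)`. -/
def H2 (L x₀ : ℝ) (u : ℝ → ℝ) : Submodule ℝ (WithLp 2 (H1 L x₀ u × L2 L)) where
  carrier := {q |
    MemLp (fun x => u x * spaceDeriv L x₀ (toL2 q.fst) x) 2 (volume.restrict (Ioo 0 L)) ∧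
    HasWeakDeriv L (fun x => u x * spaceDeriv L x₀ (toL2 q.fst) x) q.snd}
  zero_mem' := by
    have h0 : (fun x => u x * spaceDeriv L x₀ (0 : L2 L) x)
        =ᵐ[volume.restrict (Ioo 0 L)] fun _ => 0 := by
      filter_upwards [spaceDeriv_zero L x₀] with x hx
      rw [hx, mul_zero]
    simp only [mem_ofPred_eq, WithLp.zero_fst, WithLp.zero_snd, map_zero]
    refine ⟨(memLp_congr_ae h0).2 MemLp.zero', fun φ _ _ _ => ?_⟩
    have e1 : ∫ x in Ioo 0 L, u x * spaceDeriv L x₀ (0 : L2 L) x * deriv φ x = 0 := by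
      apply integral_eq_zero_of_ae
      filter_upwards [h0] with x hx
      simp [hx]
    have e2 : ∫ x in Ioo 0 L, (0 : L2 L) x * φ x = 0 := by
      apply integral_eq_zero_of_ae
      filter_upwards [Lp.coeFn_zero ℝ 2 (volume.restrict (Ioo 0 L))] with x hx
      rw [hx]; simp
    rw [e1, e2, neg_zero]
  add_mem' := by
    rintro p q ⟨hp, hp'⟩ ⟨hq, hq'⟩
    obtain ⟨g, hg⟩ := exists_rep p.fst
    obtain ⟨h, hh⟩ := exists_rep q.fst
    have hae : (fun x => u x * spaceDeriv L x₀ (toL2 p.fst + toL2 q.fst) x)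
        =ᵐ[volume.restrict (Ioo 0 L)]
        (fun x => u x * spaceDeriv L x₀ (toL2 p.fst) x) +
          (fun x => u x * spaceDeriv L x₀ (toL2 q.fst) x) := by
      filter_upwards [hg.spaceDeriv_add hh] with x hx
      rw [hx, Pi.add_apply]; ring
    simp only [mem_ofPred_eq, WithLp.add_fst, WithLp.add_snd, map_add]
    refine ⟨(memLp_congr_ae hae).2 (hp.add hq), fun φ h1 h2 h3 => ?_⟩
    have hφ : MemLp φ 2 (volume.restrict (Ioo 0 L)) :=
      h1.continuous.memLp_of_hasCompactSupport h2
    have hφ' : MemLp (deriv φ) 2 (volume.restrict (Ioo 0 L)) :=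
      (h1.continuous_deriv (by simp)).memLp_of_hasCompactSupport h2.deriv
    have e1 : ∫ x in Ioo 0 L, u x * spaceDeriv L x₀ (toL2 p.fst + toL2 q.fst) x * deriv φ x
        = (∫ x in Ioo 0 L, u x * spaceDeriv L x₀ (toL2 p.fst) x * deriv φ x) +
          ∫ x in Ioo 0 L, u x * spaceDeriv L x₀ (toL2 q.fst) x * deriv φ x := by
      refine Eq.trans ?_ (integral_add (hp.integrable_mul hφ') (hq.integrable_mul hφ'))
      apply integral_congr_ae
      filter_upwards [hae] with x hx
      rw [hx, Pi.add_apply]; ring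
    have e2 : ∫ x in Ioo 0 L, (p.snd + q.snd : L2 L) x * φ x
        = (∫ x in Ioo 0 L, p.snd x * φ x) + ∫ x in Ioo 0 L, q.snd x * φ x := by
      refine Eq.trans ?_ (integral_add ((Lp.memLp p.snd).integrable_mul hφ)
        ((Lp.memLp q.snd).integrable_mul hφ))
      apply integral_congr_ae
      filter_upwards [Lp.coeFn_add p.snd q.snd] with x hx
      rw [hx, Pi.add_apply]; ring
    rw [e1, e2, hp' φ h1 h2 h3, hq' φ h1 h2 h3]; ring
  smul_mem' := by
    rintro c p ⟨hp, hp'⟩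
    obtain ⟨g, hg⟩ := exists_rep p.fst
    have hae : (fun x => u x * spaceDeriv L x₀ (c • toL2 p.fst) x)
        =ᵐ[volume.restrict (Ioo 0 L)] fun x => c * (u x * spaceDeriv L x₀ (toL2 p.fst) x) := by
      filter_upwards [hg.spaceDeriv_smul c] with x hx
      rw [hx]; ring
    simp only [mem_ofPred_eq, WithLp.smul_fst, WithLp.smul_snd, map_smul]
    refine ⟨(memLp_congr_ae hae).2 (hp.const_mul c), fun φ h1 h2 h3 => ?_⟩
    have e1 : ∫ x in Ioo 0 L, u x * spaceDeriv L x₀ (c • toL2 p.fst) x * deriv φ x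
        = c * ∫ x in Ioo 0 L, u x * spaceDeriv L x₀ (toL2 p.fst) x * deriv φ x := by
      rw [← integral_const_mul]
      apply integral_congr_ae
      filter_upwards [hae] with x hx
      rw [hx]; ring
    have e2 : ∫ x in Ioo 0 L, (c • p.snd : L2 L) x * φ x
        = c * ∫ x in Ioo 0 L, p.snd x * φ x := by
      rw [← integral_const_mul]
      apply integral_congr_ae
      filter_upwards [Lp.coeFn_smul c p.snd] with x hx
      rw [hx, Pi.smul_apply, smul_eq_mul]; ring
    rw [e1, e2, hp' φ h1 h2 h3]; ring

/-- `y` belongs to `W^{1,2}([0,T]; X)` with derivative `y'`. -/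
def HasL2TimeDeriv {X : Type*} [NormedAddCommGroup X] [NormedSpace ℝ X] (T : ℝ)
    (y y' : ℝ → X) : Prop :=
  MemLp y' 2 (volume.restrict (Ioo 0 T)) ∧
    ∀ t ∈ Icc 0 T, y t = y 0 + ∫ s in (0 : ℝ)..t, y' s

/-- The function `y : [0,T] → L²(0,L)` is a solution (in the variational sense) of
`y_t - (u y_x)_x = f` in `Q = (0,T) × (0,L)`, `y(0,·) = y₀`, `y(t,0) = y(t,L) = 0`. -/
structure IsState (T L x₀ : ℝ) (y₀ : L2 L) (f : ℝ × ℝ → ℝ) (u : ℝ → ℝ) (y : ℝ → L2 L) :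
    Prop where
  /-- `y ∈ C([0,T]; L²(0,L))` -/
  continuousOn : ContinuousOn y (Icc 0 T)
  /-- `y ∈ L²(0,T; H¹_u(0,L))` -/
  memL2 : ∃ v : ℝ → H1 L x₀ u, MemLp v 2 (volume.restrict (Ioo 0 T)) ∧
    ∀ᵐ t ∂(volume.restrict (Ioo 0 T)), toL2 (v t) = y t
  /-- `y ∈ W^{1,2}([0,T]; (H¹_u(0,L))')` and the variational equation -/
  equation : ∃ y' : ℝ → H1Dual L x₀ u, HasL2TimeDeriv T (fun t => toDual (y t)) y' ∧
    ∀ ψ : ℝ → H1 L x₀ u, MemLp ψ 2 (volume.restrict (Ioo 0 T)) →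
      (∫ t in Ioo 0 T, y' t (ψ t)) +
        (∫ t in Ioo 0 T, ∫ x in Ioo 0 L,
          u x * spaceDeriv L x₀ (y t) x * spaceDeriv L x₀ (toL2 (ψ t)) x) =
        ∫ t in Ioo 0 T, ∫ x in Ioo 0 L, f (t, x) * toL2 (ψ t) x
  /-- the initial condition -/
  initial : y 0 = y₀

/-- The regularity class
`W^{1,2}([0,T]; L²(0,L)) ∩ L²(0,T; H²_u(0,L)) ∩ L^∞(0,T; H¹_u(0,L))`. -/
structure IsRegularState (T L x₀ : ℝ) (u : ℝ → ℝ) (y : ℝ → L2 L) : Prop where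
  timeDeriv : ∃ y' : ℝ → L2 L, HasL2TimeDeriv T y y'
  memL2 : ∃ w : ℝ → H2 L x₀ u, MemLp w 2 (volume.restrict (Ioo 0 T)) ∧
    ∀ᵐ t ∂(volume.restrict (Ioo 0 T)),
      toL2 (w t : WithLp 2 (H1 L x₀ u × L2 L)).fst = y t
  memLinfty : ∃ v : ℝ → H1 L x₀ u, MemLp v ⊤ (volume.restrict (Ioo 0 T)) ∧
    ∀ᵐ t ∂(volume.restrict (Ioo 0 T)), toL2 (v t) = y t

/-- The set `U` of admissible coefficients: all `u ∈ W^{1,∞}(0,L)`, identified with their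
continuous representatives on `[0,L]`, with `u_m ≤ u ≤ u_M`, `u(0) = u_0`, `u(L) = u_L` and
`|u_x| ≤ u_∞` almost everywhere. -/
def admissible (L : ℝ) (um uM : ℝ → ℝ) (u0 uL uinf : ℝ) : Set (ℝ → ℝ) :=
  {u | ContinuousOn u (Icc 0 L) ∧ MemLp u ⊤ (volume.restrict (Ioo 0 L)) ∧
    (∀ x ∈ Icc 0 L, um x ≤ u x ∧ u x ≤ uM x) ∧ u 0 = u0 ∧ u L = uL ∧
    ∃ ux : ℝ → ℝ, MemLp ux ⊤ (volume.restrict (Ioo 0 L)) ∧ HasWeakDeriv L u ux ∧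
      ∀ᵐ x ∂(volume.restrict (Ioo 0 L)), |ux x| ≤ uinf}

/-- The cost of the coefficient `u` with the state `y`. -/
def cost (T L x₀ l1 l2 l3 Mf MT M : ℝ) (u : ℝ → ℝ) (y : ℝ → L2 L) : ℝ :=
  l1 / 2 * ((∫ t in Ioo 0 T, ∫ x in Ioo 0 L, u x * spaceDeriv L x₀ (y t) x) - Mf) ^ 2 +
  l2 / 2 * ((∫ x in Ioo 0 L, y T x) - MT) ^ 2 +
  l3 / 2 * ((∫ t in Ioo 0 T, ∫ x in Ioo 0 L, y t x) - M) ^ 2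

end DegenerateDiffusion

end

open DegenerateDiffusion

/-!
All admissible coefficients are compared with the fixed weight `um`. Since `um ≤ u ≤ α um` and `α`
is bounded on `[0,L]`, the space `H¹_u(0,L)` is, up to an equivalent norm, the space `H¹_um(0,L)`,
for every admissible `u` (`IsComparableWeight.toRef`, `IsComparableWeight.ofRef`). Put
`V = H¹_um(0,L)` and `H = L²(0,L)`, with the dense inclusion `ι : V → H`. The space `V` is a Hilbert
space (`IsWeight.completeSpace_H1`), and the form `∫ u y_x z_x` is represented by a bounded
symmetric operator `A_u = D† (u / um) D` on `V`, where `D y = √um y_x`. A state is then exactly a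
solution of the integrated equation `ι† y(t) = ι† y₀ + ∫₀ᵗ (ι† f - A_u y)` in `V`
(`IsWeakSol.isState`, `IsState.isWeakSol`). In particular the degeneracy of the coefficient at
`x₀` plays a role only in the definition of `V`.

The abstract equation `y' + A y = f` is solved for initial values in `V` by the regularization
`ι† ι y' + ε A y' + A y = ι† f`, which is solvable by the Lax-Milgram theorem in `L²(0,T;V)`
(`IsElliptic.exists_regularized`). As `ε → 0` the solutions form a Cauchy sequence in `L²(0,T;V)`
and stay bounded in `L^∞(0,T;V)`, while `ι y'` stays bounded in `L²(0,T;H)`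
(`IsElliptic.exists_isStrongSol`). The limit `y` is a strong solution, for which the equation says
that `(u y_x)_x = y' - f` belongs to `L²(0,L)` for almost every `t`; this is the higher regularity
(`IsStrongSol.isRegularState`). Initial values in `H` are approximated by elements of `V`
(`IsElliptic.exists_isEnergySol`). The difference `h` of two weak solutions satisfies
`ι† h + A ∫₀ᵗ h = 0`, and testing with `h` gives `h = 0` (`IsWeakSol.unique`).

The minimum is attained by the direct method. Admissible coefficients are Lipschitz with constant
`uinf`, so that by the theorem of Arzelà and Ascoli a minimizing sequence has a subsequence that
converges uniformly to an admissible `u` (`exists_subseq_tendsto_admissible`). Along it, by dominated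
convergence, `A_{uₙ} p → A_u p` for each `p ∈ V`; hence the states converge in `L²(0,T;V)` and,
at each time, in `H` (`IsEnergySol.tendsto`), and so do the costs
(`IsComparableWeight.tendsto_cost`).
-/

open Filter Topology

noncomputable section

namespace DegenerateDiffusion

/-! ### Calculus of square integrable functions of time -/

section TimeCalculus

variable {X : Type*} [NormedAddCommGroup X] {T t : ℝ}

theorem intervalIntegrable_of_memLp_two {z : ℝ → X}
    (hz : MemLp z 2 (volume.restrict (Ioo 0 T))) (ht : t ∈ Icc 0 T) :
    IntervalIntegrable z volume 0 t := by
  have h1 : Integrable z (volume.restrict (Ioo 0 T)) := hz.integrable (by norm_num)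
  have h2 : IntegrableOn z (Ioc 0 T) volume := (integrableOn_Ioc_iff_integrableOn_Ioo).2 h1
  rw [intervalIntegrable_iff_integrableOn_Ioc_of_le ht.1]
  exact h2.mono_set (Ioc_subset_Ioc_right ht.2)

theorem intervalIntegrable_of_integrable {z : ℝ → X}
    (h1 : Integrable z (volume.restrict (Ioo 0 T))) (ht : t ∈ Icc 0 T) :
    IntervalIntegrable z volume 0 t := by
  have h2 : IntegrableOn z (Ioc 0 T) volume := (integrableOn_Ioc_iff_integrableOn_Ioo).2 h1
  rw [intervalIntegrable_iff_integrableOn_Ioc_of_le ht.1]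
  exact h2.mono_set (Ioc_subset_Ioc_right ht.2)

theorem integrable_inner_of_memLp [InnerProductSpace ℝ X] {μ : Measure ℝ} {a b : ℝ → X}
    (ha : MemLp a 2 μ) (hb : MemLp b 2 μ) : Integrable (fun s => inner ℝ (a s) (b s)) μ := by
  have h := L2.integrable_inner (𝕜 := ℝ) ha.toLp hb.toLp
  refine h.congr ?_
  filter_upwards [ha.coeFn_toLp, hb.coeFn_toLp] with s h1 h2
  rw [h1, h2]

theorem ae_restrict_mono_interval {p : ℝ → Prop} (ht : t ∈ Icc 0 T)
    (h : ∀ᵐ s ∂(volume.restrict (Ioo 0 T)), p s) :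
    ∀ᵐ s ∂(volume.restrict (uIoc 0 t)), p s := by
  rw [uIoc_of_le ht.1, restrict_Ioo_eq_restrict_Ioc.symm]
  exact ae_restrict_of_ae_restrict_of_subset (Ioo_subset_Ioo_right ht.2) h

theorem intervalIntegral_congr_of_ae [NormedSpace ℝ X] {z z' : ℝ → X} (ht : t ∈ Icc 0 T)
    (h : ∀ᵐ s ∂(volume.restrict (Ioo 0 T)), z s = z' s) :
    ∫ s in (0 : ℝ)..t, z s = ∫ s in (0 : ℝ)..t, z' s :=
  intervalIntegral.integral_congr_ae_restrict (ae_restrict_mono_interval ht h)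

theorem intervalIntegral_mono_of_ae {z z' : ℝ → ℝ} (ht : t ∈ Icc 0 T)
    (hz : Integrable z (volume.restrict (Ioo 0 T)))
    (hz' : Integrable z' (volume.restrict (Ioo 0 T)))
    (h : ∀ᵐ s ∂(volume.restrict (Ioo 0 T)), z s ≤ z' s) :
    ∫ s in (0 : ℝ)..t, z s ≤ ∫ s in (0 : ℝ)..t, z' s := by
  apply intervalIntegral.integral_mono_ae_restrict ht.1
    (intervalIntegrable_of_integrable hz ht) (intervalIntegrable_of_integrable hz' ht)
  have := ae_restrict_mono_interval ht h
  rwa [uIoc_of_le ht.1, Measure.restrict_congr_set Ioc_ae_eq_Icc] at this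

theorem intervalIntegral_le_of_nonneg {z : ℝ → ℝ} (ht : t ∈ Icc 0 T)
    (hz : Integrable z (volume.restrict (Ioo 0 T)))
    (h : ∀ᵐ s ∂(volume.restrict (Ioo 0 T)), 0 ≤ z s) :
    ∫ s in (0 : ℝ)..t, z s ≤ ∫ s in (0 : ℝ)..T, z s := by
  have hT : T ∈ Icc 0 T := ⟨ht.1.trans ht.2, le_rfl⟩
  have h1 := ae_restrict_mono_interval hT h
  rw [uIoc_of_le hT.1] at h1
  exact intervalIntegral.integral_mono_interval le_rfl ht.1 ht.2 h1
    (intervalIntegrable_of_integrable hz hT)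

theorem intervalIntegral_eq_integral_Ioo [NormedSpace ℝ X] (hT : 0 ≤ T) (z : ℝ → X) :
    ∫ s in (0 : ℝ)..T, z s = ∫ s in Ioo 0 T, z s := by
  rw [intervalIntegral.integral_of_le hT, integral_Ioc_eq_integral_Ioo]

theorem memLp_of_continuousOn {z : ℝ → X} (hz : ContinuousOn z (Icc 0 T)) (p : ENNReal) :
    MemLp z p (volume.restrict (Ioo 0 T)) := by
  obtain ⟨C, hC⟩ := isCompact_Icc.exists_bound_of_continuousOn hz
  refine MemLp.of_bound
    ((hz.mono Ioo_subset_Icc_self).aestronglyMeasurable measurableSet_Ioo) C ?_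
  filter_upwards [ae_restrict_mem measurableSet_Ioo] with s hs using hC s (Ioo_subset_Icc_self hs)

theorem continuousOn_primitive [NormedSpace ℝ X] (hT : 0 ≤ T) {z : ℝ → X}
    (hz : MemLp z 2 (volume.restrict (Ioo 0 T))) :
    ContinuousOn (fun t => ∫ s in (0 : ℝ)..t, z s) (Icc 0 T) := by
  have h := intervalIntegral.continuousOn_primitive_interval'
    (intervalIntegrable_of_memLp_two hz (right_mem_Icc.2 hT)) left_mem_uIcc
  rwa [uIcc_of_le hT] at h

/-- A function whose increments are dominated by those of an absolutely continuous function is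
absolutely continuous. -/
theorem absolutelyContinuousOnInterval_of_dist_le {Z : Type*} [PseudoMetricSpace Z]
    {F : ℝ → Z} {N : ℝ → ℝ} {a b : ℝ} (C : ℝ) (hN : AbsolutelyContinuousOnInterval N a b)
    (h : ∀ s ∈ uIcc a b, ∀ r ∈ uIcc a b, dist (F s) (F r) ≤ C * dist (N s) (N r)) :
    AbsolutelyContinuousOnInterval F a b := by
  have h1 := Tendsto.const_mul C hN
  rw [mul_zero] at h1
  refine squeeze_zero' (Eventually.of_forall fun E => Finset.sum_nonneg fun _ _ => dist_nonneg)
    ?_ h1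
  have h2 : ∀ᶠ E : ℕ × (ℕ → ℝ × ℝ) in AbsolutelyContinuousOnInterval.totalLengthFilter ⊓
      𝓟 (AbsolutelyContinuousOnInterval.disjWithin a b),
      E ∈ AbsolutelyContinuousOnInterval.disjWithin a b :=
    eventually_inf_principal.2 (Eventually.of_forall fun _ h => h)
  filter_upwards [h2] with E hE
  rw [Finset.mul_sum]
  refine Finset.sum_le_sum fun i hi => h _ (hE.1 i hi).1 _ (hE.1 i hi).2

/-- The energy identity for a primitive in a Hilbert space. -/
theorem inner_primitive_eq [InnerProductSpace ℝ X] [CompleteSpace X] {B : X →L[ℝ] X}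
    (hB : ∀ v w, inner ℝ (B v) w = inner ℝ v (B w)) {z : ℝ → X} (z₀ : X)
    (hz : MemLp z 2 (volume.restrict (Ioo 0 T))) (ht : t ∈ Icc 0 T) :
    inner ℝ (B (z₀ + ∫ s in (0 : ℝ)..t, z s)) (z₀ + ∫ s in (0 : ℝ)..t, z s) =
      inner ℝ (B z₀) z₀ +
        2 * ∫ s in (0 : ℝ)..t, inner ℝ (B (z₀ + ∫ r in (0 : ℝ)..s, z r)) (z s) := by
  have hzi := intervalIntegrable_of_memLp_two hz ht
  set Z : ℝ → X := fun s => z₀ + ∫ r in (0 : ℝ)..s, z r with hZ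
  set N : ℝ → ℝ := fun s => ∫ r in (0 : ℝ)..s, ‖z r‖ with hN
  have hsub : ∀ s ∈ uIcc 0 t, IntervalIntegrable z volume 0 s := fun s hs =>
    hzi.mono_set (uIcc_subset_uIcc left_mem_uIcc hs)
  have hdist : ∀ s ∈ uIcc 0 t, ∀ r ∈ uIcc 0 t, ‖Z s - Z r‖ ≤ dist (N s) (N r) := by
    intro s hs r hr
    simp only [hZ, hN, add_sub_add_left_eq_sub, Real.dist_eq]
    rw [intervalIntegral.integral_interval_sub_left (hsub s hs) (hsub r hr),
      intervalIntegral.integral_interval_sub_left (hsub s hs).norm (hsub r hr).norm]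
    exact intervalIntegral.norm_integral_le_abs_integral_norm
  have hNac : AbsolutelyContinuousOnInterval N 0 t :=
    hzi.norm.absolutelyContinuousOnInterval_intervalIntegral left_mem_uIcc
  have hZc : ContinuousOn Z (uIcc 0 t) :=
    continuousOn_const.add (intervalIntegral.continuousOn_primitive_interval' hzi left_mem_uIcc)
  obtain ⟨K, hK⟩ := isCompact_uIcc.exists_bound_of_continuousOn hZc
  have hac : AbsolutelyContinuousOnInterval (fun s => inner ℝ (B (Z s)) (Z s)) 0 t := by
    refine absolutelyContinuousOnInterval_of_dist_le (2 * ‖B‖ * K) hNac fun s hs r hr => ?_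
    have e : inner ℝ (B (Z s)) (Z s) - inner ℝ (B (Z r)) (Z r)
        = inner ℝ (B (Z s - Z r)) (Z s) + inner ℝ (B (Z r)) (Z s - Z r) := by
      rw [map_sub, inner_sub_left, inner_sub_right]; ring
    rw [Real.dist_eq, e]
    have h1 : |inner ℝ (B (Z s - Z r)) (Z s)| ≤ ‖B‖ * dist (N s) (N r) * K :=
      (abs_real_inner_le_norm _ _).trans (by
        gcongr
        · exact (B.le_opNorm _).trans (by gcongr; exact hdist s hs r hr)
        · exact hK s hs)
    have h2 : |inner ℝ (B (Z r)) (Z s - Z r)| ≤ ‖B‖ * K * dist (N s) (N r) :=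
      (abs_real_inner_le_norm _ _).trans (by
        gcongr
        · exact (norm_nonneg _).trans (B.le_opNorm (Z r) |>.trans
            (by gcongr; exact hK r hr))
        · exact (B.le_opNorm _).trans (by gcongr; exact hK r hr)
        · exact hdist s hs r hr)
    calc _ ≤ _ := abs_add_le _ _
      _ ≤ _ := add_le_add h1 h2
      _ = _ := by ring
  have hd := hac.integral_deriv_eq_sub
  have e : ∫ s in (0 : ℝ)..t, deriv (fun s => inner ℝ (B (Z s)) (Z s)) s
      = ∫ s in (0 : ℝ)..t, 2 * inner ℝ (B (Z s)) (z s) := by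
    apply intervalIntegral.integral_congr_ae
    filter_upwards [hzi.ae_hasDerivAt_integral] with s hs hs'
    have h1 : HasDerivAt Z (z s) s :=
      (hs (uIoc_subset_uIcc hs') 0 left_mem_uIcc).const_add z₀
    have h2 : HasDerivAt (fun s => B (Z s)) (B (z s)) s := B.hasFDerivAt.comp_hasDerivAt s h1
    rw [(h2.inner ℝ h1).deriv, hB (z s), real_inner_comm]
    ring
  rw [e, intervalIntegral.integral_const_mul] at hd
  have e0 : Z 0 = z₀ := by simp [hZ]
  simp only [e0] at hd
  linarith

end TimeCalculus

/-! ### The space `L²(0,T;X)` -/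

section TimeLp

variable {X Y : Type*} [NormedAddCommGroup X] [InnerProductSpace ℝ X] {T : ℝ}

theorem integral_norm_sq_eq_norm_toLp_sq {z : ℝ → X}
    (hT : 0 ≤ T) (hz : MemLp z 2 (volume.restrict (Ioo 0 T))) :
    ∫ s in (0 : ℝ)..T, ‖z s‖ ^ 2 = ‖hz.toLp‖ ^ 2 := by
  rw [intervalIntegral_eq_integral_Ioo hT, ← real_inner_self_eq_norm_sq, L2.inner_def]
  apply integral_congr_ae
  filter_upwards [hz.coeFn_toLp] with s hs
  rw [hs, real_inner_self_eq_norm_sq]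

theorem integral_norm_sq_eq_norm_Lp_sq (hT : 0 ≤ T) (z : Lp X 2 (volume.restrict (Ioo 0 T))) :
    ∫ s in (0 : ℝ)..T, ‖z s‖ ^ 2 = ‖z‖ ^ 2 := by
  rw [integral_norm_sq_eq_norm_toLp_sq hT (Lp.memLp z), Lp.toLp_coeFn]

theorem integral_norm_sub_sq {a b : ℝ → X} (hT : 0 ≤ T)
    (ha : MemLp a 2 (volume.restrict (Ioo 0 T))) (hb : MemLp b 2 (volume.restrict (Ioo 0 T))) :
    ∫ s in (0 : ℝ)..T, ‖a s - b s‖ ^ 2 = ‖ha.toLp - hb.toLp‖ ^ 2 := by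
  rw [← MemLp.toLp_sub ha hb]
  exact integral_norm_sq_eq_norm_toLp_sq hT (ha.sub hb)

theorem integrable_norm_sq {z : ℝ → X} {μ : Measure ℝ} (hz : MemLp z 2 μ) :
    Integrable (fun s => ‖z s‖ ^ 2) μ := by
  simpa only [real_inner_self_eq_norm_sq] using integrable_inner_of_memLp hz hz

/-- The Cauchy-Schwarz inequality for the primitive. -/
theorem norm_primitive_sq_le (hT : 0 < T) {z : ℝ → X}
    (hz : MemLp z 2 (volume.restrict (Ioo 0 T))) {t : ℝ} (ht : t ∈ Icc 0 T) :
    ‖∫ s in (0 : ℝ)..t, z s‖ ^ 2 ≤ T * ∫ s in (0 : ℝ)..T, ‖z s‖ ^ 2 := by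
  have hz1 : Integrable z (volume.restrict (Ioo 0 T)) := hz.integrable (by norm_num)
  have hT' : T ∈ Icc 0 T := right_mem_Icc.2 hT.le
  set I := ∫ s in (0 : ℝ)..T, ‖z s‖ with hI
  have h1 : ‖∫ s in (0 : ℝ)..t, z s‖ ≤ I :=
    (intervalIntegral.norm_integral_le_integral_norm ht.1).trans
      (intervalIntegral_le_of_nonneg ht hz1.norm (Eventually.of_forall fun _ => norm_nonneg _))
  have i1 := intervalIntegrable_of_integrable (integrable_norm_sq hz) hT'
  have i2 := intervalIntegrable_of_integrable hz1.norm hT'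
  -- the variance of `‖z‖` about its mean `I / T` is nonnegative
  have h2 : 0 ≤ ∫ s in (0 : ℝ)..T, (‖z s‖ - I / T) ^ 2 :=
    intervalIntegral.integral_nonneg hT.le fun _ _ => sq_nonneg _
  have e : ∀ s, (‖z s‖ - I / T) ^ 2 = (‖z s‖ ^ 2 - 2 * (I / T) * ‖z s‖) + (I / T) ^ 2 :=
    fun s => by ring
  simp only [e] at h2
  rw [intervalIntegral.integral_add (i1.sub (i2.const_mul _)) (by simp),
    intervalIntegral.integral_sub i1 (i2.const_mul _), intervalIntegral.integral_const_mul,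
    ← hI, intervalIntegral.integral_const] at h2
  simp only [sub_zero, smul_eq_mul] at h2
  have h3 : I ^ 2 ≤ T * ∫ s in (0 : ℝ)..T, ‖z s‖ ^ 2 := by
    have : T * (I / T) = I := by field_simp
    have h4 := mul_nonneg hT.le h2
    nlinarith [h4, this]
  exact (by gcongr : _ ≤ I ^ 2).trans h3

theorem memLp_primitive (hT : 0 < T) {z : ℝ → X}
    (hz : MemLp z 2 (volume.restrict (Ioo 0 T))) :
    MemLp (fun t => ∫ s in (0 : ℝ)..t, z s) 2 (volume.restrict (Ioo 0 T)) :=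
  memLp_of_continuousOn (continuousOn_primitive hT.le hz) 2

theorem memLp_add_primitive (hT : 0 < T) (z₀ : X) {z : ℝ → X}
    (hz : MemLp z 2 (volume.restrict (Ioo 0 T))) :
    MemLp (fun t => z₀ + ∫ s in (0 : ℝ)..t, z s) 2 (volume.restrict (Ioo 0 T)) :=
  memLp_of_continuousOn (continuousOn_const.add (continuousOn_primitive hT.le hz)) 2

/-- The operator `z ↦ ∫₀ᵗ z` on `L²(0,T;X)`. -/
def primitiveL (hT : 0 < T) :
    Lp X 2 (volume.restrict (Ioo 0 T)) →L[ℝ] Lp X 2 (volume.restrict (Ioo 0 T)) :=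
  LinearMap.mkContinuous
    { toFun := fun z => (memLp_primitive hT (Lp.memLp z)).toLp
      map_add' := fun z w => by
        rw [← MemLp.toLp_add]
        apply MemLp.toLp_congr
        filter_upwards [ae_restrict_mem measurableSet_Ioo] with t ht
        have ht' := Ioo_subset_Icc_self ht
        rw [Pi.add_apply, ← intervalIntegral.integral_add
          (intervalIntegrable_of_memLp_two (Lp.memLp z) ht')
          (intervalIntegrable_of_memLp_two (Lp.memLp w) ht')]
        exact intervalIntegral_congr_of_ae ht' (Lp.coeFn_add z w)
      map_smul' := fun c z => by
        rw [RingHom.id_apply, ← MemLp.toLp_const_smul]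
        apply MemLp.toLp_congr
        filter_upwards [ae_restrict_mem measurableSet_Ioo] with t ht
        have ht' := Ioo_subset_Icc_self ht
        rw [Pi.smul_apply, ← intervalIntegral.integral_smul]
        exact intervalIntegral_congr_of_ae ht' (Lp.coeFn_smul c z) } T fun z => by
    have h0 : 0 ≤ T * ‖z‖ := mul_nonneg hT.le (norm_nonneg _)
    refine (sq_le_sq₀ (norm_nonneg _) h0).1 ?_
    have hm := memLp_primitive hT (Lp.memLp z)
    have h1 : ‖hm.toLp‖ ^ 2 ≤ (T * ‖z‖) ^ 2 := by
      rw [← integral_norm_sq_eq_norm_toLp_sq hT.le hm, mul_pow,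
        ← integral_norm_sq_eq_norm_Lp_sq hT.le z]
      have h2 : ∫ t in (0 : ℝ)..T, ‖∫ s in (0 : ℝ)..t, z s‖ ^ 2
          ≤ ∫ t in (0 : ℝ)..T, T * ∫ s in (0 : ℝ)..T, ‖z s‖ ^ 2 := by
        apply intervalIntegral_mono_of_ae (right_mem_Icc.2 hT.le) (integrable_norm_sq hm)
          (integrable_const _)
        filter_upwards [ae_restrict_mem measurableSet_Ioo] with t ht
        exact norm_primitive_sq_le hT (Lp.memLp z) (Ioo_subset_Icc_self ht)
      refine h2.trans (le_of_eq ?_)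
      rw [intervalIntegral.integral_const, sub_zero, smul_eq_mul]; ring
    exact h1

theorem coeFn_primitiveL (hT : 0 < T) (z : Lp X 2 (volume.restrict (Ioo 0 T))) :
    primitiveL hT z =ᵐ[volume.restrict (Ioo 0 T)] fun t => ∫ s in (0 : ℝ)..t, z s :=
  (memLp_primitive hT (Lp.memLp z)).coeFn_toLp

end TimeLp

/-- The image of a bounded sequence under a bounded operator between Hilbert spaces can only
converge to a point of the range: a weak limit point of the sequence is a preimage. -/
theorem exists_apply_eq_of_tendsto_of_bounded {E F : Type*} [NormedAddCommGroup E]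
    [InnerProductSpace ℝ E] [CompleteSpace E] [NormedAddCommGroup F] [InnerProductSpace ℝ F]
    [CompleteSpace F] (S : E →L[ℝ] F) {x : ℕ → E} {C : ℝ} (hx : ∀ n, ‖x n‖ ≤ C) {q : F}
    (hq : Tendsto (fun n => S (x n)) atTop (𝓝 q)) : ∃ g, S g = q := by
  have hC : 0 ≤ C := (norm_nonneg _).trans (hx 0)
  let 𝒰 : Ultrafilter ℕ := Ultrafilter.of atTop
  have h𝒰 : (𝒰 : Filter ℕ) ≤ atTop := Ultrafilter.of_le _
  have hlim : ∀ φ : E, ∃ r : ℝ, Tendsto (fun n => inner ℝ (x n) φ) 𝒰 (𝓝 r) := by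
    intro φ
    have hc : IsCompact (Icc (-(C * ‖φ‖)) (C * ‖φ‖)) := isCompact_Icc
    obtain ⟨r, -, hr⟩ := hc.ultrafilter_le_nhds (𝒰.map fun n => inner ℝ (x n) φ) (by
      rw [le_principal_iff]
      refine Filter.mem_map.2 (Eventually.of_forall fun n => abs_le.1 ?_)
      exact (abs_real_inner_le_norm _ _).trans (by gcongr; exact hx n))
    exact ⟨r, hr⟩
  choose ℓ hℓ using hlim
  let Λ : E →L[ℝ] ℝ := LinearMap.mkContinuous
    { toFun := ℓ
      map_add' := fun φ ψ => tendsto_nhds_unique (hℓ (φ + ψ))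
        (by simpa only [inner_add_right] using (hℓ φ).add (hℓ ψ))
      map_smul' := fun c φ => tendsto_nhds_unique (hℓ (c • φ))
        (by simpa only [inner_smul_right, smul_eq_mul, RingHom.id_apply]
              using (hℓ φ).const_mul c) } C fun φ => by
    refine le_of_tendsto (hℓ φ).norm (Eventually.of_forall fun n => ?_)
    exact (abs_real_inner_le_norm _ _).trans (by gcongr; exact hx n)
  refine ⟨(InnerProductSpace.toDual ℝ E).symm Λ, ext_inner_right ℝ fun φ => ?_⟩
  rw [← ContinuousLinearMap.adjoint_inner_right, InnerProductSpace.toDual_symm_apply]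
  refine tendsto_nhds_unique (hℓ _) ?_
  simp only [ContinuousLinearMap.adjoint_inner_right]
  exact (hq.mono_left h𝒰).inner tendsto_const_nhds

/-! ### Elliptic operators and the regularized problem -/

section Abstract

variable {H V : Type*} [NormedAddCommGroup H] [InnerProductSpace ℝ H] [CompleteSpace H]
  [NormedAddCommGroup V] [InnerProductSpace ℝ V] [CompleteSpace V]
  {ι : V →L[ℝ] H} {A : V →L[ℝ] V} {T : ℝ}

/-- `A` represents, through the inner product of `V`, a symmetric nonnegative form which together
with the square of the norm of the pivot space `H` dominates the norm of `V`. -/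
structure IsElliptic (ι : V →L[ℝ] H) (A : V →L[ℝ] V) : Prop where
  symm : ∀ v w, inner ℝ (A v) w = inner ℝ v (A w)
  nonneg : ∀ v, 0 ≤ inner ℝ (A v) v
  coercive : ∀ v, ‖v‖ ^ 2 ≤ inner ℝ (A v) v + ‖ι v‖ ^ 2

theorem memLp_clm_comp {X Y : Type*} [NormedAddCommGroup X] [NormedSpace ℝ X]
    [NormedAddCommGroup Y] [NormedSpace ℝ Y] {μ : Measure ℝ} {p : ENNReal} (B : X →L[ℝ] Y)
    {z : ℝ → X} (hz : MemLp z p μ) : MemLp (fun t => B (z t)) p μ :=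
  B.comp_memLp' hz

omit [CompleteSpace V] in
/-- The energy estimate for `d = (ι e)'`, `(ι e)(0) = h₀`, `⟨d, ι e⟩ + ⟨A e, e⟩ = ρ`. -/
theorem IsElliptic.energy_estimate (hA : IsElliptic ι A) (hT : 0 < T) {h₀ : H} {d : ℝ → H}
    {e : ℝ → V} {ρ : ℝ → ℝ} {R : ℝ} (hd : MemLp d 2 (volume.restrict (Ioo 0 T)))
    (he : MemLp e 2 (volume.restrict (Ioo 0 T)))
    (hde : ∀ᵐ t ∂(volume.restrict (Ioo 0 T)), ι (e t) = h₀ + ∫ s in (0 : ℝ)..t, d s)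
    (heq : ∀ᵐ t ∂(volume.restrict (Ioo 0 T)),
      inner ℝ (d t) (ι (e t)) + inner ℝ (A (e t)) (e t) = ρ t)
    (hR : ∀ t ∈ Icc 0 T, ∫ s in (0 : ℝ)..t, ρ s ≤ R) :
    (∀ t ∈ Icc 0 T, ‖h₀ + ∫ s in (0 : ℝ)..t, d s‖ ^ 2 ≤ ‖h₀‖ ^ 2 + 2 * R) ∧
      ∫ s in (0 : ℝ)..T, ‖e s‖ ^ 2 ≤ (1 + 2 * T) * (‖h₀‖ ^ 2 / 2 + R) := by
  have i1 := integrable_inner_of_memLp hd (memLp_clm_comp ι he)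
  have i2 := integrable_inner_of_memLp (memLp_clm_comp A he) he
  have hTm : T ∈ Icc 0 T := right_mem_Icc.2 hT.le
  have key : ∀ t ∈ Icc 0 T, ‖h₀ + ∫ s in (0 : ℝ)..t, d s‖ ^ 2
      + 2 * ∫ s in (0 : ℝ)..t, inner ℝ (A (e s)) (e s) ≤ ‖h₀‖ ^ 2 + 2 * R := by
    intro t ht
    have h1 := inner_primitive_eq (B := ContinuousLinearMap.id ℝ H) (fun _ _ => rfl) h₀ hd ht
    simp only [ContinuousLinearMap.id_apply, real_inner_self_eq_norm_sq] at h1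
    have h2 : ∫ s in (0 : ℝ)..t, inner ℝ (h₀ + ∫ r in (0 : ℝ)..s, d r) (d s)
        = ∫ s in (0 : ℝ)..t, inner ℝ (d s) (ι (e s)) :=
      intervalIntegral_congr_of_ae ht (by
        filter_upwards [hde] with s hs
        rw [hs, real_inner_comm])
    have h3 : (∫ s in (0 : ℝ)..t, inner ℝ (d s) (ι (e s)))
        + ∫ s in (0 : ℝ)..t, inner ℝ (A (e s)) (e s) = ∫ s in (0 : ℝ)..t, ρ s := by
      rw [← intervalIntegral.integral_add (intervalIntegrable_of_integrable i1 ht)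
        (intervalIntegrable_of_integrable i2 ht)]
      exact intervalIntegral_congr_of_ae ht heq
    have := hR t ht
    rw [h1, h2]
    linarith
  have hnn : ∀ t ∈ Icc 0 T, 0 ≤ ∫ s in (0 : ℝ)..t, inner ℝ (A (e s)) (e s) := fun t ht =>
    intervalIntegral.integral_nonneg ht.1 fun s _ => hA.nonneg _
  have hpt : ∀ t ∈ Icc 0 T, ‖h₀ + ∫ s in (0 : ℝ)..t, d s‖ ^ 2 ≤ ‖h₀‖ ^ 2 + 2 * R :=
    fun t ht => by linarith [key t ht, hnn t ht]
  refine ⟨hpt, ?_⟩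
  have h4 : ∫ s in (0 : ℝ)..T, ‖e s‖ ^ 2
      ≤ ∫ s in (0 : ℝ)..T, (inner ℝ (A (e s)) (e s) + (‖h₀‖ ^ 2 + 2 * R)) := by
    apply intervalIntegral_mono_of_ae hTm (integrable_norm_sq he) (i2.add (integrable_const _))
    filter_upwards [hde, ae_restrict_mem measurableSet_Ioo] with s hs hs'
    have := hpt s (Ioo_subset_Icc_self hs')
    rw [← hs] at this
    rw [Pi.add_apply]
    linarith [hA.coercive (e s)]
  rw [intervalIntegral.integral_add (intervalIntegrable_of_integrable i2 hTm) (by simp),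
    intervalIntegral.integral_const, sub_zero, smul_eq_mul] at h4
  have := key T hTm
  nlinarith [sq_nonneg ‖h₀ + ∫ s in (0 : ℝ)..T, d s‖]

/-- Solvability of the regularized problem `ι† ι y' + ε A y' + A y = ι† f`, `y(0) = v₀`, in terms
of `w = y'`. The left side is a coercive operator of `w ∈ L²(0,T;V)`, because `w ↦ A ∫₀ᵗ w` is
monotone and `ι† ι + ε A` is coercive. -/
theorem IsElliptic.exists_regularized (hA : IsElliptic ι A) (hT : 0 < T) {ε : ℝ} (hε : 0 < ε)
    (hε1 : ε ≤ 1) (v₀ : V) {f : ℝ → H} (hf : MemLp f 2 (volume.restrict (Ioo 0 T))) :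
    ∃ w : ℝ → V, MemLp w 2 (volume.restrict (Ioo 0 T)) ∧
      ∀ᵐ t ∂(volume.restrict (Ioo 0 T)), ι.adjoint (ι (w t)) + ε • A (w t) +
        A (v₀ + ∫ s in (0 : ℝ)..t, w s) = ι.adjoint (f t) := by
  set P : V →L[ℝ] V := ι.adjoint.comp ι + ε • A with hP
  let 𝓑 : Lp V 2 (volume.restrict (Ioo 0 T)) →L[ℝ] Lp V 2 (volume.restrict (Ioo 0 T)) :=
    P.compLpL 2 _ + (A.compLpL 2 _).comp (primitiveL hT)
  have h𝓑 : ∀ w : Lp V 2 (volume.restrict (Ioo 0 T)), ∀ᵐ t ∂(volume.restrict (Ioo 0 T)),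
      𝓑 w t = P (w t) + A (∫ s in (0 : ℝ)..t, w s) := by
    intro w
    filter_upwards [Lp.coeFn_add (P.compLpL 2 _ w) (A.compLpL 2 _ (primitiveL hT w)),
      P.coeFn_compLpL w, A.coeFn_compLpL (primitiveL hT w), coeFn_primitiveL hT w]
      with t h1 h2 h3 h4
    have : 𝓑 w t = (P.compLpL 2 _ w + A.compLpL 2 _ (primitiveL hT w) :
      Lp V 2 (volume.restrict (Ioo 0 T))) t := rfl
    rw [this, h1, Pi.add_apply, h2, h3, h4]
  have hcoer : IsCoercive ((innerSL ℝ).comp 𝓑) := by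
    refine ⟨ε, hε, fun w => ?_⟩
    have hTm : T ∈ Icc 0 T := right_mem_Icc.2 hT.le
    have hw := Lp.memLp w
    have hp := memLp_primitive hT hw
    have i1 := integrable_inner_of_memLp (memLp_clm_comp P hw) hw
    have i2 := integrable_inner_of_memLp (memLp_clm_comp A hp) hw
    have h1 := inner_primitive_eq hA.symm (0 : V) hw hTm
    simp only [zero_add, map_zero, inner_zero_left] at h1
    have h2 : ∫ s in (0 : ℝ)..T, ε * ‖w s‖ ^ 2 ≤ ∫ s in (0 : ℝ)..T, inner ℝ (P (w s)) (w s) := by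
      apply intervalIntegral_mono_of_ae hTm ((integrable_norm_sq hw).const_mul ε) i1
      refine Eventually.of_forall fun s => ?_
      simp only [hP, add_apply, ContinuousLinearMap.comp_apply,
        smul_apply, inner_add_left, ContinuousLinearMap.adjoint_inner_left,
        real_inner_self_eq_norm_sq, real_inner_smul_left]
      have := mul_le_mul_of_nonneg_left (hA.coercive (w s)) hε.le
      have := mul_le_mul_of_nonneg_right hε1 (sq_nonneg ‖ι (w s)‖)
      linarith
    have h3 : inner ℝ (𝓑 w) w = (∫ s in (0 : ℝ)..T, inner ℝ (P (w s)) (w s))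
        + ∫ s in (0 : ℝ)..T, inner ℝ (A (∫ r in (0 : ℝ)..s, w r)) (w s) := by
      rw [← intervalIntegral.integral_add (intervalIntegrable_of_integrable i1 hTm)
        (intervalIntegrable_of_integrable i2 hTm), intervalIntegral_eq_integral_Ioo hT.le,
        L2.inner_def]
      apply integral_congr_ae
      filter_upwards [h𝓑 w] with t ht
      rw [ht, inner_add_left]
    rw [intervalIntegral.integral_const_mul, integral_norm_sq_eq_norm_Lp_sq hT.le] at h2
    have h4 := hA.nonneg (∫ s in (0 : ℝ)..T, w s)
    change ε * ‖w‖ * ‖w‖ ≤ inner ℝ (𝓑 w) w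
    rw [h3]
    nlinarith
  have hg : MemLp (fun t => ι.adjoint (f t) - A v₀) 2 (volume.restrict (Ioo 0 T)) :=
    (memLp_clm_comp _ hf).sub (memLp_const _)
  set w := hcoer.continuousLinearEquivOfBilin.symm hg.toLp with hw
  have hw' : 𝓑 w = hg.toLp := by
    refine ext_inner_right ℝ fun v => ?_
    have := hcoer.continuousLinearEquivOfBilin_apply w v
    rw [hw, ContinuousLinearEquiv.apply_symm_apply] at this
    exact this.symm
  refine ⟨w, Lp.memLp w, ?_⟩
  filter_upwards [h𝓑 w, hg.coeFn_toLp] with t h1 h2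
  rw [hw', h2] at h1
  rw [map_add]
  have h3 : ι.adjoint (ι (w t)) + ε • A (w t) = P (w t) := rfl
  rw [h3, add_left_comm, ← h1]
  abel

end Abstract

/-! ### Estimates for the regularized problem -/

section Abstract

variable {H V : Type*} [NormedAddCommGroup H] [InnerProductSpace ℝ H] [CompleteSpace H]
  [NormedAddCommGroup V] [InnerProductSpace ℝ V] [CompleteSpace V]
  {ι : V →L[ℝ] H} {A : V →L[ℝ] V} {T : ℝ}

theorem apply_add_primitive {X Y : Type*} [NormedAddCommGroup X] [InnerProductSpace ℝ X]
    [CompleteSpace X] [NormedAddCommGroup Y] [InnerProductSpace ℝ Y] [CompleteSpace Y]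
    (B : X →L[ℝ] Y) (z₀ : X) {z : ℝ → X} (hz : MemLp z 2 (volume.restrict (Ioo 0 T))) {t : ℝ}
    (ht : t ∈ Icc 0 T) :
    B (z₀ + ∫ s in (0 : ℝ)..t, z s) = B z₀ + ∫ s in (0 : ℝ)..t, B (z s) := by
  rw [map_add, ContinuousLinearMap.intervalIntegral_comp_comm B
    (intervalIntegrable_of_memLp_two hz ht)]

theorem norm_add_sq_le_two_mul {X : Type*} [NormedAddCommGroup X] (a b : X) :
    ‖a + b‖ ^ 2 ≤ 2 * ‖a‖ ^ 2 + 2 * ‖b‖ ^ 2 := by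
  have h := pow_le_pow_left₀ (norm_nonneg _) (norm_add_le a b) 2
  linarith [sq_nonneg (‖a‖ - ‖b‖), add_sq ‖a‖ ‖b‖, sub_sq ‖a‖ ‖b‖]

theorem norm_sub_sq_le_two_mul {X : Type*} [NormedAddCommGroup X] (a b : X) :
    ‖a - b‖ ^ 2 ≤ 2 * ‖a‖ ^ 2 + 2 * ‖b‖ ^ 2 := by
  simpa [sub_eq_add_neg] using norm_add_sq_le_two_mul a (-b)

theorem two_mul_inner_le {X : Type*} [NormedAddCommGroup X] [InnerProductSpace ℝ X] (a b : X) :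
    2 * inner ℝ a b ≤ ‖a‖ ^ 2 + ‖b‖ ^ 2 := by
  linarith [real_inner_le_norm a b, two_mul_le_add_sq ‖a‖ ‖b‖]

omit [CompleteSpace V] in
/-- Young's inequality with the weight `√η`. -/
theorem mul_norm_apply_mul_norm_le {η D : ℝ} (hη : 0 < η) (x E : V) (hE : ‖E‖ ^ 2 ≤ 4 * D) :
    η * (‖A x‖ * ‖E‖) ≤ ‖A‖ / 2 * (√η * (η * ‖x‖ ^ 2 + 4 * D)) := by
  have e1 : η * (‖A x‖ * ‖E‖) ≤ η * ((‖A‖ * ‖x‖) * ‖E‖) := by gcongr; exact A.le_opNorm x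
  have e2 : √η * √η = η := Real.mul_self_sqrt hη.le
  have e3 : 2 * (√η * ‖x‖) * ‖E‖ ≤ η * ‖x‖ ^ 2 + 4 * D := by
    have := two_mul_le_add_sq (√η * ‖x‖) ‖E‖
    rw [mul_pow, Real.sq_sqrt hη.le] at this
    linarith
  calc η * (‖A x‖ * ‖E‖) ≤ η * ((‖A‖ * ‖x‖) * ‖E‖) := e1
    _ = (√η * √η) * ((‖A‖ * ‖x‖) * ‖E‖) := by rw [e2]
    _ = ‖A‖ / 2 * (√η * (2 * (√η * ‖x‖) * ‖E‖)) := by ring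
    _ ≤ _ := by gcongr

/-- A priori bounds for the regularized problem, uniform in `ε`. -/
theorem IsElliptic.regularized_bounds (hA : IsElliptic ι A) (hT : 0 < T) {ε : ℝ} (hε : 0 < ε)
    (hε1 : ε ≤ 1) (v₀ : V) {f : ℝ → H} (hf : MemLp f 2 (volume.restrict (Ioo 0 T)))
    {w : ℝ → V} (hw : MemLp w 2 (volume.restrict (Ioo 0 T)))
    (hweq : ∀ᵐ t ∂(volume.restrict (Ioo 0 T)), ι.adjoint (ι (w t)) + ε • A (w t) +
        A (v₀ + ∫ s in (0 : ℝ)..t, w s) = ι.adjoint (f t)) {C : ℝ}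
    (hC : (∫ s in (0 : ℝ)..T, ‖f s‖ ^ 2) + inner ℝ (A v₀) v₀ = C) :
    (∫ s in (0 : ℝ)..T, ‖ι (w s)‖ ^ 2 ≤ C) ∧ (ε * ∫ s in (0 : ℝ)..T, ‖w s‖ ^ 2 ≤ 2 * C) ∧
      ∀ t ∈ Icc 0 T, ‖v₀ + ∫ s in (0 : ℝ)..t, w s‖ ^ 2 ≤ C + 2 * ‖ι v₀‖ ^ 2 + 2 * T * C := by
  have hTm : T ∈ Icc 0 T := right_mem_Icc.2 hT.le
  have hιw := memLp_clm_comp ι hw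
  have hv : MemLp (fun t => v₀ + ∫ s in (0 : ℝ)..t, w s) 2 (volume.restrict (Ioo 0 T)) :=
    memLp_add_primitive hT v₀ hw
  have i1 := integrable_norm_sq hιw
  have i2 := (integrable_inner_of_memLp (memLp_clm_comp A hw) hw).const_mul ε
  have i3 := integrable_inner_of_memLp (memLp_clm_comp A hv) hw
  have i4 := integrable_norm_sq hf
  have key : ∀ t ∈ Icc 0 T, (∫ s in (0 : ℝ)..t, ‖ι (w s)‖ ^ 2)
      + 2 * (∫ s in (0 : ℝ)..t, ε * inner ℝ (A (w s)) (w s))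
      + inner ℝ (A (v₀ + ∫ s in (0 : ℝ)..t, w s)) (v₀ + ∫ s in (0 : ℝ)..t, w s) ≤ C := by
    intro t ht
    rw [inner_primitive_eq hA.symm v₀ hw ht]
    have j1 := intervalIntegrable_of_integrable i1 ht
    have j2 := intervalIntegrable_of_integrable i2 ht
    have j3 := intervalIntegrable_of_integrable i3 ht
    have h1 : (∫ s in (0 : ℝ)..t, ‖ι (w s)‖ ^ 2)
        + 2 * (∫ s in (0 : ℝ)..t, ε * inner ℝ (A (w s)) (w s))
        + 2 * (∫ s in (0 : ℝ)..t, inner ℝ (A (v₀ + ∫ r in (0 : ℝ)..s, w r)) (w s))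
        ≤ ∫ s in (0 : ℝ)..t, ‖f s‖ ^ 2 := by
      rw [← intervalIntegral.integral_const_mul, ← intervalIntegral.integral_const_mul,
        ← intervalIntegral.integral_add j1 (j2.const_mul 2),
        ← intervalIntegral.integral_add (j1.add (j2.const_mul 2)) (j3.const_mul 2)]
      apply intervalIntegral_mono_of_ae ht ((i1.add (i2.const_mul 2)).add (i3.const_mul 2)) i4
      filter_upwards [hweq] with s hs
      have h2 := congrArg (fun x => inner ℝ x (w s)) hs
      simp only [inner_add_left, real_inner_smul_left, ContinuousLinearMap.adjoint_inner_left,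
        real_inner_self_eq_norm_sq] at h2
      simp only [Pi.add_apply]
      linarith [two_mul_inner_le (f s) (ι (w s))]
    have h2 := intervalIntegral_le_of_nonneg ht i4 (Eventually.of_forall fun _ => sq_nonneg _)
    linarith
  have n1 : ∀ t ∈ Icc 0 T, 0 ≤ ∫ s in (0 : ℝ)..t, ‖ι (w s)‖ ^ 2 := fun t ht =>
    intervalIntegral.integral_nonneg ht.1 fun s _ => sq_nonneg _
  have n2 : ∀ t ∈ Icc 0 T, 0 ≤ ∫ s in (0 : ℝ)..t, ε * inner ℝ (A (w s)) (w s) := fun t ht =>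
    intervalIntegral.integral_nonneg ht.1 fun s _ => mul_nonneg hε.le (hA.nonneg _)
  have b1 : ∫ s in (0 : ℝ)..T, ‖ι (w s)‖ ^ 2 ≤ C := by
    linarith [key T hTm, n2 T hTm, hA.nonneg (v₀ + ∫ s in (0 : ℝ)..T, w s)]
  refine ⟨b1, ?_, fun t ht => ?_⟩
  · have h1 : ∫ s in (0 : ℝ)..T, ε * ‖w s‖ ^ 2 ≤
        ∫ s in (0 : ℝ)..T, (ε * inner ℝ (A (w s)) (w s) + ‖ι (w s)‖ ^ 2) := by
      apply intervalIntegral_mono_of_ae hTm ((integrable_norm_sq hw).const_mul ε) (i2.add i1)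
      refine Eventually.of_forall fun s => ?_
      rw [Pi.add_apply]
      have := mul_le_mul_of_nonneg_left (hA.coercive (w s)) hε.le
      have := mul_le_mul_of_nonneg_right hε1 (sq_nonneg ‖ι (w s)‖)
      linarith
    rw [intervalIntegral.integral_const_mul, intervalIntegral.integral_add
      (intervalIntegrable_of_integrable i2 hTm) (intervalIntegrable_of_integrable i1 hTm)] at h1
    linarith [key T hTm, n1 T hTm, n2 T hTm, hA.nonneg (v₀ + ∫ s in (0 : ℝ)..T, w s)]
  · have h1 := hA.coercive (v₀ + ∫ s in (0 : ℝ)..t, w s)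
    have h2 : ‖ι (v₀ + ∫ s in (0 : ℝ)..t, w s)‖ ^ 2 ≤ 2 * ‖ι v₀‖ ^ 2 + 2 * T * C := by
      rw [apply_add_primitive ι v₀ hw ht]
      have h3 := norm_primitive_sq_le hT hιw ht
      have h4 := norm_add_sq_le_two_mul (ι v₀) (∫ s in (0 : ℝ)..t, ι (w s))
      have h5 := mul_le_mul_of_nonneg_left b1 hT.le
      linarith
    linarith [key t ht, n1 t ht, n2 t ht]

/-- Two regularized solutions with parameters `ε` and `δ` differ by `O(√ε + √δ)`. -/
theorem IsElliptic.regularized_cauchy (hA : IsElliptic ι A) (hT : 0 < T) {ε δ : ℝ} (hε : 0 < ε)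
    (hε1 : ε ≤ 1) (hδ : 0 < δ) (hδ1 : δ ≤ 1) (v₀ : V) {f : ℝ → H}
    (hf : MemLp f 2 (volume.restrict (Ioo 0 T))) {w z : ℝ → V}
    (hw : MemLp w 2 (volume.restrict (Ioo 0 T)))
    (hweq : ∀ᵐ t ∂(volume.restrict (Ioo 0 T)), ι.adjoint (ι (w t)) + ε • A (w t) +
        A (v₀ + ∫ s in (0 : ℝ)..t, w s) = ι.adjoint (f t))
    (hz : MemLp z 2 (volume.restrict (Ioo 0 T)))
    (hzeq : ∀ᵐ t ∂(volume.restrict (Ioo 0 T)), ι.adjoint (ι (z t)) + δ • A (z t) +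
        A (v₀ + ∫ s in (0 : ℝ)..t, z s) = ι.adjoint (f t)) {C D R : ℝ}
    (hC : (∫ s in (0 : ℝ)..T, ‖f s‖ ^ 2) + inner ℝ (A v₀) v₀ = C)
    (hD : C + 2 * ‖ι v₀‖ ^ 2 + 2 * T * C = D)
    (hR : ‖A‖ * (C + 2 * D * T) * (√ε + √δ) = R) :
    (∀ t ∈ Icc 0 T, ‖(∫ s in (0 : ℝ)..t, ι (w s)) - ∫ s in (0 : ℝ)..t, ι (z s)‖ ^ 2 ≤ 2 * R) ∧
      ∫ t in (0 : ℝ)..T, ‖(v₀ + ∫ s in (0 : ℝ)..t, w s) - (v₀ + ∫ s in (0 : ℝ)..t, z s)‖ ^ 2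
        ≤ (1 + 2 * T) * R := by
  obtain ⟨-, bw, bwt⟩ := hA.regularized_bounds hT hε hε1 v₀ hf hw hweq hC
  obtain ⟨-, bz, bzt⟩ := hA.regularized_bounds hT hδ hδ1 v₀ hf hz hzeq hC
  have hTm : T ∈ Icc 0 T := right_mem_Icc.2 hT.le
  have hιw := memLp_clm_comp ι hw
  have hιz := memLp_clm_comp ι hz
  have hW : MemLp (fun t => v₀ + ∫ s in (0 : ℝ)..t, w s) 2 (volume.restrict (Ioo 0 T)) :=
    memLp_add_primitive hT v₀ hw
  have hZ : MemLp (fun t => v₀ + ∫ s in (0 : ℝ)..t, z s) 2 (volume.restrict (Ioo 0 T)) :=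
    memLp_add_primitive hT v₀ hz
  have hsub : ∀ t ∈ Icc 0 T, (∫ s in (0 : ℝ)..t, (ι (w s) - ι (z s)))
      = (∫ s in (0 : ℝ)..t, ι (w s)) - ∫ s in (0 : ℝ)..t, ι (z s) := fun t ht =>
    intervalIntegral.integral_sub (intervalIntegrable_of_memLp_two hιw ht)
      (intervalIntegrable_of_memLp_two hιz ht)
  have hr : MemLp (fun t => δ • A (z t) - ε • A (w t)) 2 (volume.restrict (Ioo 0 T)) :=
    ((memLp_clm_comp A hz).const_smul δ).sub ((memLp_clm_comp A hw).const_smul ε)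
  have hint := integrable_inner_of_memLp hr (hW.sub hZ)
  have hC0 : 0 ≤ C := by
    rw [← hC]
    exact add_nonneg (intervalIntegral.integral_nonneg hT.le fun s _ => sq_nonneg _) (hA.nonneg _)
  have hD0 : 0 ≤ D := by rw [← hD]; positivity
  obtain ⟨h1, h2⟩ := hA.energy_estimate hT (h₀ := 0) (d := fun t => ι (w t) - ι (z t))
    (e := fun t => (v₀ + ∫ s in (0 : ℝ)..t, w s) - (v₀ + ∫ s in (0 : ℝ)..t, z s))
    (ρ := fun t => inner ℝ (δ • A (z t) - ε • A (w t))
      ((v₀ + ∫ s in (0 : ℝ)..t, w s) - (v₀ + ∫ s in (0 : ℝ)..t, z s))) (R := R)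
    (hιw.sub hιz) (hW.sub hZ) (by
      filter_upwards [ae_restrict_mem measurableSet_Ioo] with t ht
      have ht' := Ioo_subset_Icc_self ht
      rw [map_sub, apply_add_primitive ι v₀ hw ht', apply_add_primitive ι v₀ hz ht', hsub t ht']
      abel) (by
      filter_upwards [hweq, hzeq] with t h3 h4
      rw [← map_sub, ← ContinuousLinearMap.adjoint_inner_left, ← inner_add_left]
      congr 1
      have h5 := h3.trans h4.symm
      rw [← sub_eq_zero] at h5 ⊢
      rw [← h5]
      simp only [map_sub]
      abel) (by
      intro t ht
      -- `ε ‖w‖ ‖e‖` is split so that only `√ε (ε ‖w‖²)` appears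
      have hb : ∀ s ∈ Ioo 0 T, inner ℝ (δ • A (z s) - ε • A (w s))
          ((v₀ + ∫ r in (0 : ℝ)..s, w r) - (v₀ + ∫ r in (0 : ℝ)..s, z r))
          ≤ ‖A‖ / 2 * (√ε * (ε * ‖w s‖ ^ 2 + 4 * D) + √δ * (δ * ‖z s‖ ^ 2 + 4 * D)) := by
        intro s hs
        set E := (v₀ + ∫ r in (0 : ℝ)..s, w r) - (v₀ + ∫ r in (0 : ℝ)..s, z r) with hE
        have hE' : ‖E‖ ^ 2 ≤ 4 * D := by
          have e1 := bwt s (Ioo_subset_Icc_self hs)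
          have e2 := bzt s (Ioo_subset_Icc_self hs)
          have e3 := norm_sub_sq_le_two_mul (v₀ + ∫ r in (0 : ℝ)..s, w r)
            (v₀ + ∫ r in (0 : ℝ)..s, z r)
          rw [← hE] at e3
          rw [hD] at e1 e2
          linarith
        rw [inner_sub_left, real_inner_smul_left, real_inner_smul_left]
        have e1 := abs_le.1 (abs_real_inner_le_norm (A (z s)) E)
        have e2 := abs_le.1 (abs_real_inner_le_norm (A (w s)) E)
        have e3 := mul_norm_apply_mul_norm_le (A := A) hδ (z s) E hE'
        have e4 := mul_norm_apply_mul_norm_le (A := A) hε (w s) E hE'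
        have e5 := mul_le_mul_of_nonneg_left e1.2 hδ.le
        have e6 := mul_le_mul_of_nonneg_left e2.1 hε.le
        linarith
      have iw := integrable_norm_sq hw
      have iz := integrable_norm_sq hz
      have ib := ((((iw.const_mul ε).add (integrable_const (4 * D))).const_mul √ε).add
        (((iz.const_mul δ).add (integrable_const (4 * D))).const_mul √δ)).const_mul (‖A‖ / 2)
      refine (intervalIntegral_mono_of_ae ht hint ib (by
        filter_upwards [ae_restrict_mem measurableSet_Ioo] with s hs using hb s hs)).trans ?_
      refine (intervalIntegral_le_of_nonneg ht ib (Eventually.of_forall fun s => by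
        simp only [Pi.add_apply]; positivity)).trans ?_
      have jw := intervalIntegrable_of_integrable iw hTm
      have jz := intervalIntegrable_of_integrable iz hTm
      have jc : IntervalIntegrable (fun _ : ℝ => 4 * D) volume 0 T := by simp
      simp only [Pi.add_apply]
      rw [intervalIntegral.integral_const_mul, intervalIntegral.integral_add
        (((jw.const_mul ε).add jc).const_mul _) (((jz.const_mul δ).add jc).const_mul _),
        intervalIntegral.integral_const_mul, intervalIntegral.integral_const_mul,
        intervalIntegral.integral_add (jw.const_mul ε) jc,
        intervalIntegral.integral_add (jz.const_mul δ) jc,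
        intervalIntegral.integral_const_mul, intervalIntegral.integral_const_mul,
        intervalIntegral.integral_const, sub_zero, smul_eq_mul, ← hR]
      have e1 := mul_le_mul_of_nonneg_left bw (Real.sqrt_nonneg ε)
      have e2 := mul_le_mul_of_nonneg_left bz (Real.sqrt_nonneg δ)
      simp only [intervalIntegral.integral_const_mul]
      linarith [mul_le_mul_of_nonneg_left (add_le_add e1 e2)
        (by positivity : 0 ≤ ‖A‖ / 2)])
  constructor
  · intro t ht
    have := h1 t ht
    rw [zero_add, hsub t ht] at this
    simpa using this
  · simpa using h2

end Abstract

/-! ### Strong solutions of the abstract evolution equation -/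

section Abstract

variable {H V : Type*} [NormedAddCommGroup H] [InnerProductSpace ℝ H] [CompleteSpace H]
  [NormedAddCommGroup V] [InnerProductSpace ℝ V] [CompleteSpace V]
  {ι : V →L[ℝ] H} {A : V →L[ℝ] V} {T : ℝ}

/-- Strong solutions of `y' + A y = f`, `y(0) = ι v₀`: the values `v` of `y` in `V` and the
derivative `g = y'` in `H` are both square integrable. -/
structure IsStrongSol (ι : V →L[ℝ] H) (A : V →L[ℝ] V) (T : ℝ) (f : ℝ → H) (v₀ : V)
    (v : ℝ → V) (g : ℝ → H) : Prop where
  memLp : MemLp v 2 (volume.restrict (Ioo 0 T))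
  memLp_deriv : MemLp g 2 (volume.restrict (Ioo 0 T))
  eq_primitive : ∀ᵐ t ∂(volume.restrict (Ioo 0 T)), ι (v t) = ι v₀ + ∫ s in (0 : ℝ)..t, g s
  equation : ∀ᵐ t ∂(volume.restrict (Ioo 0 T)), ι.adjoint (g t) + A (v t) = ι.adjoint (f t)

/-- The regularized solutions form a Cauchy sequence in `L²(0,T;V)`; their limit is a strong
solution, and it inherits the uniform bound in `V`. -/
theorem IsElliptic.exists_isStrongSol (hA : IsElliptic ι A) (hT : 0 < T)
    (hι : Function.Injective ι.adjoint) (v₀ : V) {f : ℝ → H}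
    (hf : MemLp f 2 (volume.restrict (Ioo 0 T))) :
    ∃ v g, IsStrongSol ι A T f v₀ v g ∧ MemLp v ⊤ (volume.restrict (Ioo 0 T)) := by
  set ε : ℕ → ℝ := fun n => 1 / ((n : ℝ) + 1) with hεdef
  have hε : ∀ n, 0 < ε n := fun n => Nat.one_div_pos_of_nat
  have hε1 : ∀ n, ε n ≤ 1 := fun n => by
    rw [hεdef, div_le_one (by positivity)]; linarith [(Nat.cast_nonneg n : (0 : ℝ) ≤ n)]
  have hεanti : ∀ n m, n ≤ m → ε m ≤ ε n := fun n m h => Nat.one_div_le_one_div h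
  have hε0 : Tendsto ε atTop (𝓝 0) := tendsto_one_div_add_atTop_nhds_zero_nat
  choose w hw hweq using fun n => hA.exists_regularized hT (hε n) (hε1 n) v₀ hf
  obtain ⟨C, hC⟩ : ∃ C, (∫ s in (0 : ℝ)..T, ‖f s‖ ^ 2) + inner ℝ (A v₀) v₀ = C := ⟨_, rfl⟩
  obtain ⟨D, hD⟩ : ∃ D, C + 2 * ‖ι v₀‖ ^ 2 + 2 * T * C = D := ⟨_, rfl⟩
  have hC0 : 0 ≤ C := by
    rw [← hC]
    exact add_nonneg (intervalIntegral.integral_nonneg hT.le fun s _ => sq_nonneg _) (hA.nonneg _)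
  have hD0 : 0 ≤ D := by rw [← hD]; positivity
  have hbd := fun n => hA.regularized_bounds hT (hε n) (hε1 n) v₀ hf (hw n) (hweq n) hC
  have hY := fun n => memLp_add_primitive hT v₀ (hw n)
  set Y : ℕ → Lp V 2 (volume.restrict (Ioo 0 T)) := fun n => (hY n).toLp with hYdef
  have hcauchy : CauchySeq Y := by
    refine cauchySeq_of_le_tendsto_0
      (fun N => √((1 + 2 * T) * (‖A‖ * (C + 2 * D * T) * (√(ε N) + √(ε N))))) ?_ ?_
    · intro n m N hn hm
      have h := (hA.regularized_cauchy hT (hε n) (hε1 n) (hε m) (hε1 m) v₀ hf (hw n) (hweq n)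
        (hw m) (hweq m) hC hD rfl).2
      rw [integral_norm_sub_sq hT.le (hY n) (hY m)] at h
      rw [dist_eq_norm]
      apply Real.le_sqrt_of_sq_le
      refine h.trans ?_
      gcongr
      · exact hεanti _ _ hn
      · exact hεanti _ _ hm
    · have h1 : Tendsto (fun N => √(ε N)) atTop (𝓝 0) := by
        simpa using hε0.sqrt
      have h2 := (((h1.add h1).const_mul (‖A‖ * (C + 2 * D * T))).const_mul (1 + 2 * T)).sqrt
      simpa using h2
  obtain ⟨v, hv⟩ := cauchySeq_tendsto_of_complete hcauchy
  -- the derivatives `ι w` are merely bounded in `L²(0,T;H)`, but by the equation their images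
  -- under `ι†` converge in `L²(0,T;V)`
  have hιw := fun n => memLp_clm_comp ι (hw n)
  have hιf := memLp_clm_comp ι.adjoint hf
  set S : Lp H 2 (volume.restrict (Ioo 0 T)) →L[ℝ] Lp V 2 (volume.restrict (Ioo 0 T)) :=
    ι.adjoint.compLpL 2 _ with hS
  have hx : ∀ n, ‖(hιw n).toLp‖ ≤ √C := fun n => by
    apply Real.le_sqrt_of_sq_le
    rw [← integral_norm_sq_eq_norm_toLp_sq hT.le]
    exact (hbd n).1
  have hSx : ∀ n, S (hιw n).toLp = hιf.toLp - ε n • A.compLpL 2 _ (hw n).toLp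
      - A.compLpL 2 _ (Y n) := by
    intro n
    apply Lp.ext
    filter_upwards [ι.adjoint.coeFn_compLpL (hιw n).toLp, (hιw n).coeFn_toLp, hιf.coeFn_toLp,
      A.coeFn_compLpL (hw n).toLp, (hw n).coeFn_toLp, A.coeFn_compLpL (Y n), (hY n).coeFn_toLp,
      Lp.coeFn_sub (hιf.toLp - ε n • A.compLpL 2 _ (hw n).toLp) (A.compLpL 2 _ (Y n)),
      Lp.coeFn_sub hιf.toLp (ε n • A.compLpL 2 _ (hw n).toLp),
      Lp.coeFn_smul (ε n) (A.compLpL 2 _ (hw n).toLp), hweq n]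
      with t h1 h2 h3 h4 h5 h6 h7 h8 h9 h10 h11
    rw [h8, Pi.sub_apply, h9, Pi.sub_apply, h10, Pi.smul_apply, h4, h5, h6, h7, h3, h1, h2, ← h11]
    abel
  have hεw : Tendsto (fun n => ε n • A.compLpL 2 _ (hw n).toLp) atTop (𝓝 0) := by
    have h1 : Tendsto (fun n => ε n • (hw n).toLp) atTop (𝓝 0) := by
      refine squeeze_zero_norm (a := fun n => √(ε n * (2 * C))) (fun n => ?_) ?_
      · apply Real.le_sqrt_of_sq_le
        have h2 := (hbd n).2.1
        rw [integral_norm_sq_eq_norm_toLp_sq hT.le (hw n)] at h2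
        rw [norm_smul, mul_pow, Real.norm_eq_abs, sq_abs, sq, mul_assoc]
        exact mul_le_mul_of_nonneg_left h2 (hε n).le
      · simpa using (hε0.mul_const (2 * C)).sqrt
    have h2 := ((A.compLpL 2 (volume.restrict (Ioo 0 T))).continuous.tendsto 0).comp h1
    simpa [Function.comp_def] using h2
  have hAY : Tendsto (fun n => A.compLpL 2 _ (Y n)) atTop (𝓝 (A.compLpL 2 _ v)) :=
    ((A.compLpL 2 _).continuous.tendsto v).comp hv
  have hSlim : Tendsto (fun n => S (hιw n).toLp) atTop (𝓝 (hιf.toLp - A.compLpL 2 _ v)) := by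
    simp only [hSx]
    simpa using (hεw.const_sub hιf.toLp).sub hAY
  obtain ⟨g, hg⟩ := exists_apply_eq_of_tendsto_of_bounded S hx hSlim
  rw [← hg] at hSlim
  refine ⟨v, g, ⟨Lp.memLp v, Lp.memLp g, ?_, ?_⟩, ?_⟩
  · -- since `ι†` is injective, the relation may be checked after applying it
    set J : V →L[ℝ] V := ι.adjoint.comp ι with hJ
    have hc : MemLp (fun _ : ℝ => J v₀) 2 (volume.restrict (Ioo 0 T)) := memLp_const _
    have e1 : ∀ n, J.compLpL 2 _ (Y n) = hc.toLp + primitiveL hT (S (hιw n).toLp) := by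
      intro n
      apply Lp.ext
      filter_upwards [J.coeFn_compLpL (Y n), (hY n).coeFn_toLp, hc.coeFn_toLp,
        Lp.coeFn_add hc.toLp (primitiveL hT (S (hιw n).toLp)),
        coeFn_primitiveL hT (S (hιw n).toLp), ae_restrict_mem measurableSet_Ioo]
        with t h1 h2 h3 h4 h5 ht
      have ht' := Ioo_subset_Icc_self ht
      rw [h1, h2, h4, Pi.add_apply, h3, h5, apply_add_primitive J v₀ (hw n) ht']
      congr 1
      apply intervalIntegral_congr_of_ae ht'
      filter_upwards [ι.adjoint.coeFn_compLpL (hιw n).toLp, (hιw n).coeFn_toLp] with s h6 h7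
      rw [h6, h7]; rfl
    have e2 : J.compLpL 2 _ v = hc.toLp + primitiveL hT (S g) :=
      tendsto_nhds_unique (((J.compLpL 2 _).continuous.tendsto v).comp hv) (by
        simp only [Function.comp_def, e1]
        exact (((primitiveL hT).continuous.tendsto _).comp hSlim).const_add _)
    have e3 : ∀ᵐ t ∂(volume.restrict (Ioo 0 T)), J.compLpL 2 _ v t
        = (hc.toLp + primitiveL hT (S g) : Lp V 2 (volume.restrict (Ioo 0 T))) t := by
      rw [e2]; exact Eventually.of_forall fun _ => rfl
    filter_upwards [e3, J.coeFn_compLpL v, hc.coeFn_toLp,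
      Lp.coeFn_add hc.toLp (primitiveL hT (S g)), coeFn_primitiveL hT (S g),
      ae_restrict_mem measurableSet_Ioo] with t h0 h1 h3 h4 h5 ht
    have ht' := Ioo_subset_Icc_self ht
    apply hι
    rw [apply_add_primitive ι.adjoint (ι v₀) (Lp.memLp g) ht']
    rw [h1, h4, Pi.add_apply, h3, h5] at h0
    refine h0.trans ?_
    congr 1
    exact intervalIntegral_congr_of_ae ht' (ι.adjoint.coeFn_compLpL g)
  · have e3 : ∀ᵐ t ∂(volume.restrict (Ioo 0 T)), S g t
        = (hιf.toLp - A.compLpL 2 _ v : Lp V 2 (volume.restrict (Ioo 0 T))) t := by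
      rw [hg]; exact Eventually.of_forall fun _ => rfl
    filter_upwards [e3, ι.adjoint.coeFn_compLpL g, Lp.coeFn_sub hιf.toLp (A.compLpL 2 _ v),
      hιf.coeFn_toLp, A.coeFn_compLpL v] with t h0 h1 h2 h3 h4
    rw [h1, h2, Pi.sub_apply, h3, h4] at h0
    rw [h0]; abel
  · obtain ⟨φ, -, hφ⟩ := (tendstoInMeasure_of_tendsto_Lp hv).exists_seq_tendsto_ae
    refine MemLp.of_bound (Lp.aestronglyMeasurable v) √D ?_
    have hall : ∀ᵐ t ∂(volume.restrict (Ioo 0 T)), ∀ n, ‖Y n t‖ ≤ √D := by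
      rw [ae_all_iff]
      intro n
      filter_upwards [(hY n).coeFn_toLp, ae_restrict_mem measurableSet_Ioo] with t h1 ht
      rw [h1, ← hD]
      exact Real.le_sqrt_of_sq_le ((hbd n).2.2 t (Ioo_subset_Icc_self ht))
    filter_upwards [hφ, hall] with t h1 h2
    exact le_of_tendsto h1.norm (Eventually.of_forall fun n => h2 _)

end Abstract

/-! ### Weak solutions of the abstract evolution equation -/

section Abstract

variable {H V : Type*} [NormedAddCommGroup H] [InnerProductSpace ℝ H] [CompleteSpace H]
  [NormedAddCommGroup V] [InnerProductSpace ℝ V] [CompleteSpace V]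
  {ι : V →L[ℝ] H} {A : V →L[ℝ] V} {T : ℝ}

/-- Weak solutions of `y' + A y = f`, `y(0) = y₀`, in the form integrated in time; `v` are the
values of `y` in `V`, and the equation, an identity in the dual of `V`, is transported to `V`. -/
structure IsWeakSol (ι : V →L[ℝ] H) (A : V →L[ℝ] V) (T : ℝ) (f : ℝ → H) (y₀ : H)
    (y : ℝ → H) (v : ℝ → V) : Prop where
  continuousOn : ContinuousOn y (Icc 0 T)
  memLp : MemLp v 2 (volume.restrict (Ioo 0 T))
  eq_apply : ∀ᵐ t ∂(volume.restrict (Ioo 0 T)), ι (v t) = y t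
  equation : ∀ t ∈ Icc 0 T,
    ι.adjoint (y t) = ι.adjoint y₀ + ∫ s in (0 : ℝ)..t, (ι.adjoint (f s) - A (v s))

/-- Weak solutions which are limits of strong ones, in the sense that their distance to each strong
solution is controlled by the distance of the initial data. -/
structure IsEnergySol (ι : V →L[ℝ] H) (A : V →L[ℝ] V) (T : ℝ) (f : ℝ → H) (y₀ : H)
    (y : ℝ → H) (v : ℝ → V) : Prop extends IsWeakSol ι A T f y₀ y v where
  norm_sub_le : ∀ v₀ z g, IsStrongSol ι A T f v₀ z g → ∀ t ∈ Icc 0 T,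
    ‖y t - (ι v₀ + ∫ s in (0 : ℝ)..t, g s)‖ ≤ ‖y₀ - ι v₀‖
  integral_sub_le : ∀ v₀ z g, IsStrongSol ι A T f v₀ z g →
    ∫ s in (0 : ℝ)..T, ‖v s - z s‖ ^ 2 ≤ (1 + 2 * T) * ‖y₀ - ι v₀‖ ^ 2

theorem IsStrongSol.isWeakSol (hT : 0 < T) {f : ℝ → H} {v₀ : V} {v : ℝ → V} {g : ℝ → H}
    (h : IsStrongSol ι A T f v₀ v g) :
    IsWeakSol ι A T f (ι v₀) (fun t => ι v₀ + ∫ s in (0 : ℝ)..t, g s) v where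
  continuousOn := continuousOn_const.add (continuousOn_primitive hT.le h.memLp_deriv)
  memLp := h.memLp
  eq_apply := h.eq_primitive
  equation t ht := by
    rw [apply_add_primitive ι.adjoint (ι v₀) h.memLp_deriv ht]
    congr 1
    apply intervalIntegral_congr_of_ae ht
    filter_upwards [h.equation] with s hs
    rw [← hs]; abel

/-- The contraction property of strong solutions with the same source. -/
theorem IsStrongSol.sub_le (hA : IsElliptic ι A) (hT : 0 < T) {f : ℝ → H} {v₀ w₀ : V}
    {v w : ℝ → V} {g k : ℝ → H} (h : IsStrongSol ι A T f v₀ v g)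
    (h' : IsStrongSol ι A T f w₀ w k) :
    (∀ t ∈ Icc 0 T, ‖(ι v₀ + ∫ s in (0 : ℝ)..t, g s) - (ι w₀ + ∫ s in (0 : ℝ)..t, k s)‖
        ≤ ‖ι v₀ - ι w₀‖) ∧
      ∫ s in (0 : ℝ)..T, ‖v s - w s‖ ^ 2 ≤ (1 + 2 * T) * ‖ι v₀ - ι w₀‖ ^ 2 := by
  have hsub : ∀ t ∈ Icc 0 T, (ι v₀ + ∫ s in (0 : ℝ)..t, g s) - (ι w₀ + ∫ s in (0 : ℝ)..t, k s)
      = (ι v₀ - ι w₀) + ∫ s in (0 : ℝ)..t, (g s - k s) := fun t ht => by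
    rw [intervalIntegral.integral_sub (intervalIntegrable_of_memLp_two h.memLp_deriv ht)
      (intervalIntegrable_of_memLp_two h'.memLp_deriv ht)]
    abel
  obtain ⟨h1, h2⟩ := hA.energy_estimate hT (h₀ := ι v₀ - ι w₀) (d := fun t => g t - k t)
    (e := fun t => v t - w t) (ρ := fun _ => 0) (R := 0) (h.memLp_deriv.sub h'.memLp_deriv)
    (h.memLp.sub h'.memLp) (by
      filter_upwards [h.eq_primitive, h'.eq_primitive, ae_restrict_mem measurableSet_Ioo]
        with t e1 e2 ht
      rw [← hsub t (Ioo_subset_Icc_self ht), map_sub, e1, e2]) (by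
      filter_upwards [h.equation, h'.equation] with t e1 e2
      rw [← ContinuousLinearMap.adjoint_inner_left, ← inner_add_left]
      have e3 := e1.trans e2.symm
      rw [← sub_eq_zero] at e3
      have e4 : ι.adjoint (g t - k t) + A (v t - w t) = 0 := by
        rw [← e3]; simp only [map_sub]; abel
      rw [e4, inner_zero_left]) (fun t _ => by simp)
  constructor
  · intro t ht
    have := h1 t ht
    rw [← hsub t ht, mul_zero, add_zero] at this
    exact (sq_le_sq₀ (norm_nonneg _) (norm_nonneg _)).1 this
  · refine h2.trans ?_
    have : 0 ≤ (1 + 2 * T) * ‖ι v₀ - ι w₀‖ ^ 2 := by positivity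
    linarith

omit [CompleteSpace H] in
theorem tendsto_primitive_of_tendsto_Lp (hT : 0 < T)
    {z : ℕ → Lp H 2 (volume.restrict (Ioo 0 T))} {z' : Lp H 2 (volume.restrict (Ioo 0 T))}
    (h : Tendsto z atTop (𝓝 z')) {t : ℝ} (ht : t ∈ Icc 0 T) :
    Tendsto (fun n => ∫ s in (0 : ℝ)..t, z n s) atTop (𝓝 (∫ s in (0 : ℝ)..t, z' s)) := by
  rw [tendsto_iff_norm_sub_tendsto_zero] at h ⊢
  have h1 := (h.const_mul √T)
  rw [mul_zero] at h1
  refine squeeze_zero (fun _ => norm_nonneg _) (fun n => ?_) h1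
  refine (sq_le_sq₀ (norm_nonneg _) (by positivity)).1 ?_
  rw [mul_pow, Real.sq_sqrt hT.le, ← integral_norm_sq_eq_norm_Lp_sq hT.le]
  refine le_trans (le_of_eq ?_) (norm_primitive_sq_le hT (Lp.memLp (z n - z')) ht)
  rw [← intervalIntegral.integral_sub (intervalIntegrable_of_memLp_two (Lp.memLp _) ht)
    (intervalIntegrable_of_memLp_two (Lp.memLp _) ht)]
  congr 2
  exact (intervalIntegral_congr_of_ae ht (Lp.coeFn_sub (z n) z')).symm

/-- The embedding of `H` into the dual of `V`, transported to `V`, is injective. -/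
theorem adjoint_injective_of_denseRange (hι : DenseRange ι) : Function.Injective ι.adjoint := by
  rw [injective_iff_map_eq_zero]
  intro h hh
  refine hι.eq_zero_of_inner_left ℝ fun w => ?_
  rw [← ContinuousLinearMap.adjoint_inner_left, hh, inner_zero_left]

/-- Existence for initial values in `H`: approximate `y₀` by elements of `V`. The difference of two
strong solutions is controlled by that of their initial values, so the solutions converge uniformly
in `H` and in `L²(0,T;V)`. -/
theorem IsElliptic.exists_isEnergySol (hA : IsElliptic ι A) (hT : 0 < T) (hι : DenseRange ι)
    (y₀ : H) {f : ℝ → H} (hf : MemLp f 2 (volume.restrict (Ioo 0 T))) :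
    ∃ y v, IsEnergySol ι A T f y₀ y v := by
  have hιa := adjoint_injective_of_denseRange hι
  obtain ⟨b, hb, hblim⟩ := mem_closure_iff_seq_limit.1 (hι y₀)
  choose v₀ hv₀ using hb
  obtain rfl : (fun n => ι (v₀ n)) = b := funext hv₀
  choose v g hs _ using fun n => hA.exists_isStrongSol hT hιa (v₀ n) hf
  have hcau := hblim.cauchySeq
  set Y : ℕ → ℝ → H := fun n t => ι (v₀ n) + ∫ s in (0 : ℝ)..t, g n s with hY
  have hYc : ∀ n m, ∀ t ∈ Icc 0 T, ‖Y n t - Y m t‖ ≤ ‖ι (v₀ n) - ι (v₀ m)‖ := fun n m =>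
    ((hs n).sub_le hA hT (hs m)).1
  have hYcau : ∀ t ∈ Icc 0 T, CauchySeq fun n => Y n t := fun t ht => by
    rw [Metric.cauchySeq_iff] at hcau ⊢
    intro η hη
    obtain ⟨N, hN⟩ := hcau η hη
    refine ⟨N, fun n hn m hm => lt_of_le_of_lt ?_ (hN n hn m hm)⟩
    rw [dist_eq_norm, dist_eq_norm]
    exact hYc n m t ht
  have hlim : ∀ t, ∃ l, t ∈ Icc 0 T → Tendsto (fun n => Y n t) atTop (𝓝 l) := fun t => by
    by_cases ht : t ∈ Icc 0 T
    · obtain ⟨l, hl⟩ := cauchySeq_tendsto_of_complete (hYcau t ht)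
      exact ⟨l, fun _ => hl⟩
    · exact ⟨0, fun h => absurd h ht⟩
  choose y hy using hlim
  have hYy : ∀ n, ∀ t ∈ Icc 0 T, ‖Y n t - y t‖ ≤ ‖ι (v₀ n) - y₀‖ := fun n t ht =>
    le_of_tendsto_of_tendsto ((hy t ht).const_sub _).norm (hblim.const_sub _).norm
      (Eventually.of_forall fun m => hYc n m t ht)
  have hunif : TendstoUniformlyOn Y y atTop (Icc 0 T) := by
    rw [Metric.tendstoUniformlyOn_iff]
    intro η hη
    filter_upwards [(tendsto_iff_norm_sub_tendsto_zero.1 hblim).eventually (gt_mem_nhds hη)]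
      with n hn t ht
    rw [dist_comm, dist_eq_norm]
    exact (hYy n t ht).trans_lt hn
  set Vs : ℕ → Lp V 2 (volume.restrict (Ioo 0 T)) := fun n => (hs n).memLp.toLp with hVs
  have hVle : ∀ n m, ‖Vs n - Vs m‖ ≤ √(1 + 2 * T) * ‖ι (v₀ n) - ι (v₀ m)‖ := fun n m => by
    have h1 := ((hs n).sub_le hA hT (hs m)).2
    rw [integral_norm_sub_sq hT.le (hs n).memLp (hs m).memLp] at h1
    refine (sq_le_sq₀ (norm_nonneg _) (by positivity)).1 ?_
    rw [mul_pow, Real.sq_sqrt (by positivity)]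
    exact h1
  have hVcau : CauchySeq Vs := by
    rw [Metric.cauchySeq_iff] at hcau ⊢
    intro η hη
    have hc : 0 < √(1 + 2 * T) := by positivity
    obtain ⟨N, hN⟩ := hcau (η / √(1 + 2 * T)) (by positivity)
    refine ⟨N, fun n hn m hm => ?_⟩
    have h1 := hN n hn m hm
    rw [dist_eq_norm] at h1 ⊢
    refine (hVle n m).trans_lt ?_
    rw [lt_div_iff₀ hc] at h1
    linarith
  obtain ⟨w, hw⟩ := cauchySeq_tendsto_of_complete hVcau
  refine ⟨y, w, ⟨⟨?_, Lp.memLp w, ?_, ?_⟩, ?_, ?_⟩⟩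
  · exact hunif.continuousOn (Eventually.of_forall fun n =>
      ((hs n).isWeakSol hT).continuousOn).frequently
  · obtain ⟨φ, hφm, hφ⟩ := (tendstoInMeasure_of_tendsto_Lp hw).exists_seq_tendsto_ae
    have hall : ∀ᵐ t ∂(volume.restrict (Ioo 0 T)), ∀ n, ι (Vs n t) = Y n t := by
      rw [ae_all_iff]
      intro n
      filter_upwards [(hs n).memLp.coeFn_toLp, (hs n).eq_primitive] with t h1 h2
      rw [hVs, h1, h2]
    filter_upwards [hφ, hall, ae_restrict_mem measurableSet_Ioo] with t h1 h2 ht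
    refine tendsto_nhds_unique ((ι.continuous.tendsto _).comp h1) ?_
    simp only [Function.comp_def, h2]
    exact (hy t (Ioo_subset_Icc_self ht)).comp hφm.tendsto_atTop
  · intro t ht
    have hif := intervalIntegrable_of_memLp_two (memLp_clm_comp ι.adjoint hf) ht
    have hAV : Tendsto (fun n => ∫ s in (0 : ℝ)..t, A (v n s)) atTop
        (𝓝 (∫ s in (0 : ℝ)..t, A (w s))) := by
      have h1 := tendsto_primitive_of_tendsto_Lp hT
        (((A.compLpL 2 (volume.restrict (Ioo 0 T))).continuous.tendsto w).comp hw) ht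
      rw [intervalIntegral_congr_of_ae ht (A.coeFn_compLpL w)] at h1
      refine h1.congr fun n => intervalIntegral_congr_of_ae ht ?_
      filter_upwards [A.coeFn_compLpL (Vs n), (hs n).memLp.coeFn_toLp] with s h2 h3
      rw [Function.comp_apply, h2, hVs, h3]
    refine tendsto_nhds_unique ((ι.adjoint.continuous.tendsto _).comp (hy t ht)) ?_
    have h2 : ∀ n, ι.adjoint (Y n t) = ι.adjoint (ι (v₀ n))
        + ((∫ s in (0 : ℝ)..t, ι.adjoint (f s)) - ∫ s in (0 : ℝ)..t, A (v n s)) := fun n => by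
      rw [((hs n).isWeakSol hT).equation t ht, intervalIntegral.integral_sub hif
        (intervalIntegrable_of_memLp_two (memLp_clm_comp A (hs n).memLp) ht)]
    simp only [Function.comp_def, h2]
    rw [intervalIntegral.integral_sub hif
      (intervalIntegrable_of_memLp_two (memLp_clm_comp A (Lp.memLp w)) ht)]
    exact ((ι.adjoint.continuous.tendsto _).comp hblim).add (hAV.const_sub _)
  · intro u₀ z k hz t ht
    exact le_of_tendsto_of_tendsto ((hy t ht).sub_const _).norm (hblim.sub_const _).norm
      (Eventually.of_forall fun n => ((hs n).sub_le hA hT hz).1 t ht)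
  · intro u₀ z k hz
    rw [integral_norm_sub_sq hT.le (Lp.memLp w) hz.memLp, Lp.toLp_coeFn]
    refine le_of_tendsto_of_tendsto ((hw.sub_const _).norm.pow 2)
      (((hblim.sub_const _).norm.pow 2).const_mul _) (Eventually.of_forall fun n => ?_)
    have h2 := ((hs n).sub_le hA hT hz).2
    rw [integral_norm_sub_sq hT.le (hs n).memLp hz.memLp] at h2
    exact h2

/-- Uniqueness of weak solutions: the difference `h` of two of them satisfies
`ι† h + A ∫₀ᵗ h = 0`, which is tested with `h`. -/
theorem IsWeakSol.unique (hA : IsElliptic ι A) (hT : 0 < T) {f : ℝ → H} {y₀ : H}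
    (hf : MemLp f 2 (volume.restrict (Ioo 0 T))) {y z : ℝ → H} {v w : ℝ → V}
    (h : IsWeakSol ι A T f y₀ y v) (h' : IsWeakSol ι A T f y₀ z w) : EqOn y z (Icc 0 T) := by
  have hTm : T ∈ Icc 0 T := right_mem_Icc.2 hT.le
  set d : ℝ → V := fun t => v t - w t with hd
  have hdm : MemLp d 2 (volume.restrict (Ioo 0 T)) := h.memLp.sub h'.memLp
  have hιd := memLp_clm_comp ι hdm
  have heq : ∀ t ∈ Icc 0 T, ι.adjoint (y t - z t) = - A (0 + ∫ s in (0 : ℝ)..t, d s) := by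
    intro t ht
    have hif := intervalIntegrable_of_memLp_two (memLp_clm_comp ι.adjoint hf) ht
    have i1 := intervalIntegrable_of_memLp_two (memLp_clm_comp A h.memLp) ht
    have i2 := intervalIntegrable_of_memLp_two (memLp_clm_comp A h'.memLp) ht
    rw [apply_add_primitive A 0 hdm ht, map_sub, h.equation t ht, h'.equation t ht,
      intervalIntegral.integral_sub hif i1, intervalIntegral.integral_sub hif i2]
    simp only [hd, map_sub, map_zero]
    rw [intervalIntegral.integral_sub i1 i2]
    abel
  have h1 := inner_primitive_eq hA.symm (0 : V) hdm hTm
  have h2 := hA.nonneg (0 + ∫ s in (0 : ℝ)..T, d s)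
  have h3 : ∫ s in (0 : ℝ)..T, inner ℝ (A (0 + ∫ r in (0 : ℝ)..s, d r)) (d s)
      = - ∫ s in (0 : ℝ)..T, ‖ι (d s)‖ ^ 2 := by
    rw [← intervalIntegral.integral_neg]
    apply intervalIntegral_congr_of_ae hTm
    filter_upwards [h.eq_apply, h'.eq_apply, ae_restrict_mem measurableSet_Ioo] with s e1 e2 hs
    have e3 := heq s (Ioo_subset_Icc_self hs)
    rw [← e1, ← e2, ← map_sub] at e3
    rw [← neg_eq_iff_eq_neg.2 e3, inner_neg_left, ContinuousLinearMap.adjoint_inner_left,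
      real_inner_self_eq_norm_sq]
  rw [h3, map_zero, inner_zero_left, zero_add] at h1
  have h4 : ∫ s in (0 : ℝ)..T, ‖ι (d s)‖ ^ 2 = 0 :=
    le_antisymm (by rw [zero_add] at h2; linarith [h1])
      (intervalIntegral.integral_nonneg hT.le fun s _ => sq_nonneg _)
  rw [intervalIntegral_eq_integral_Ioo hT.le, integral_eq_zero_iff_of_nonneg
    (fun _ => sq_nonneg _) (integrable_norm_sq hιd)] at h4
  refine Measure.eqOn_Icc_of_ae_eq volume hT.ne ?_ h.continuousOn h'.continuousOn
  rw [← restrict_Ioo_eq_restrict_Icc]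
  filter_upwards [h4, h.eq_apply, h'.eq_apply] with t e1 e2 e3
  have e4 : ‖ι (d t)‖ ^ 2 = 0 := e1
  rw [pow_eq_zero_iff two_ne_zero, norm_eq_zero, hd, map_sub, e2, e3, sub_eq_zero] at e4
  exact e4

end Abstract

/-! ### Continuous dependence on the operator -/

section Abstract

variable {H V : Type*} [NormedAddCommGroup H] [InnerProductSpace ℝ H] [CompleteSpace H]
  [NormedAddCommGroup V] [InnerProductSpace ℝ V] [CompleteSpace V]
  {ι : V →L[ℝ] H} {A : V →L[ℝ] V} {T : ℝ}

/-- Strong solutions with the same data depend continuously on the operator, in the topology of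
pointwise convergence. -/
theorem IsStrongSol.tendsto (hT : 0 < T) {f : ℝ → H} {v₀ : V} {An : ℕ → V →L[ℝ] V}
    (hAn : ∀ n, IsElliptic ι (An n)) {K : ℝ} (hK : ∀ n, ‖An n‖ ≤ K)
    (hlim : ∀ x, Tendsto (fun n => An n x) atTop (𝓝 (A x)))
    {v : ℝ → V} {g : ℝ → H} (h : IsStrongSol ι A T f v₀ v g)
    {vn : ℕ → ℝ → V} {gn : ℕ → ℝ → H} (hn : ∀ n, IsStrongSol ι (An n) T f v₀ (vn n) (gn n)) :
    (∀ t ∈ Icc 0 T, Tendsto (fun n => ∫ s in (0 : ℝ)..t, gn n s) atTop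
        (𝓝 (∫ s in (0 : ℝ)..t, g s))) ∧
      Tendsto (fun n => ∫ s in (0 : ℝ)..T, ‖vn n s - v s‖ ^ 2) atTop (𝓝 0) := by
  have hTm : T ∈ Icc 0 T := right_mem_Icc.2 hT.le
  have hr : ∀ n, MemLp (fun t => A (v t) - An n (v t)) 2 (volume.restrict (Ioo 0 T)) := fun n =>
    (memLp_clm_comp A h.memLp).sub (memLp_clm_comp (An n) h.memLp)
  set R : ℕ → ℝ := fun n => ∫ s in (0 : ℝ)..T, ‖A (v s) - An n (v s)‖ ^ 2 with hR
  have hRlim : Tendsto R atTop (𝓝 0) := by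
    have h1 : Tendsto R atTop (𝓝 (∫ _ in (0 : ℝ)..T, (0 : ℝ))) := by
      simp only [hR, intervalIntegral_eq_integral_Ioo hT.le]
      refine tendsto_integral_of_dominated_convergence (fun s => (‖A‖ + K) ^ 2 * ‖v s‖ ^ 2)
        (fun n => (integrable_norm_sq (hr n)).aestronglyMeasurable)
        ((integrable_norm_sq h.memLp).const_mul _) (fun n => Eventually.of_forall fun s => ?_)
        (Eventually.of_forall fun s => ?_)
      · rw [Real.norm_of_nonneg (sq_nonneg _), ← mul_pow]
        have e1 : ‖A (v s) - An n (v s)‖ ≤ ‖A‖ * ‖v s‖ + K * ‖v s‖ :=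
          (norm_sub_le _ _).trans (add_le_add (A.le_opNorm _)
            (((An n).le_opNorm _).trans (by gcongr; exact hK n)))
        rw [← add_mul] at e1
        gcongr
      · have e1 := (((hlim (v s)).const_sub (A (v s))).norm).pow 2
        simpa using e1
    simpa using h1
  set c : ℝ := 1 + 2 * T with hc
  have hc0 : 0 < c := by positivity
  have hsub : ∀ n, ∀ t ∈ Icc 0 T, ∫ s in (0 : ℝ)..t, (gn n s - g s)
      = (∫ s in (0 : ℝ)..t, gn n s) - ∫ s in (0 : ℝ)..t, g s := fun n t ht =>
    intervalIntegral.integral_sub (intervalIntegrable_of_memLp_two (hn n).memLp_deriv ht)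
      (intervalIntegrable_of_memLp_two h.memLp_deriv ht)
  have key : ∀ n, (∀ t ∈ Icc 0 T,
      ‖(∫ s in (0 : ℝ)..t, gn n s) - ∫ s in (0 : ℝ)..t, g s‖ ^ 2 ≤ 2 * c * R n) ∧
      ∫ s in (0 : ℝ)..T, ‖vn n s - v s‖ ^ 2 ≤ c ^ 2 * R n := by
    intro n
    have he : MemLp (fun t => vn n t - v t) 2 (volume.restrict (Ioo 0 T)) :=
      (hn n).memLp.sub h.memLp
    set E : ℝ := ∫ s in (0 : ℝ)..T, ‖vn n s - v s‖ ^ 2 with hE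
    obtain ⟨h1, h2⟩ := (hAn n).energy_estimate hT (h₀ := 0) (d := fun t => gn n t - g t)
      (e := fun t => vn n t - v t)
      (ρ := fun t => inner ℝ (A (v t) - An n (v t)) (vn n t - v t))
      (R := c / 2 * R n + 1 / (2 * c) * E) ((hn n).memLp_deriv.sub h.memLp_deriv) he (by
        filter_upwards [(hn n).eq_primitive, h.eq_primitive, ae_restrict_mem measurableSet_Ioo]
          with t e1 e2 ht
        rw [hsub n t (Ioo_subset_Icc_self ht), map_sub, e1, e2]
        abel) (by
        filter_upwards [(hn n).equation, h.equation] with t e1 e2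
        rw [← ContinuousLinearMap.adjoint_inner_left, ← inner_add_left]
        congr 1
        have e3 := e1.trans e2.symm
        rw [← sub_eq_zero] at e3 ⊢
        rw [← e3]
        simp only [map_sub]
        abel) (by
        intro t ht
        have i1 := integrable_norm_sq (hr n)
        have i2 := integrable_norm_sq he
        have i3 := (i1.const_mul (c / 2)).add (i2.const_mul (1 / (2 * c)))
        refine (intervalIntegral_mono_of_ae ht (integrable_inner_of_memLp (hr n) he) i3
          (Eventually.of_forall fun s => ?_)).trans ?_
        · -- Young's inequality with the weight `c`
          have e1 := real_inner_le_norm (A (v s) - An n (v s)) (vn n s - v s)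
          set a := ‖A (v s) - An n (v s)‖
          set b := ‖vn n s - v s‖
          have e2 : c / 2 * a ^ 2 + 1 / (2 * c) * b ^ 2 - a * b
              = 1 / (2 * c) * (c * a - b) ^ 2 := by field_simp; ring
          have e3 : 0 ≤ 1 / (2 * c) * (c * a - b) ^ 2 := by positivity
          rw [Pi.add_apply]
          linarith
        · refine (intervalIntegral_le_of_nonneg ht i3 (Eventually.of_forall fun s => ?_)).trans
            (le_of_eq ?_)
          · rw [Pi.add_apply]; positivity
          · simp only [Pi.add_apply]
            rw [intervalIntegral.integral_add
              ((intervalIntegrable_of_integrable i1 hTm).const_mul _)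
              ((intervalIntegrable_of_integrable i2 hTm).const_mul _),
              intervalIntegral.integral_const_mul, intervalIntegral.integral_const_mul])
    rw [norm_zero, ← hc] at h2
    have e1 : c * (1 / (2 * c) * E) = E / 2 := by field_simp
    have h3 : E ≤ c ^ 2 * R n := by
      have : c * (0 ^ 2 / 2 + (c / 2 * R n + 1 / (2 * c) * E))
          = c ^ 2 * R n / 2 + c * (1 / (2 * c) * E) := by ring
      rw [this, e1] at h2
      linarith
    refine ⟨fun t ht => ?_, h3⟩
    have h4 := h1 t ht
    rw [zero_add, hsub n t ht, norm_zero] at h4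
    have e2 : 2 * (1 / (2 * c) * E) = E / c := by field_simp
    have e3 : E / c ≤ c * R n := by
      rw [div_le_iff₀ hc0]; linarith [h3, (by ring : c * R n * c = c ^ 2 * R n)]
    linarith
  constructor
  · intro t ht
    rw [tendsto_iff_norm_sub_tendsto_zero]
    refine squeeze_zero (fun _ => norm_nonneg _)
      (fun n => Real.le_sqrt_of_sq_le ((key n).1 t ht)) ?_
    simpa using (hRlim.const_mul (2 * c)).sqrt
  · refine squeeze_zero (fun n => intervalIntegral.integral_nonneg hT.le fun s _ => sq_nonneg _)
      (fun n => (key n).2) ?_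
    simpa using hRlim.const_mul (c ^ 2)

/-- Weak solutions with the same data depend continuously on the operator, in the topology of
pointwise convergence: approximate the initial value by elements of `V`. -/
theorem IsEnergySol.tendsto (hT : 0 < T) (hι : DenseRange ι) {f : ℝ → H}
    (hf : MemLp f 2 (volume.restrict (Ioo 0 T))) {y₀ : H} (hA : IsElliptic ι A)
    {An : ℕ → V →L[ℝ] V} (hAn : ∀ n, IsElliptic ι (An n)) {K : ℝ} (hK : ∀ n, ‖An n‖ ≤ K)
    (hlim : ∀ x, Tendsto (fun n => An n x) atTop (𝓝 (A x)))
    {y : ℝ → H} {v : ℝ → V} (h : IsEnergySol ι A T f y₀ y v)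
    {yn : ℕ → ℝ → H} {vn : ℕ → ℝ → V} (hn : ∀ n, IsEnergySol ι (An n) T f y₀ (yn n) (vn n)) :
    (∀ t ∈ Icc 0 T, Tendsto (fun n => yn n t) atTop (𝓝 (y t))) ∧
      Tendsto (fun n => (hn n).memLp.toLp) atTop (𝓝 h.memLp.toLp) := by
  have hιa := adjoint_injective_of_denseRange hι
  have happ : ∀ η > 0, ∃ v₀, ‖y₀ - ι v₀‖ < η := fun η hη => by
    obtain ⟨v₀, hv₀⟩ := hι.exists_dist_lt y₀ hη
    exact ⟨v₀, by rwa [dist_eq_norm] at hv₀⟩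
  constructor
  · intro t ht
    rw [Metric.tendsto_atTop']
    intro η hη
    obtain ⟨v₀, hv₀⟩ := happ (η / 3) (by positivity)
    obtain ⟨z, g, hz, -⟩ := hA.exists_isStrongSol hT hιa v₀ hf
    choose zn gn hzn _ using fun n => (hAn n).exists_isStrongSol hT hιa v₀ hf
    obtain ⟨N, hN⟩ := Metric.tendsto_atTop'.1 ((IsStrongSol.tendsto hT hAn hK hlim hz hzn).1 t ht)
      (η / 3) (by positivity)
    refine ⟨N, fun n hnN => ?_⟩
    have h1 := hN n hnN
    have h2 := (hn n).norm_sub_le v₀ _ _ (hzn n) t ht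
    have h3 := h.norm_sub_le v₀ _ _ hz t ht
    rw [dist_eq_norm] at h1 ⊢
    have e : yn n t - y t = (yn n t - (ι v₀ + ∫ s in (0 : ℝ)..t, gn n s))
        + ((∫ s in (0 : ℝ)..t, gn n s) - ∫ s in (0 : ℝ)..t, g s)
        - (y t - (ι v₀ + ∫ s in (0 : ℝ)..t, g s)) := by abel
    rw [e]
    have e1 := _root_.norm_sub_le ((yn n t - (ι v₀ + ∫ s in (0 : ℝ)..t, gn n s))
        + ((∫ s in (0 : ℝ)..t, gn n s) - ∫ s in (0 : ℝ)..t, g s))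
        (y t - (ι v₀ + ∫ s in (0 : ℝ)..t, g s))
    have e2 := norm_add_le (yn n t - (ι v₀ + ∫ s in (0 : ℝ)..t, gn n s))
        ((∫ s in (0 : ℝ)..t, gn n s) - ∫ s in (0 : ℝ)..t, g s)
    linarith
  · rw [Metric.tendsto_atTop']
    intro η hη
    have hc : 0 < √(1 + 2 * T) := by positivity
    obtain ⟨v₀, hv₀⟩ := happ (η / 3 / √(1 + 2 * T)) (by positivity)
    rw [lt_div_iff₀ hc] at hv₀
    obtain ⟨z, g, hz, -⟩ := hA.exists_isStrongSol hT hιa v₀ hf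
    choose zn gn hzn _ using fun n => (hAn n).exists_isStrongSol hT hιa v₀ hf
    obtain ⟨N, hN⟩ := Metric.tendsto_atTop'.1 (IsStrongSol.tendsto hT hAn hK hlim hz hzn).2
      ((η / 3) ^ 2) (by positivity)
    refine ⟨N, fun n hnN => ?_⟩
    have hsq : ∀ a b : Lp V 2 (volume.restrict (Ioo 0 T)),
        ‖a - b‖ ^ 2 ≤ (1 + 2 * T) * ‖y₀ - ι v₀‖ ^ 2 → ‖a - b‖ < η / 3 := by
      intro a b hab
      refine lt_of_le_of_lt ?_ hv₀
      refine (sq_le_sq₀ (norm_nonneg _) (by positivity)).1 ?_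
      rw [mul_pow, Real.sq_sqrt (by positivity)]
      linarith
    have h1 := hN n hnN
    rw [Real.dist_eq, sub_zero, integral_norm_sub_sq hT.le (hzn n).memLp hz.memLp,
      abs_of_nonneg (sq_nonneg _)] at h1
    have h1' := lt_of_pow_lt_pow_left₀ 2 (by positivity) h1
    have h2 := (hn n).integral_sub_le v₀ _ _ (hzn n)
    have h3 := h.integral_sub_le v₀ _ _ hz
    rw [integral_norm_sub_sq hT.le (hn n).memLp (hzn n).memLp] at h2
    rw [integral_norm_sub_sq hT.le h.memLp hz.memLp] at h3
    have h2' := hsq _ _ h2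
    have h3' := hsq _ _ h3
    rw [dist_eq_norm]
    have e : (hn n).memLp.toLp - h.memLp.toLp = ((hn n).memLp.toLp - (hzn n).memLp.toLp)
        + ((hzn n).memLp.toLp - hz.memLp.toLp) - (h.memLp.toLp - hz.memLp.toLp) := by abel
    rw [e]
    have e1 := _root_.norm_sub_le (((hn n).memLp.toLp - (hzn n).memLp.toLp)
        + ((hzn n).memLp.toLp - hz.memLp.toLp)) (h.memLp.toLp - hz.memLp.toLp)
    have e2 := norm_add_le ((hn n).memLp.toLp - (hzn n).memLp.toLp)
        ((hzn n).memLp.toLp - hz.memLp.toLp)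
    linarith

end Abstract

/-! ### Functions of two variables and multiplication operators -/

section Curry

/-- A map into a separable metric space is measurable if its distances to all points are. -/
theorem measurable_of_measurable_dist {α E : Type*} [MeasurableSpace α] [PseudoMetricSpace E]
    [SecondCountableTopology E] [MeasurableSpace E] [BorelSpace E] {F : α → E}
    (h : ∀ c, Measurable fun t => dist (F t) c) : Measurable F := by
  refine measurable_of_isOpen fun U hU => ?_
  choose! r hr hrU using Metric.isOpen_iff.1 hU
  obtain ⟨S, -, hS, hSU⟩ := TopologicalSpace.isOpen_biUnion_countable U
    (fun x => Metric.ball x (r x)) fun x _ => Metric.isOpen_ball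
  have hU' : U = ⋃ x ∈ S, Metric.ball x (r x) := by
    rw [hSU]
    refine Subset.antisymm (fun x hx => mem_biUnion hx (Metric.mem_ball_self (hr x hx)))
      (iUnion₂_subset fun x hx => hrU x hx)
  rw [hU', preimage_iUnion₂]
  exact MeasurableSet.biUnion hS fun x _ => (h x) measurableSet_Iio

/-- A square integrable function of two variables is a square integrable function of the first
variable with values in the square integrable functions of the second. -/
theorem exists_memLp_curry {μ ν : Measure ℝ} [IsFiniteMeasure μ] [IsFiniteMeasure ν]
    {f : ℝ × ℝ → ℝ} (hf : MemLp f 2 (μ.prod ν)) :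
    ∃ F : ℝ → Lp ℝ 2 ν, MemLp F 2 μ ∧ ∀ᵐ t ∂μ, F t =ᵐ[ν] fun x => f (t, x) := by
  classical
  set f' := hf.1.mk f with hf'
  have hf'm : StronglyMeasurable f' := hf.1.stronglyMeasurable_mk
  have hff' : f =ᵐ[μ.prod ν] f' := hf.1.ae_eq_mk
  have hf'2 : MemLp f' 2 (μ.prod ν) := (memLp_congr_ae hff').1 hf
  have hsq : Integrable (fun p => f' p ^ 2) (μ.prod ν) := hf'2.integrable_sq
  set N : Set ℝ := {t | Integrable (fun x => f' (t, x) ^ 2) ν} with hN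
  have hNm : MeasurableSet N :=
    measurableSet_integrable (f := fun t x => f' (t, x) ^ 2) (hf'm.pow 2)
  have hslice : ∀ t, AEStronglyMeasurable (fun x => f' (t, x)) ν := fun t =>
    (hf'm.comp_measurable measurable_prodMk_left).aestronglyMeasurable
  have hmem : ∀ t ∈ N, MemLp (fun x => f' (t, x)) 2 ν := fun t ht =>
    (memLp_two_iff_integrable_sq (hslice t)).2 ht
  set F : ℝ → Lp ℝ 2 ν := fun t => if h : t ∈ N then (hmem t h).toLp else 0 with hF
  have hFae : ∀ t ∈ N, F t =ᵐ[ν] fun x => f' (t, x) := fun t ht => by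
    simp only [hF, dif_pos ht]
    exact (hmem t ht).coeFn_toLp
  have hNae : ∀ᵐ t ∂μ, t ∈ N := hsq.prod_right_ae
  let _ : MeasurableSpace (Lp ℝ 2 ν) := borel _
  have _ : BorelSpace (Lp ℝ 2 ν) := ⟨rfl⟩
  have _ : Fact ((2 : ENNReal) ≠ ⊤) := ⟨by simp⟩
  have hFm : Measurable F := by
    refine measurable_of_measurable_dist fun c => ?_
    have h1 : ∀ t, dist (F t) c = √(∫ x, (N.indicator (fun _ => (1 : ℝ)) t * f' (t, x)
        - c x) ^ 2 ∂ν) := by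
      intro t
      rw [dist_eq_norm, ← Real.sqrt_sq (norm_nonneg (F t - c)), ← real_inner_self_eq_norm_sq,
        L2.inner_def]
      congr 1
      apply integral_congr_ae
      by_cases ht : t ∈ N
      · filter_upwards [Lp.coeFn_sub (F t) c, hFae t ht] with x e1 e2
        rw [e1, Pi.sub_apply, e2, real_inner_self_eq_norm_sq, Real.norm_eq_abs, sq_abs]
        simp [ht]
      · have e0 : F t = 0 := by simp only [hF, dif_neg ht]
        filter_upwards [Lp.coeFn_sub (F t) c, Lp.coeFn_zero ℝ 2 ν] with x e1 e2
        rw [e1, Pi.sub_apply, e0, e2, real_inner_self_eq_norm_sq, Real.norm_eq_abs, sq_abs]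
        simp [ht]
    simp only [h1]
    have h2 : StronglyMeasurable fun p : ℝ × ℝ =>
        (N.indicator (fun _ => (1 : ℝ)) p.1 * f' (p.1, p.2) - c p.2) ^ 2 :=
      ((((stronglyMeasurable_const.indicator hNm).comp_measurable measurable_fst).mul hf'm).sub
        ((Lp.stronglyMeasurable c).comp_measurable measurable_snd)).pow 2
    exact (h2.integral_prod_right'.measurable).sqrt
  have hFsq : ∀ t ∈ N, ‖F t‖ ^ 2 = ∫ x, f' (t, x) ^ 2 ∂ν := fun t ht => by
    rw [← real_inner_self_eq_norm_sq, L2.inner_def]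
    apply integral_congr_ae
    filter_upwards [hFae t ht] with x e2
    rw [e2, real_inner_self_eq_norm_sq, Real.norm_eq_abs, sq_abs]
  refine ⟨F, ?_, ?_⟩
  · rw [memLp_two_iff_integrable_sq_norm hFm.aestronglyMeasurable]
    refine hsq.integral_prod_left.congr ?_
    filter_upwards [hNae] with t ht using (hFsq t ht).symm
  · filter_upwards [hNae, Measure.ae_ae_of_ae_prod hff'] with t ht h1
    exact (hFae t ht).trans (EventuallyEq.symm h1)

end Curry

section Multiplication

variable {L : ℝ}

/-- Multiplication by an essentially bounded function on `L²(0,L)`. -/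
def mulOp {m : ℝ → ℝ} (hm : MemLp m ⊤ (volume.restrict (Ioo 0 L))) : L2 L →L[ℝ] L2 L :=
  (ContinuousLinearMap.mul ℝ ℝ).holderL (volume.restrict (Ioo 0 L)) ⊤ 2 2 hm.toLp

theorem coeFn_mulOp {m : ℝ → ℝ} (hm : MemLp m ⊤ (volume.restrict (Ioo 0 L))) (q : L2 L) :
    mulOp hm q =ᵐ[volume.restrict (Ioo 0 L)] fun x => m x * q x := by
  filter_upwards [(ContinuousLinearMap.mul ℝ ℝ).coeFn_holder (r := 2) hm.toLp q,
    hm.coeFn_toLp] with x h1 h2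
  have h3 : mulOp hm q x = (ContinuousLinearMap.mul ℝ ℝ).holder 2 hm.toLp q x := rfl
  rw [h3, h1, h2, ContinuousLinearMap.mul_apply']

theorem norm_mulOp_le {m : ℝ → ℝ} (hm : MemLp m ⊤ (volume.restrict (Ioo 0 L))) {C : ℝ}
    (hC0 : 0 ≤ C) (hC : ∀ᵐ x ∂(volume.restrict (Ioo 0 L)), |m x| ≤ C) : ‖mulOp hm‖ ≤ C := by
  refine ContinuousLinearMap.opNorm_le_bound _ hC0 fun q => ?_
  apply Lp.norm_le_mul_norm_of_ae_le_mul
  filter_upwards [coeFn_mulOp hm q, hC] with x h1 h2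
  rw [h1, norm_mul]
  gcongr
  exact h2

theorem inner_L2_eq (p q : L2 L) : inner ℝ p q = ∫ x in Ioo 0 L, p x * q x := by
  rw [L2.inner_def]
  refine integral_congr_ae (Eventually.of_forall fun x => ?_)
  simp [mul_comm]

/-- Multiplication operators converge pointwise when the factors are uniformly bounded and
converge almost everywhere. -/
theorem tendsto_mulOp {m : ℝ → ℝ} {mn : ℕ → ℝ → ℝ} (hm : MemLp m ⊤ (volume.restrict (Ioo 0 L)))
    (hmn : ∀ n, MemLp (mn n) ⊤ (volume.restrict (Ioo 0 L))) {C : ℝ}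
    (hC : ∀ᵐ x ∂(volume.restrict (Ioo 0 L)), |m x| ≤ C)
    (hCn : ∀ n, ∀ᵐ x ∂(volume.restrict (Ioo 0 L)), |mn n x| ≤ C)
    (hlim : ∀ᵐ x ∂(volume.restrict (Ioo 0 L)), Tendsto (fun n => mn n x) atTop (𝓝 (m x)))
    (q : L2 L) : Tendsto (fun n => mulOp (hmn n) q) atTop (𝓝 (mulOp hm q)) := by
  rw [tendsto_iff_norm_sub_tendsto_zero]
  have h1 : ∀ n, ‖mulOp (hmn n) q - mulOp hm q‖ ^ 2
      = ∫ x in Ioo 0 L, ((mn n x - m x) * q x) ^ 2 := fun n => by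
    rw [← real_inner_self_eq_norm_sq, inner_L2_eq]
    apply integral_congr_ae
    filter_upwards [Lp.coeFn_sub (mulOp (hmn n) q) (mulOp hm q), coeFn_mulOp (hmn n) q,
      coeFn_mulOp hm q] with x e1 e2 e3
    rw [e1, Pi.sub_apply, e2, e3]; ring
  have h2 : Tendsto (fun n => ∫ x in Ioo 0 L, ((mn n x - m x) * q x) ^ 2) atTop
      (𝓝 (∫ _ in Ioo 0 L, (0 : ℝ))) := by
    refine tendsto_integral_of_dominated_convergence (fun x => (2 * C) ^ 2 * (q x) ^ 2)
      (fun n => ((((hmn n).1.sub hm.1).mul (Lp.aestronglyMeasurable q)).pow 2))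
      ((Lp.memLp q).integrable_sq.const_mul _) (fun n => ?_) ?_
    · filter_upwards [hC, hCn n] with x e1 e2
      rw [Real.norm_of_nonneg (sq_nonneg _), mul_pow]
      gcongr ?_ * _
      rw [← sq_abs]
      have e3 := abs_sub (mn n x) (m x)
      have e4 : |mn n x - m x| ≤ 2 * C := by linarith
      gcongr
    · filter_upwards [hlim] with x e1
      simpa using ((e1.sub_const (m x)).mul_const (q x)).pow 2
  have h3 := h2.sqrt
  simp only [← h1, integral_zero, Real.sqrt_zero, Real.sqrt_sq (norm_nonneg _)] at h3
  exact h3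

end Multiplication

/-! ### Completeness of the weighted spaces -/

section Weight

variable {L x₀ : ℝ} {u w : ℝ → ℝ}

/-- Weights of the spaces `H¹_u(0,L)`: continuous on `[0,L]` and positive off `x₀`. -/
structure IsWeight (L x₀ : ℝ) (u : ℝ → ℝ) : Prop where
  continuousOn : ContinuousOn u (Icc 0 L)
  pos : ∀ x ∈ Icc 0 L, x ≠ x₀ → 0 < u x

theorem IsWeight.ae_pos (hu : IsWeight L x₀ u) :
    ∀ᵐ x ∂(volume.restrict (Ioo 0 L)), 0 < u x := by
  filter_upwards [ae_restrict_mem measurableSet_Ioo,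
    ae_restrict_of_ae (Measure.ae_ne volume x₀)] with x hx hx0
  exact hu.pos x (Ioo_subset_Icc_self hx) hx0

theorem uIcc_subset_Icc_zero {e x : ℝ} (he : e ∈ Icc 0 L) (hx : x ∈ Icc 0 L) :
    uIcc e x ⊆ Icc 0 L := by
  intro z hz
  exact ⟨(le_min he.1 hx.1).trans hz.1, hz.2.trans (max_le he.2 hx.2)⟩

/-- On intervals avoiding `x₀`, dividing an `L²` function by `√u` keeps it integrable. -/
theorem IsWeight.intervalIntegrable_div (hu : IsWeight L x₀ u) (q : L2 L) {e x : ℝ}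
    (he : e ∈ Icc 0 L) (hx : x ∈ Icc 0 L) (h0 : x₀ ∉ uIcc e x) :
    IntervalIntegrable (fun s => q s / √(u s)) volume e x := by
  have hsub := uIcc_subset_Icc_zero he hx
  have h1 : Integrable q (volume.restrict (Ioo 0 L)) := (Lp.memLp q).integrable (by norm_num)
  have h2 : IntegrableOn q (Icc 0 L) volume := (integrableOn_Icc_iff_integrableOn_Ioo).2 h1
  have h3 : IntervalIntegrable q volume e x :=
    (h2.mono_set hsub).intervalIntegrable
  have h4 : ContinuousOn (fun s => (√(u s))⁻¹) (uIcc e x) := by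
    refine ContinuousOn.inv₀ (Real.continuous_sqrt.comp_continuousOn (hu.continuousOn.mono hsub))
      fun s hs => ?_
    exact (Real.sqrt_pos.2 (hu.pos s (hsub hs) fun h => h0 (h ▸ hs))).ne'
  simpa only [div_eq_mul_inv] using h3.mul_continuousOn h4

theorem snd_ae_eq (p : H1 L x₀ u) : (p : WithLp 2 (L2 L × L2 L)).snd
    =ᵐ[volume.restrict (Ioo 0 L)] fun x => √(u x) * spaceDeriv L x₀ (toL2 p) x := p.2.2

theorem uIoc_subset_Ioc_zero {e x : ℝ} (he : e ∈ Icc 0 L) (hx : x ∈ Icc 0 L) :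
    uIoc e x ⊆ Ioc 0 L := by
  intro z hz
  exact ⟨(le_min he.1 hx.1).trans_lt hz.1, hz.2.trans (max_le he.2 hx.2)⟩

theorem ae_restrict_uIoc_of_Ioo {e x : ℝ} (he : e ∈ Icc 0 L) (hx : x ∈ Icc 0 L) {P : ℝ → Prop}
    (h : ∀ᵐ s ∂(volume.restrict (Ioo 0 L)), P s) : ∀ᵐ s ∂(volume.restrict (uIoc e x)), P s := by
  rw [restrict_Ioo_eq_restrict_Ioc] at h
  exact ae_restrict_of_ae_restrict_of_subset (uIoc_subset_Ioc_zero he hx) h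

/-- Elements of `H¹_u(0,L)` are recovered from `√u y_x` by integrating from the end point on the
same side of `x₀`. -/
theorem IsWeight.fst_eq_integral (hu : IsWeight L x₀ u) (hL : 0 < L) {p : WithLp 2 (L2 L × L2 L)}
    (hp : p ∈ H1 L x₀ u) {e : ℝ} (he : e = 0 ∨ e = L) :
    ∀ᵐ x ∂(volume.restrict (Ioo 0 L)), x₀ ∉ uIcc e x →
      p.fst x = ∫ s in e..x, p.snd s / √(u s) := by
  obtain ⟨⟨g, hg, hg0, hgL⟩, hsnd⟩ := hp
  have heI : e ∈ Icc 0 L := by rcases he with rfl | rfl <;> simp [hL.le]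
  have hge : g e = 0 := by rcases he with rfl | rfl <;> assumption
  filter_upwards [hg.2, ae_restrict_mem measurableSet_Ioo] with x hx hxI h0
  have hxI' := Ioo_subset_Icc_self hxI
  have hac : AbsolutelyContinuousOnInterval g e x := by
    have h1 := hg.1 (min e x) (max e x) (le_min heI.1 hxI'.1) min_le_max
      (max_le heI.2 hxI'.2) h0
    exact h1.mono (by rw [uIcc_of_le (min_le_max : min e x ≤ max e x)]; rfl)
  have h2 := hac.integral_deriv_eq_sub
  rw [hge, sub_zero] at h2
  rw [hx, ← h2]
  apply intervalIntegral.integral_congr_ae_restrict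
  filter_upwards [ae_restrict_uIoc_of_Ioo heI hxI' hg.deriv_ae_eq,
    ae_restrict_uIoc_of_Ioo heI hxI' hsnd, ae_restrict_uIoc_of_Ioo heI hxI' hu.ae_pos]
    with s h3 h4 h5
  rw [h4, h3, mul_div_cancel_left₀ _ (Real.sqrt_pos.2 h5).ne']

/-- The converse of `IsWeight.fst_eq_integral`. -/
theorem IsWeight.mem_H1 (hu : IsWeight L x₀ u) (hx₀ : x₀ ∈ Ioo 0 L)
    {p : WithLp 2 (L2 L × L2 L)}
    (h : ∀ e, e = 0 ∨ e = L → ∀ᵐ x ∂(volume.restrict (Ioo 0 L)), x₀ ∉ uIcc e x →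
      p.fst x = ∫ s in e..x, p.snd s / √(u s)) : p ∈ H1 L x₀ u := by
  have hL : 0 < L := hx₀.1.trans hx₀.2
  have h0m : (0 : ℝ) ∈ Icc 0 L := left_mem_Icc.2 hL.le
  have hLm : L ∈ Icc 0 L := right_mem_Icc.2 hL.le
  set q : ℝ → ℝ := fun s => p.snd s / √(u s) with hq
  set g : ℝ → ℝ := fun x => if x < x₀ then ∫ s in (0 : ℝ)..x, q s else ∫ s in L..x, q s with hg
  have hgl : ∀ x, x < x₀ → g x = ∫ s in (0 : ℝ)..x, q s := fun x hx => by
    simp only [hg, if_pos hx]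
  have hgr : ∀ x, x₀ < x → g x = ∫ s in L..x, q s := fun x hx => by
    simp only [hg, if_neg hx.le.not_gt]
  -- `q` is integrable between an end point and any point on the same side of `x₀`
  have hql : ∀ b ∈ Icc 0 L, b < x₀ → IntervalIntegrable q volume 0 b := fun b hb hb0 =>
    hu.intervalIntegrable_div p.snd h0m hb (by rw [uIcc_of_le hb.1]; simp [hb0])
  have hqr : ∀ b ∈ Icc 0 L, x₀ < b → IntervalIntegrable q volume L b := fun b hb hb0 =>
    hu.intervalIntegrable_div p.snd hLm hb (by rw [uIcc_of_ge hb.2]; simp [hb0])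
  have hrep : IsACRep L x₀ p.fst g := by
    constructor
    · intro a b ha hab hb h0
      rw [mem_Icc, not_and_or, not_le, not_le] at h0
      have haI : a ∈ Icc 0 L := ⟨ha, hab.trans hb⟩
      have hbI : b ∈ Icc 0 L := ⟨ha.trans hab, hb⟩
      rcases h0 with h0 | h0
      · have hac := (hqr a haI h0).absolutelyContinuousOnInterval_intervalIntegral left_mem_uIcc
        refine absolutelyContinuousOnInterval_of_dist_le 1 (hac.mono (c := a) (d := b) ?_)
          fun s hs r hr => ?_
        · rw [uIcc_of_le hab, uIcc_of_ge haI.2]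
          exact Icc_subset_Icc_right hb
        · rw [uIcc_of_le hab] at hs hr
          rw [hgr s (h0.trans_le hs.1), hgr r (h0.trans_le hr.1), one_mul]
      · have hac := (hql b hbI h0).absolutelyContinuousOnInterval_intervalIntegral left_mem_uIcc
        refine absolutelyContinuousOnInterval_of_dist_le 1 (hac.mono (c := a) (d := b) ?_)
          fun s hs r hr => ?_
        · rw [uIcc_of_le hab, uIcc_of_le hbI.1]
          exact Icc_subset_Icc_left ha
        · rw [uIcc_of_le hab] at hs hr
          rw [hgl s (hs.2.trans_lt h0), hgl r (hr.2.trans_lt h0), one_mul]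
    · filter_upwards [h 0 (Or.inl rfl), h L (Or.inr rfl), ae_restrict_mem measurableSet_Ioo,
        ae_restrict_of_ae (Measure.ae_ne volume x₀)] with x h1 h2 hx hxx
      have hx' := Ioo_subset_Icc_self hx
      rcases lt_or_gt_of_ne hxx with h3 | h3
      · rw [hgl x h3, h1 (by rw [uIcc_of_le hx'.1]; simp [h3])]
      · rw [hgr x h3, h2 (by rw [uIcc_of_ge hx'.2]; simp [h3])]
  have hderiv : ∀ᵐ x ∂(volume.restrict (Ioo 0 L)), deriv g x = q x := by
    have k1 : ∀ᵐ x ∂(volume : Measure ℝ), ∀ b : ℚ, (b : ℝ) ∈ Icc 0 L → (b : ℝ) < x₀ →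
        x ∈ uIcc 0 (b : ℝ) → HasDerivAt (fun x => ∫ s in (0 : ℝ)..x, q s) (q x) x := by
      rw [ae_all_iff]; intro b
      by_cases hb : (b : ℝ) ∈ Icc 0 L ∧ (b : ℝ) < x₀
      · filter_upwards [(hql b hb.1 hb.2).ae_hasDerivAt_integral] with x hx _ _ h3
        exact hx h3 0 left_mem_uIcc
      · exact Eventually.of_forall fun x h1 h2 => absurd ⟨h1, h2⟩ hb
    have k2 : ∀ᵐ x ∂(volume : Measure ℝ), ∀ b : ℚ, (b : ℝ) ∈ Icc 0 L → x₀ < (b : ℝ) →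
        x ∈ uIcc L (b : ℝ) → HasDerivAt (fun x => ∫ s in L..x, q s) (q x) x := by
      rw [ae_all_iff]; intro b
      by_cases hb : (b : ℝ) ∈ Icc 0 L ∧ x₀ < (b : ℝ)
      · filter_upwards [(hqr b hb.1 hb.2).ae_hasDerivAt_integral] with x hx _ _ h3
        exact hx h3 L left_mem_uIcc
      · exact Eventually.of_forall fun x h1 h2 => absurd ⟨h1, h2⟩ hb
    filter_upwards [ae_restrict_mem measurableSet_Ioo, ae_restrict_of_ae k1, ae_restrict_of_ae k2,
      ae_restrict_of_ae (Measure.ae_ne volume x₀)] with x hx h1 h2 hxx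
    rcases lt_or_gt_of_ne hxx with h3 | h3
    · obtain ⟨b, hb1, hb2⟩ := exists_rat_btwn h3
      have hb0 : 0 ≤ (b : ℝ) := hx.1.le.trans hb1.le
      have h4 := h1 b ⟨hb0, (hb2.trans hx₀.2).le⟩ hb2 (by
        rw [uIcc_of_le hb0]; exact ⟨hx.1.le, hb1.le⟩)
      have h5 : g =ᶠ[𝓝 x] fun x => ∫ s in (0 : ℝ)..x, q s := by
        filter_upwards [Iio_mem_nhds h3] with z hz using hgl z hz
      rw [h5.deriv_eq, h4.deriv]
    · obtain ⟨b, hb1, hb2⟩ := exists_rat_btwn h3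
      have hbL : (b : ℝ) ≤ L := hb2.le.trans hx.2.le
      have h4 := h2 b ⟨(hx₀.1.trans hb1).le, hbL⟩ hb1 (by
        rw [uIcc_of_ge hbL]; exact ⟨hb2.le, hx.2.le⟩)
      have h5 : g =ᶠ[𝓝 x] fun x => ∫ s in L..x, q s := by
        filter_upwards [Ioi_mem_nhds h3] with z hz using hgr z hz
      rw [h5.deriv_eq, h4.deriv]
  refine ⟨⟨g, hrep, ?_, ?_⟩, ?_⟩
  · rw [hgl 0 hx₀.1, intervalIntegral.integral_same]
  · rw [hgr L hx₀.2, intervalIntegral.integral_same]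
  · filter_upwards [hrep.deriv_ae_eq, hderiv, hu.ae_pos] with x h1 h2 h3
    rw [h1, h2, hq, mul_div_cancel₀ _ (Real.sqrt_pos.2 h3).ne']

/-- The integral of `q / √u` over an interval avoiding `x₀` is continuous in `q ∈ L²(0,L)`. -/
theorem IsWeight.tendsto_integral_div (hu : IsWeight L x₀ u) {e x : ℝ} (he : e ∈ Icc 0 L)
    (hx : x ∈ Icc 0 L) (h0 : x₀ ∉ uIcc e x) {qn : ℕ → L2 L} {q : L2 L}
    (hq : Tendsto qn atTop (𝓝 q)) :
    Tendsto (fun n => ∫ s in e..x, qn n s / √(u s)) atTop (𝓝 (∫ s in e..x, q s / √(u s))) := by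
  have hsub := uIcc_subset_Icc_zero he hx
  have hsub' := uIoc_subset_Ioc_zero he hx
  have hc : ContinuousOn (fun s => (√(u s))⁻¹) (uIcc e x) := by
    refine ContinuousOn.inv₀ (Real.continuous_sqrt.comp_continuousOn (hu.continuousOn.mono hsub))
      fun s hs => ?_
    exact (Real.sqrt_pos.2 (hu.pos s (hsub hs) fun h => h0 (h ▸ hs))).ne'
  obtain ⟨C, hC⟩ := isCompact_uIcc.exists_bound_of_continuousOn hc
  set k : ℝ → ℝ := (uIoc e x).indicator fun s => (√(u s))⁻¹ with hk
  have hkm : MemLp k 2 (volume.restrict (Ioo 0 L)) := by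
    have h1 : AEStronglyMeasurable k volume := by
      rw [hk, aestronglyMeasurable_indicator_iff measurableSet_uIoc]
      exact (hc.mono uIoc_subset_uIcc).aestronglyMeasurable measurableSet_uIoc
    refine MemLp.of_bound h1.restrict (max C 0) (Eventually.of_forall fun s => ?_)
    by_cases hs : s ∈ uIoc e x
    · rw [hk, indicator_of_mem hs]
      exact (hC s (uIoc_subset_uIcc hs)).trans (le_max_left _ _)
    · rw [hk, indicator_of_notMem hs, norm_zero]
      exact le_max_right _ _
  have hrw : ∀ r : L2 L, ∫ s in e..x, r s / √(u s)
      = (if e ≤ x then 1 else -1 : ℝ) • inner ℝ (hkm.toLp : L2 L) r := by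
    intro r
    rw [intervalIntegral.intervalIntegral_eq_integral_uIoc, inner_L2_eq]
    congr 1
    have h1 : ∫ s in Ioo 0 L, (hkm.toLp : L2 L) s * r s
        = ∫ s in Ioc 0 L, (uIoc e x).indicator (fun s => r s / √(u s)) s := by
      rw [integral_Ioc_eq_integral_Ioo]
      apply integral_congr_ae
      filter_upwards [hkm.coeFn_toLp] with s hs
      rw [hs, hk]
      by_cases hs : s ∈ uIoc e x
      · rw [indicator_of_mem hs, indicator_of_mem hs, div_eq_mul_inv, mul_comm]
      · rw [indicator_of_notMem hs, indicator_of_notMem hs, zero_mul]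
    rw [h1, setIntegral_indicator measurableSet_uIoc, inter_eq_right.2 hsub']
  simp only [hrw]
  exact ((tendsto_const_nhds.inner hq)).const_smul _

theorem IsWeight.isClosed_H1 (hu : IsWeight L x₀ u) (hx₀ : x₀ ∈ Ioo 0 L) :
    IsClosed (H1 L x₀ u : Set (WithLp 2 (L2 L × L2 L))) := by
  have hL : 0 < L := hx₀.1.trans hx₀.2
  refine isClosed_of_closure_subset fun p hp => ?_
  obtain ⟨pn, hpn, hlim⟩ := mem_closure_iff_seq_limit.1 hp
  have h1 : Tendsto (fun n => (pn n).fst) atTop (𝓝 p.fst) :=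
    ((WithLp.fstL 2 ℝ (L2 L) (L2 L)).continuous.tendsto p).comp hlim
  have h2 : Tendsto (fun n => (pn n).snd) atTop (𝓝 p.snd) :=
    ((WithLp.sndL 2 ℝ (L2 L) (L2 L)).continuous.tendsto p).comp hlim
  refine hu.mem_H1 hx₀ fun e he => ?_
  have heI : e ∈ Icc 0 L := by rcases he with rfl | rfl <;> simp [hL.le]
  obtain ⟨φ, hφm, hφ⟩ := (tendstoInMeasure_of_tendsto_Lp h1).exists_seq_tendsto_ae
  have hall := ae_all_iff.2 fun n => hu.fst_eq_integral hL (hpn n) he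
  filter_upwards [hφ, hall, ae_restrict_mem measurableSet_Ioo] with x h3 h4 hx h0
  refine tendsto_nhds_unique h3 ?_
  simp only [fun n => h4 (φ n) h0]
  exact hu.tendsto_integral_div heI (Ioo_subset_Icc_self hx) h0 (h2.comp hφm.tendsto_atTop)

theorem IsWeight.completeSpace_H1 (hu : IsWeight L x₀ u) (hx₀ : x₀ ∈ Ioo 0 L) :
    CompleteSpace (H1 L x₀ u) :=
  (hu.isClosed_H1 hx₀).completeSpace_coe

end Weight

/-! ### Comparable weights and the diffusion operator -/

section Operators

variable {L x₀ C : ℝ} {u w : ℝ → ℝ}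

/-- The weighted derivative `y ↦ √u y_x` on `H¹_u(0,L)`. -/
def gradOp : H1 L x₀ u →L[ℝ] L2 L :=
  (WithLp.sndL 2 ℝ (L2 L) (L2 L)).comp (H1 L x₀ u).subtypeL

theorem coeFn_gradOp (p : H1 L x₀ u) :
    gradOp p =ᵐ[volume.restrict (Ioo 0 L)] fun x => √(u x) * spaceDeriv L x₀ (toL2 p) x :=
  snd_ae_eq p

theorem toL2_apply (p : H1 L x₀ u) : toL2 p = (p : WithLp 2 (L2 L × L2 L)).fst := rfl

theorem H1_norm_sq (p : H1 L x₀ u) : ‖p‖ ^ 2 = ‖toL2 p‖ ^ 2 + ‖gradOp p‖ ^ 2 :=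
  WithLp.prod_norm_sq_eq_of_L2 (p : WithLp 2 (L2 L × L2 L))

/-- The component `√u y_x` of an element of `H¹_u(0,L)` is determined by `y`. -/
theorem toL2_injective : Function.Injective (toL2 : H1 L x₀ u → L2 L) := by
  intro p q h
  have h2 : gradOp p = gradOp q := by
    apply Lp.ext
    filter_upwards [coeFn_gradOp p, coeFn_gradOp q] with x e1 e2
    rw [e1, e2, h]
  have h3 : ‖p - q‖ ^ 2 = 0 := by
    rw [H1_norm_sq, map_sub, map_sub, h, h2]; simp
  rwa [pow_eq_zero_iff two_ne_zero, norm_eq_zero, sub_eq_zero] at h3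

/-- `u` is a weight comparable with the reference weight `w`. -/
structure IsComparableWeight (L x₀ : ℝ) (w : ℝ → ℝ) (C : ℝ) (u : ℝ → ℝ) : Prop
    extends IsWeight L x₀ u where
  le : ∀ x ∈ Icc 0 L, w x ≤ u x
  le_mul : ∀ x ∈ Icc 0 L, u x ≤ C * w x

theorem IsWeight.memLp_top_comp_div {u₁ u₂ : ℝ → ℝ} (h₁ : IsWeight L x₀ u₁)
    (h₂ : IsWeight L x₀ u₂) {F : ℝ → ℝ} (hF : Continuous F) {K : ℝ}
    (h : ∀ᵐ x ∂(volume.restrict (Ioo 0 L)), |F (u₁ x / u₂ x)| ≤ K) :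
    MemLp (fun x => F (u₁ x / u₂ x)) ⊤ (volume.restrict (Ioo 0 L)) := by
  refine memLp_top_of_bound ?_ K h
  have a1 := (h₁.continuousOn.mono Ioo_subset_Icc_self).aestronglyMeasurable
    (μ := volume) measurableSet_Ioo
  have a2 := (h₂.continuousOn.mono Ioo_subset_Icc_self).aestronglyMeasurable
    (μ := volume) measurableSet_Ioo
  exact hF.comp_aestronglyMeasurable (a1.aemeasurable.div a2.aemeasurable).aestronglyMeasurable

theorem IsComparableWeight.ratio_bounds (hw : IsWeight L x₀ w)
    (hu : IsComparableWeight L x₀ w C u) :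
    ∀ᵐ x ∂(volume.restrict (Ioo 0 L)), 1 ≤ u x / w x ∧ u x / w x ≤ C := by
  filter_upwards [hw.ae_pos, ae_restrict_mem measurableSet_Ioo] with x h1 hx
  have hx' := Ioo_subset_Icc_self hx
  exact ⟨(one_le_div h1).2 (hu.le x hx'), (div_le_iff₀ h1).2 (hu.le_mul x hx')⟩

theorem IsComparableWeight.abs_ratio_le (hw : IsWeight L x₀ w)
    (hu : IsComparableWeight L x₀ w C u) :
    ∀ᵐ x ∂(volume.restrict (Ioo 0 L)), |u x / w x| ≤ C := by
  filter_upwards [hu.ratio_bounds hw] with x h1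
  rw [abs_of_nonneg (by linarith [h1.1])]
  exact h1.2

theorem IsComparableWeight.memLp_ratio (hw : IsWeight L x₀ w)
    (hu : IsComparableWeight L x₀ w C u) :
    MemLp (fun x => u x / w x) ⊤ (volume.restrict (Ioo 0 L)) :=
  hu.toIsWeight.memLp_top_comp_div hw continuous_id (hu.abs_ratio_le hw)

theorem IsComparableWeight.memLp_sqrt_ratio (hw : IsWeight L x₀ w)
    (hu : IsComparableWeight L x₀ w C u) :
    MemLp (fun x => √(u x / w x)) ⊤ (volume.restrict (Ioo 0 L)) :=
  hu.toIsWeight.memLp_top_comp_div hw Real.continuous_sqrt (K := √C) (by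
    filter_upwards [hu.ratio_bounds hw] with x h1
    rw [abs_of_nonneg (Real.sqrt_nonneg _)]
    exact Real.sqrt_le_sqrt h1.2)

theorem IsComparableWeight.memLp_sqrt_ratio_symm (hw : IsWeight L x₀ w)
    (hu : IsComparableWeight L x₀ w C u) :
    MemLp (fun x => √(w x / u x)) ⊤ (volume.restrict (Ioo 0 L)) :=
  hw.memLp_top_comp_div hu.toIsWeight Real.continuous_sqrt (K := 1) (by
    filter_upwards [hu.ae_pos, ae_restrict_mem measurableSet_Ioo] with x h1 hx
    rw [abs_of_nonneg (Real.sqrt_nonneg _)]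
    refine Real.sqrt_le_iff.2 ⟨zero_le_one, ?_⟩
    rw [one_pow, div_le_one₀ h1]
    exact hu.le x (Ioo_subset_Icc_self hx))

theorem rescale_mem {u₁ u₂ : ℝ → ℝ} (h₁ : IsWeight L x₀ u₁) (h₂ : IsWeight L x₀ u₂)
    (h : MemLp (fun x => √(u₂ x / u₁ x)) ⊤ (volume.restrict (Ioo 0 L))) (p : H1 L x₀ u₁) :
    ((WithLp.prodContinuousLinearEquiv 2 ℝ (L2 L) (L2 L)).symm.toContinuousLinearMap.comp
      (toL2.prod ((mulOp h).comp gradOp))) p ∈ H1 L x₀ u₂ := by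
  refine ⟨p.2.1, ?_⟩
  change mulOp h (gradOp p) =ᵐ[volume.restrict (Ioo 0 L)]
    fun x => √(u₂ x) * spaceDeriv L x₀ (toL2 p) x
  filter_upwards [coeFn_mulOp h (gradOp p), coeFn_gradOp p, h₁.ae_pos, h₂.ae_pos]
    with x e1 e2 e3 e4
  rw [e1, e2, ← mul_assoc, ← Real.sqrt_mul (div_pos e4 e3).le, div_mul_cancel₀ _ e3.ne']

/-- The identity `y ↦ y` from `H¹_{u₁}(0,L)` to `H¹_{u₂}(0,L)` when `u₂ / u₁` is bounded. -/
def rescale {u₁ u₂ : ℝ → ℝ} (h₁ : IsWeight L x₀ u₁) (h₂ : IsWeight L x₀ u₂)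
    (h : MemLp (fun x => √(u₂ x / u₁ x)) ⊤ (volume.restrict (Ioo 0 L))) :
    H1 L x₀ u₁ →L[ℝ] H1 L x₀ u₂ :=
  ContinuousLinearMap.codRestrict
    ((WithLp.prodContinuousLinearEquiv 2 ℝ (L2 L) (L2 L)).symm.toContinuousLinearMap.comp
      (toL2.prod ((mulOp h).comp gradOp))) (H1 L x₀ u₂) (rescale_mem h₁ h₂ h)

theorem toL2_rescale {u₁ u₂ : ℝ → ℝ} (h₁ : IsWeight L x₀ u₁) (h₂ : IsWeight L x₀ u₂)
    (h : MemLp (fun x => √(u₂ x / u₁ x)) ⊤ (volume.restrict (Ioo 0 L))) (p : H1 L x₀ u₁) :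
    toL2 (rescale h₁ h₂ h p) = toL2 p := by
  rw [toL2_apply, rescale, ContinuousLinearMap.coe_codRestrict_apply]
  rfl

/-- Test functions belong to `H¹_u(0,L)`. -/
theorem IsWeight.exists_test (hu : IsWeight L x₀ u) {φ : ℝ → ℝ} (h1 : ContDiff ℝ (⊤ : ℕ∞) φ)
    (h2 : HasCompactSupport φ) (h3 : tsupport φ ⊆ Ioo 0 L) :
    ∃ p : H1 L x₀ u, toL2 p =ᵐ[volume.restrict (Ioo 0 L)] φ ∧
      spaceDeriv L x₀ (toL2 p) =ᵐ[volume.restrict (Ioo 0 L)] deriv φ := by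
  have hφ : MemLp φ 2 (volume.restrict (Ioo 0 L)) := h1.continuous.memLp_of_hasCompactSupport h2
  have hφ' : Continuous (deriv φ) := h1.continuous_deriv (by simp)
  have hD : MemLp (fun x => √(u x) * deriv φ x) 2 (volume.restrict (Ioo 0 L)) :=
    memLp_of_continuousOn ((Real.continuous_sqrt.comp_continuousOn hu.continuousOn).mul
      hφ'.continuousOn) 2
  have hrep : IsACRep L x₀ hφ.toLp φ :=
    ⟨fun a b _ _ _ _ => ContDiffOn.absolutelyContinuousOnInterval
      (h1.contDiffOn.of_le (by simp)), hφ.coeFn_toLp⟩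
  have hz : ∀ x, x ∉ Ioo 0 L → φ x = 0 := fun x hx => image_eq_zero_of_notMem_tsupport
    fun h => hx (h3 h)
  refine ⟨⟨WithLp.toLp 2 (hφ.toLp, hD.toLp),
    ⟨⟨φ, hrep, hz 0 (by simp), hz L (by simp)⟩, ?_⟩⟩, hφ.coeFn_toLp, hrep.deriv_ae_eq⟩
  filter_upwards [hD.coeFn_toLp, hrep.deriv_ae_eq] with x e1 e2
  change (hD.toLp : L2 L) x = √(u x) * spaceDeriv L x₀ hφ.toLp x
  rw [e1, e2]

/-- The inclusion of `H¹_u(0,L)` is dense because the test functions belong to it. -/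
theorem IsWeight.denseRange_toL2 (hu : IsWeight L x₀ u) :
    DenseRange (toL2 : H1 L x₀ u → L2 L) := by
  have h : Submodule.topologicalClosure (toL2 : H1 L x₀ u →L[ℝ] L2 L).toLinearMap.range = ⊤ := by
    rw [Submodule.topologicalClosure_eq_top_iff, Submodule.eq_bot_iff]
    intro h hh
    apply Lp.ext
    have hint : IntegrableOn h (Ioo 0 L) volume := (Lp.memLp h).integrable (by norm_num)
    have hloc : LocallyIntegrableOn h (Ioo 0 L) volume := hint.locallyIntegrableOn
    have h0 := isOpen_Ioo.ae_eq_zero_of_integral_contDiff_smul_eq_zero hloc fun φ h1 h2 h3 => by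
      obtain ⟨p, hp, -⟩ := hu.exists_test h1 h2 h3
      have h4 := hh (toL2 p) ⟨p, rfl⟩
      rw [inner_L2_eq] at h4
      have h5 : ∫ x, φ x • h x = ∫ x in Ioo 0 L, φ x • h x := by
        rw [setIntegral_eq_integral_of_forall_compl_eq_zero]
        intro x hx
        rw [image_eq_zero_of_notMem_tsupport fun h' => hx (h3 h'), zero_smul]
      refine h5.trans (Eq.trans ?_ h4)
      apply integral_congr_ae
      filter_upwards [hp] with x e1
      rw [e1, smul_eq_mul]
    filter_upwards [(ae_restrict_iff' measurableSet_Ioo).2 h0, Lp.coeFn_zero ℝ 2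
      (volume.restrict (Ioo 0 L))] with x e1 e2
    rw [e1, e2]; rfl
  rw [← Submodule.dense_iff_topologicalClosure_eq_top] at h
  exact h

/-- The operator on `H¹_w(0,L)` that represents the form `∫ m w y_x z_x`. -/
def diffusionOp [CompleteSpace (H1 L x₀ w)] {m : ℝ → ℝ}
    (hm : MemLp m ⊤ (volume.restrict (Ioo 0 L))) : H1 L x₀ w →L[ℝ] H1 L x₀ w :=
  gradOp.adjoint.comp ((mulOp hm).comp gradOp)

theorem inner_diffusionOp [CompleteSpace (H1 L x₀ w)] {m : ℝ → ℝ}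
    (hm : MemLp m ⊤ (volume.restrict (Ioo 0 L))) (p q : H1 L x₀ w) :
    inner ℝ (diffusionOp hm p) q = ∫ x in Ioo 0 L, m x * (gradOp p x * gradOp q x) := by
  rw [diffusionOp, ContinuousLinearMap.comp_apply, ContinuousLinearMap.adjoint_inner_left,
    inner_L2_eq]
  apply integral_congr_ae
  filter_upwards [coeFn_mulOp hm (gradOp p)] with x h1
  rw [ContinuousLinearMap.comp_apply, h1, mul_assoc]

theorem isElliptic_diffusionOp [CompleteSpace (H1 L x₀ w)] {m : ℝ → ℝ}
    (hm : MemLp m ⊤ (volume.restrict (Ioo 0 L)))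
    (hm1 : ∀ᵐ x ∂(volume.restrict (Ioo 0 L)), 1 ≤ m x) :
    IsElliptic (toL2 : H1 L x₀ w →L[ℝ] L2 L) (diffusionOp hm) where
  symm p q := by
    refine Eq.trans ?_ (real_inner_comm p (diffusionOp hm q))
    rw [inner_diffusionOp, inner_diffusionOp]
    exact integral_congr_ae (Eventually.of_forall fun x => by ring)
  nonneg p := by
    rw [inner_diffusionOp]
    apply integral_nonneg_of_ae
    filter_upwards [hm1] with x h1
    exact mul_nonneg (by linarith) (mul_self_nonneg _)
  coercive p := by
    rw [H1_norm_sq, add_comm, inner_diffusionOp]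
    gcongr
    rw [← real_inner_self_eq_norm_sq, inner_L2_eq]
    have i1 : Integrable (fun x => gradOp p x * gradOp p x) (volume.restrict (Ioo 0 L)) :=
      (Lp.memLp (gradOp p)).integrable_mul (Lp.memLp (gradOp p))
    have i2 : Integrable (fun x => m x * (gradOp p x * gradOp p x))
        (volume.restrict (Ioo 0 L)) := by
      refine ((Lp.memLp (mulOp hm (gradOp p))).integrable_mul (Lp.memLp (gradOp p))).congr ?_
      filter_upwards [coeFn_mulOp hm (gradOp p)] with x h1
      rw [Pi.mul_apply, h1, mul_assoc]
    refine integral_mono_ae i1 i2 ?_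
    filter_upwards [hm1] with x h1
    exact le_mul_of_one_le_left (mul_self_nonneg _) h1

theorem norm_diffusionOp_le [CompleteSpace (H1 L x₀ w)] {m : ℝ → ℝ}
    (hm : MemLp m ⊤ (volume.restrict (Ioo 0 L))) {K : ℝ} (hK0 : 0 ≤ K)
    (hK : ∀ᵐ x ∂(volume.restrict (Ioo 0 L)), |m x| ≤ K) :
    ‖(diffusionOp hm : H1 L x₀ w →L[ℝ] H1 L x₀ w)‖ ≤
      ‖(gradOp : H1 L x₀ w →L[ℝ] L2 L).adjoint‖ * (K * ‖(gradOp : H1 L x₀ w →L[ℝ] L2 L)‖) := by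
  refine (ContinuousLinearMap.opNorm_comp_le _ _).trans ?_
  gcongr
  refine (ContinuousLinearMap.opNorm_comp_le _ _).trans ?_
  gcongr
  exact norm_mulOp_le hm hK0 hK

/-- The form of `diffusionOp` for `m = u / w`, expressed in the space `H¹_u(0,L)`. -/
theorem inner_diffusionOp_eq_integral [CompleteSpace (H1 L x₀ w)] (hw : IsWeight L x₀ w)
    (hm : MemLp (fun x => u x / w x) ⊤ (volume.restrict (Ioo 0 L))) (p q : H1 L x₀ w) :
    inner ℝ (diffusionOp hm p) q = ∫ x in Ioo 0 L,
      u x * spaceDeriv L x₀ (toL2 p) x * spaceDeriv L x₀ (toL2 q) x := by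
  rw [inner_diffusionOp]
  apply integral_congr_ae
  filter_upwards [coeFn_gradOp p, coeFn_gradOp q, hw.ae_pos] with x h1 h2 h3
  rw [h1, h2]
  have h4 := Real.mul_self_sqrt h3.le
  calc u x / w x * (√(w x) * spaceDeriv L x₀ (toL2 p) x * (√(w x) * spaceDeriv L x₀ (toL2 q) x))
      = u x / w x * (√(w x) * √(w x)) * spaceDeriv L x₀ (toL2 p) x
        * spaceDeriv L x₀ (toL2 q) x := by ring
    _ = _ := by rw [h4, div_mul_cancel₀ _ h3.ne']

end Operators

/-! ### States as weak solutions of the abstract equation -/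

section Dual

variable {E V : Type*} [NormedAddCommGroup E] [InnerProductSpace ℝ E]
  [NormedAddCommGroup V] [InnerProductSpace ℝ V] {T t : ℝ}

/-- The functional `p ↦ ⟪x, R p⟫` on `E`, for `x ∈ V` and an operator `R` from `E` to `V`. -/
def pullbackDual (R : E →L[ℝ] V) : V →L[ℝ] StrongDual ℝ E :=
  (ContinuousLinearMap.precomp ℝ R).comp
    (isBoundedBilinearMap_inner (𝕜 := ℝ) (E := V)).toContinuousLinearMap

theorem pullbackDual_apply (R : E →L[ℝ] V) (x : V) (p : E) :
    pullbackDual R x p = inner ℝ x (R p) := rfl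

theorem memLp_pullbackDual (R : E →L[ℝ] V) {r : ℝ → V} {μ : Measure ℝ} (hr : MemLp r 2 μ) :
    MemLp (fun s => pullbackDual R (r s)) 2 μ :=
  memLp_clm_comp _ hr

theorem pullbackDual_add_primitive [CompleteSpace V] (R : E →L[ℝ] V) (x : V) {r : ℝ → V}
    (hr : MemLp r 2 (volume.restrict (Ioo 0 T))) (ht : t ∈ Icc 0 T) :
    pullbackDual R (x + ∫ s in (0 : ℝ)..t, r s) =
      pullbackDual R x + ∫ s in (0 : ℝ)..t, pullbackDual R (r s) := by
  rw [map_add, ContinuousLinearMap.intervalIntegral_comp_comm _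
    (intervalIntegrable_of_memLp_two hr ht)]

end Dual

section States

variable {T L x₀ C : ℝ} {u w : ℝ → ℝ}

/-- The identity `y ↦ y` from `H¹_u(0,L)` to `H¹_w(0,L)` for a weight comparable with `w`. -/
def IsComparableWeight.toRef (hw : IsWeight L x₀ w) (hu : IsComparableWeight L x₀ w C u) :
    H1 L x₀ u →L[ℝ] H1 L x₀ w :=
  rescale hu.toIsWeight hw (hu.memLp_sqrt_ratio_symm hw)

/-- The identity `y ↦ y` from `H¹_w(0,L)` to `H¹_u(0,L)` for a weight comparable with `w`. -/
def IsComparableWeight.ofRef (hw : IsWeight L x₀ w) (hu : IsComparableWeight L x₀ w C u) :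
    H1 L x₀ w →L[ℝ] H1 L x₀ u :=
  rescale hw hu.toIsWeight (hu.memLp_sqrt_ratio hw)

theorem IsComparableWeight.toL2_toRef (hw : IsWeight L x₀ w) (hu : IsComparableWeight L x₀ w C u)
    (p : H1 L x₀ u) : toL2 (hu.toRef hw p) = toL2 p := toL2_rescale ..

theorem IsComparableWeight.toL2_ofRef (hw : IsWeight L x₀ w) (hu : IsComparableWeight L x₀ w C u)
    (p : H1 L x₀ w) : toL2 (hu.ofRef hw p) = toL2 p := toL2_rescale ..

theorem IsComparableWeight.toRef_ofRef (hw : IsWeight L x₀ w)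
    (hu : IsComparableWeight L x₀ w C u) (p : H1 L x₀ w) : hu.toRef hw (hu.ofRef hw p) = p :=
  toL2_injective (by rw [hu.toL2_toRef, hu.toL2_ofRef])

/-- The operator on `H¹_w(0,L)` that represents the form `∫ u y_x z_x`. -/
def IsComparableWeight.op [CompleteSpace (H1 L x₀ w)] (hw : IsWeight L x₀ w)
    (hu : IsComparableWeight L x₀ w C u) : H1 L x₀ w →L[ℝ] H1 L x₀ w :=
  diffusionOp (hu.memLp_ratio hw)

theorem IsComparableWeight.isElliptic_op [CompleteSpace (H1 L x₀ w)] (hw : IsWeight L x₀ w)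
    (hu : IsComparableWeight L x₀ w C u) : IsElliptic toL2 (hu.op hw) :=
  isElliptic_diffusionOp _ ((hu.ratio_bounds hw).mono fun _ h => h.1)

theorem IsComparableWeight.pullbackDual_adjoint [CompleteSpace (H1 L x₀ w)]
    (hw : IsWeight L x₀ w) (hu : IsComparableWeight L x₀ w C u) (h : L2 L) :
    pullbackDual (hu.toRef hw) ((toL2 : H1 L x₀ w →L[ℝ] L2 L).adjoint h) = toDual h := by
  ext p
  rw [pullbackDual_apply, ContinuousLinearMap.adjoint_inner_left, hu.toL2_toRef]
  rfl

/-- The integrals in the variational equation, in terms of the reference space. -/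
theorem IsComparableWeight.equation_iff [CompleteSpace (H1 L x₀ w)] (hw : IsWeight L x₀ w)
    (hu : IsComparableWeight L x₀ w C u) {f : ℝ × ℝ → ℝ} {F : ℝ → L2 L}
    (hF : ∀ᵐ t ∂(volume.restrict (Ioo 0 T)),
      F t =ᵐ[volume.restrict (Ioo 0 L)] fun x => f (t, x))
    {y : ℝ → L2 L} {v : ℝ → H1 L x₀ w}
    (hv : ∀ᵐ t ∂(volume.restrict (Ioo 0 T)), toL2 (v t) = y t)
    (y' : ℝ → H1Dual L x₀ u) (ψ : ℝ → H1 L x₀ u) :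
    ((∫ t in Ioo 0 T, y' t (ψ t)) +
        (∫ t in Ioo 0 T, ∫ x in Ioo 0 L,
          u x * spaceDeriv L x₀ (y t) x * spaceDeriv L x₀ (toL2 (ψ t)) x) =
        ∫ t in Ioo 0 T, ∫ x in Ioo 0 L, f (t, x) * toL2 (ψ t) x) ↔
      (∫ t in Ioo 0 T, y' t (ψ t)) +
        (∫ t in Ioo 0 T, inner ℝ (hu.op hw (v t)) (hu.toRef hw (ψ t))) =
        ∫ t in Ioo 0 T, inner ℝ ((toL2 : H1 L x₀ w →L[ℝ] L2 L).adjoint (F t))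
          (hu.toRef hw (ψ t)) := by
  have e1 : (∫ t in Ioo 0 T, ∫ x in Ioo 0 L,
      u x * spaceDeriv L x₀ (y t) x * spaceDeriv L x₀ (toL2 (ψ t)) x) =
      ∫ t in Ioo 0 T, inner ℝ (hu.op hw (v t)) (hu.toRef hw (ψ t)) := by
    apply integral_congr_ae
    filter_upwards [hv] with t ht
    rw [IsComparableWeight.op, inner_diffusionOp_eq_integral hw, hu.toL2_toRef, ht]
  have e2 : (∫ t in Ioo 0 T, ∫ x in Ioo 0 L, f (t, x) * toL2 (ψ t) x) =
      ∫ t in Ioo 0 T, inner ℝ ((toL2 : H1 L x₀ w →L[ℝ] L2 L).adjoint (F t))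
          (hu.toRef hw (ψ t)) := by
    apply integral_congr_ae
    filter_upwards [hF] with t ht
    rw [ContinuousLinearMap.adjoint_inner_left, hu.toL2_toRef, inner_L2_eq]
    apply integral_congr_ae
    filter_upwards [ht] with x hx
    rw [hx]
  rw [e1, e2]

/-- A solution of the integrated equation is a state, whose time derivative in the dual space is
the functional `ι† f - A y`. -/
theorem IsWeakSol.isState [CompleteSpace (H1 L x₀ w)] (hT : 0 < T) (hw : IsWeight L x₀ w)
    (hu : IsComparableWeight L x₀ w C u) {f : ℝ × ℝ → ℝ} {F : ℝ → L2 L}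
    (hF2 : MemLp F 2 (volume.restrict (Ioo 0 T)))
    (hF : ∀ᵐ t ∂(volume.restrict (Ioo 0 T)),
      F t =ᵐ[volume.restrict (Ioo 0 L)] fun x => f (t, x))
    {y₀ : L2 L} {y : ℝ → L2 L} {v : ℝ → H1 L x₀ w}
    (h : IsWeakSol toL2 (hu.op hw) T F y₀ y v) : IsState T L x₀ y₀ f u y := by
  have hinit : y 0 = y₀ := by
    have := h.equation 0 ⟨le_rfl, hT.le⟩
    rw [intervalIntegral.integral_same, add_zero] at this
    exact adjoint_injective_of_denseRange hw.denseRange_toL2 this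
  have hιF : MemLp (fun s => (toL2 : H1 L x₀ w →L[ℝ] L2 L).adjoint (F s)) 2
    (volume.restrict (Ioo 0 T)) := memLp_clm_comp _ hF2
  have hAv : MemLp (fun s => hu.op hw (v s)) 2
    (volume.restrict (Ioo 0 T)) := memLp_clm_comp _ h.memLp
  have hr : MemLp (fun s => (toL2 : H1 L x₀ w →L[ℝ] L2 L).adjoint (F s) - hu.op hw (v s)) 2
      (volume.restrict (Ioo 0 T)) := hιF.sub hAv
  set r : ℝ → H1 L x₀ w := fun s =>
    (toL2 : H1 L x₀ w →L[ℝ] L2 L).adjoint (F s) - hu.op hw (v s) with hrdef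
  have hy' : MemLp (fun s => pullbackDual (hu.toRef hw) (r s)) 2
      (volume.restrict (Ioo 0 T)) := memLp_pullbackDual _ hr
  have hmem : MemLp (fun t => hu.ofRef hw (v t)) 2 (volume.restrict (Ioo 0 T)) :=
    memLp_clm_comp _ h.memLp
  have hmemy : ∀ᵐ t ∂(volume.restrict (Ioo 0 T)), toL2 (hu.ofRef hw (v t)) = y t := by
    filter_upwards [h.eq_apply] with t ht
    rw [hu.toL2_ofRef, ht]
  have hprim : ∀ t ∈ Icc 0 T, (toDual (y t) : H1Dual L x₀ u) = toDual (y 0) +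
      ∫ s in (0 : ℝ)..t, pullbackDual (hu.toRef hw) (r s) := fun t ht => by
    rw [← hu.pullbackDual_adjoint hw, ← hu.pullbackDual_adjoint hw, h.equation t ht, hinit,
      pullbackDual_add_primitive _ _ hr ht]
  refine ⟨h.continuousOn, ⟨_, hmem, hmemy⟩, ⟨_, ⟨hy', hprim⟩, fun ψ hψ => ?_⟩, hinit⟩
  have hψ' : MemLp (fun t => hu.toRef hw (ψ t)) 2 (volume.restrict (Ioo 0 T)) :=
    memLp_clm_comp _ hψ
  rw [hu.equation_iff hw hF h.eq_apply]
  rw [← integral_add (f := fun t => pullbackDual (hu.toRef hw) (r t) (ψ t))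
    (integrable_inner_of_memLp hr hψ') (integrable_inner_of_memLp hAv hψ')]
  apply integral_congr_ae
  filter_upwards with t
  rw [pullbackDual_apply, ← inner_add_left, hrdef, sub_add_cancel]

/-- A state solves the integrated equation: use the test functions `1_(0,t) q`. -/
theorem IsState.isWeakSol [CompleteSpace (H1 L x₀ w)] (hw : IsWeight L x₀ w)
    (hu : IsComparableWeight L x₀ w C u) {f : ℝ × ℝ → ℝ} {F : ℝ → L2 L}
    (hF2 : MemLp F 2 (volume.restrict (Ioo 0 T)))
    (hF : ∀ᵐ t ∂(volume.restrict (Ioo 0 T)),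
      F t =ᵐ[volume.restrict (Ioo 0 L)] fun x => f (t, x))
    {y₀ : L2 L} {y : ℝ → L2 L} (h : IsState T L x₀ y₀ f u y) :
    ∃ v, IsWeakSol toL2 (hu.op hw) T F y₀ y v := by
  obtain ⟨v, hv, hvy⟩ := h.memL2
  obtain ⟨y', ⟨hy', hprim⟩, heq⟩ := h.equation
  have hRv : MemLp (fun t => hu.toRef hw (v t)) 2 (volume.restrict (Ioo 0 T)) :=
    memLp_clm_comp _ hv
  have hRvy : ∀ᵐ t ∂(volume.restrict (Ioo 0 T)), toL2 (hu.toRef hw (v t)) = y t := by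
    filter_upwards [hvy] with t ht
    rw [hu.toL2_toRef, ht]
  refine ⟨fun t => hu.toRef hw (v t), h.continuousOn, hRv, hRvy, fun t ht => ?_⟩
  have hιF : MemLp (fun s => (toL2 : H1 L x₀ w →L[ℝ] L2 L).adjoint (F s)) 2
    (volume.restrict (Ioo 0 T)) := memLp_clm_comp _ hF2
  have hAv : MemLp (fun s => hu.op hw (hu.toRef hw (v s))) 2
    (volume.restrict (Ioo 0 T)) := memLp_clm_comp _ hRv
  have hr : MemLp (fun s => (toL2 : H1 L x₀ w →L[ℝ] L2 L).adjoint (F s)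
      - hu.op hw (hu.toRef hw (v s))) 2 (volume.restrict (Ioo 0 T)) := hιF.sub hAv
  refine ext_inner_right ℝ fun q => ?_
  have h1 : MemLp ((Ioo 0 t).indicator fun _ => hu.ofRef hw q) 2 (volume.restrict (Ioo 0 T)) :=
    (memLp_const _).indicator measurableSet_Ioo
  have h2 := (hu.equation_iff hw hF hRvy y' _).1 (heq _ h1)
  -- the integrals against the indicator function are integrals over `(0,t)`
  have key : ∀ G : ℝ → H1 L x₀ u → ℝ, (∀ s, G s 0 = 0) →
      ∫ s in Ioo 0 T, G s ((Ioo 0 t).indicator (fun _ => hu.ofRef hw q) s) =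
        ∫ s in (0 : ℝ)..t, G s (hu.ofRef hw q) := fun G hG => by
    have e : (fun s => G s ((Ioo 0 t).indicator (fun _ => hu.ofRef hw q) s)) =
        (Ioo 0 t).indicator fun s => G s (hu.ofRef hw q) := by
      funext s
      by_cases hs : s ∈ Ioo 0 t
      · rw [indicator_of_mem hs, indicator_of_mem hs]
      · rw [indicator_of_notMem hs, indicator_of_notMem hs, hG]
    rw [e, setIntegral_indicator measurableSet_Ioo, Ioo_inter_Ioo, max_self, min_eq_right ht.2,
      intervalIntegral_eq_integral_Ioo ht.1]
  rw [key (fun s p => y' s p) (fun s => map_zero _),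
    key (fun s p => inner ℝ (hu.op hw (hu.toRef hw (v s))) (hu.toRef hw p)) (fun s => by simp),
    key (fun s p => inner ℝ ((toL2 : H1 L x₀ w →L[ℝ] L2 L).adjoint (F s)) (hu.toRef hw p))
      (fun s => by simp), hu.toRef_ofRef] at h2
  have h3 := congrArg (fun Φ => Φ (hu.ofRef hw q)) (hprim t ht)
  simp only [add_apply] at h3
  rw [ContinuousLinearMap.intervalIntegral_apply (intervalIntegrable_of_memLp_two hy' ht),
    h.initial, ← hu.pullbackDual_adjoint hw, ← hu.pullbackDual_adjoint hw, pullbackDual_apply,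
    pullbackDual_apply, hu.toRef_ofRef] at h3
  rw [h3, inner_add_left]
  congr 1
  rw [← eq_sub_iff_add_eq] at h2
  rw [h2, ← intervalIntegral.integral_sub]
  · have := (innerSL ℝ q).intervalIntegral_comp_comm (intervalIntegrable_of_memLp_two hr ht)
    simp only [innerSL_apply_apply] at this
    rw [real_inner_comm, ← this]
    congr 1
    funext s
    rw [inner_sub_right, real_inner_comm, real_inner_comm q]
  · exact intervalIntegrable_of_integrable (integrable_inner_of_memLp hιF (memLp_const q)) ht
  · exact intervalIntegrable_of_integrable (integrable_inner_of_memLp hAv (memLp_const q)) ht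

end States

/-! ### Continuity of the cost -/

section Cost

variable {T L x₀ C : ℝ} {u w : ℝ → ℝ}

theorem memLp_one (L : ℝ) : MemLp (fun _ => (1 : ℝ)) 2 (volume.restrict (Ioo 0 L)) :=
  memLp_of_continuousOn continuousOn_const 2

theorem IsWeight.memLp_sqrt (hw : IsWeight L x₀ w) :
    MemLp (fun x => √(w x)) 2 (volume.restrict (Ioo 0 L)) :=
  memLp_of_continuousOn (Real.continuous_sqrt.comp_continuousOn hw.continuousOn) 2

/-- The element of `L²(0,L)` that represents `y ↦ ∫ u y_x` through the weighted derivative of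
`H¹_w(0,L)`. -/
def IsComparableWeight.fluxWeight (hw : IsWeight L x₀ w) (hu : IsComparableWeight L x₀ w C u) :
    L2 L :=
  mulOp (hu.memLp_ratio hw) hw.memLp_sqrt.toLp

theorem IsComparableWeight.inner_fluxWeight (hw : IsWeight L x₀ w)
    (hu : IsComparableWeight L x₀ w C u) (p : H1 L x₀ w) :
    inner ℝ (hu.fluxWeight hw) (gradOp p) = ∫ x in Ioo 0 L, u x * spaceDeriv L x₀ (toL2 p) x := by
  rw [inner_L2_eq]
  apply integral_congr_ae
  filter_upwards [coeFn_gradOp p, hw.ae_pos, coeFn_mulOp (hu.memLp_ratio hw) hw.memLp_sqrt.toLp,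
    hw.memLp_sqrt.coeFn_toLp] with x h1 h3 h2 h4
  rw [h1, IsComparableWeight.fluxWeight, h2, h4]
  have h5 := Real.mul_self_sqrt h3.le
  calc u x / w x * √(w x) * (√(w x) * spaceDeriv L x₀ (toL2 p) x)
      = u x / w x * (√(w x) * √(w x)) * spaceDeriv L x₀ (toL2 p) x := by ring
    _ = _ := by rw [h5, div_mul_cancel₀ _ h3.ne']

theorem inner_one (q : L2 L) : inner ℝ (memLp_one L).toLp q = ∫ x in Ioo 0 L, q x := by
  rw [inner_L2_eq]
  apply integral_congr_ae
  filter_upwards [(memLp_one L).coeFn_toLp] with x h1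
  rw [h1, one_mul]

theorem integral_inner_primitive {X Y : Type*} [NormedAddCommGroup X] [NormedSpace ℝ X]
    [CompleteSpace X] [NormedAddCommGroup Y] [InnerProductSpace ℝ Y] [CompleteSpace Y]
    (hT : 0 ≤ T) (k : Y) (B : X →L[ℝ] Y) {v : ℝ → X}
    (hv : MemLp v 2 (volume.restrict (Ioo 0 T))) :
    ∫ t in Ioo 0 T, inner ℝ k (B (v t)) = inner ℝ k (B (∫ t in (0 : ℝ)..T, v t)) := by
  rw [intervalIntegral_eq_integral_Ioo hT]
  exact ((innerSL ℝ k).comp B).integral_comp_comm (hv.integrable (by norm_num))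

/-- The cost, as a continuous function of the coefficient, of the time integral of the state and
of its final value. -/
theorem IsComparableWeight.cost_eq [CompleteSpace (H1 L x₀ w)] (hT : 0 ≤ T)
    (hw : IsWeight L x₀ w) (hu : IsComparableWeight L x₀ w C u) {y : ℝ → L2 L}
    {v : ℝ → H1 L x₀ w} (hv : MemLp v 2 (volume.restrict (Ioo 0 T)))
    (hvy : ∀ᵐ t ∂(volume.restrict (Ioo 0 T)), toL2 (v t) = y t) (l1 l2 l3 Mf MT M : ℝ) :
    cost T L x₀ l1 l2 l3 Mf MT M u y =
      l1 / 2 * (inner ℝ (hu.fluxWeight hw) (gradOp (∫ t in (0 : ℝ)..T, v t)) - Mf) ^ 2 +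
      l2 / 2 * (inner ℝ (memLp_one L).toLp (y T) - MT) ^ 2 +
      l3 / 2 * (inner ℝ (memLp_one L).toLp (toL2 (∫ t in (0 : ℝ)..T, v t)) - M) ^ 2 := by
  have e1 : (∫ t in Ioo 0 T, ∫ x in Ioo 0 L, u x * spaceDeriv L x₀ (y t) x) =
      inner ℝ (hu.fluxWeight hw) (gradOp (∫ t in (0 : ℝ)..T, v t)) := by
    rw [← integral_inner_primitive hT _ gradOp hv]
    apply integral_congr_ae
    filter_upwards [hvy] with t ht
    rw [hu.inner_fluxWeight, ht]
  have e3 : (∫ t in Ioo 0 T, ∫ x in Ioo 0 L, y t x) =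
      inner ℝ (memLp_one L).toLp (toL2 (∫ t in (0 : ℝ)..T, v t)) := by
    rw [← integral_inner_primitive hT _ toL2 hv]
    apply integral_congr_ae
    filter_upwards [hvy] with t ht
    rw [inner_one, ht]
  rw [cost, e1, e3, inner_one (y T)]

variable [CompleteSpace (H1 L x₀ w)]

theorem IsComparableWeight.norm_op_le (hC : 0 ≤ C) (hw : IsWeight L x₀ w)
    (hu : IsComparableWeight L x₀ w C u) : ‖hu.op hw‖ ≤
      ‖(gradOp : H1 L x₀ w →L[ℝ] L2 L).adjoint‖ * (C * ‖(gradOp : H1 L x₀ w →L[ℝ] L2 L)‖) :=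
  norm_diffusionOp_le _ hC (hu.abs_ratio_le hw)

omit [CompleteSpace (H1 L x₀ w)] in
theorem IsComparableWeight.tendsto_mulOp_ratio (hw : IsWeight L x₀ w) {un : ℕ → ℝ → ℝ}
    (hu : IsComparableWeight L x₀ w C u) (hun : ∀ n, IsComparableWeight L x₀ w C (un n))
    (hlim : ∀ x ∈ Icc 0 L, Tendsto (fun n => un n x) atTop (𝓝 (u x))) (q : L2 L) :
    Tendsto (fun n => mulOp ((hun n).memLp_ratio hw) q) atTop
      (𝓝 (mulOp (hu.memLp_ratio hw) q)) := by
  refine tendsto_mulOp _ _ (hu.abs_ratio_le hw) (fun n => (hun n).abs_ratio_le hw) ?_ q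
  filter_upwards [ae_restrict_mem measurableSet_Ioo] with x hx
  exact (hlim x (Ioo_subset_Icc_self hx)).div_const _

theorem IsComparableWeight.tendsto_op (hw : IsWeight L x₀ w) {un : ℕ → ℝ → ℝ}
    (hu : IsComparableWeight L x₀ w C u) (hun : ∀ n, IsComparableWeight L x₀ w C (un n))
    (hlim : ∀ x ∈ Icc 0 L, Tendsto (fun n => un n x) atTop (𝓝 (u x))) (p : H1 L x₀ w) :
    Tendsto (fun n => (hun n).op hw p) atTop (𝓝 (hu.op hw p)) :=
  ((gradOp : H1 L x₀ w →L[ℝ] L2 L).adjoint.continuous.tendsto _).comp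
    (IsComparableWeight.tendsto_mulOp_ratio hw hu hun hlim (gradOp p))

/-- The cost is continuous for the pointwise convergence of the coefficients. -/
theorem IsComparableWeight.tendsto_cost (hT : 0 < T) (hC : 0 ≤ C) (hw : IsWeight L x₀ w)
    {un : ℕ → ℝ → ℝ} (hu : IsComparableWeight L x₀ w C u)
    (hun : ∀ n, IsComparableWeight L x₀ w C (un n))
    (hlim : ∀ x ∈ Icc 0 L, Tendsto (fun n => un n x) atTop (𝓝 (u x))) {F : ℝ → L2 L}
    (hF : MemLp F 2 (volume.restrict (Ioo 0 T))) {y₀ : L2 L} {y : ℝ → L2 L}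
    {v : ℝ → H1 L x₀ w} (h : IsEnergySol toL2 (hu.op hw) T F y₀ y v) {yn : ℕ → ℝ → L2 L}
    {vn : ℕ → ℝ → H1 L x₀ w}
    (hn : ∀ n, IsEnergySol toL2 ((hun n).op hw) T F y₀ (yn n) (vn n)) (l1 l2 l3 Mf MT M : ℝ) :
    Tendsto (fun n => cost T L x₀ l1 l2 l3 Mf MT M (un n) (yn n)) atTop
      (𝓝 (cost T L x₀ l1 l2 l3 Mf MT M u y)) := by
  obtain ⟨hy, hv⟩ := IsEnergySol.tendsto hT hw.denseRange_toL2 hF (hu.isElliptic_op hw)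
    (fun n => (hun n).isElliptic_op hw) (fun n => (hun n).norm_op_le hC hw)
    (IsComparableWeight.tendsto_op hw hu hun hlim) h hn
  have hTm : T ∈ Icc 0 T := right_mem_Icc.2 hT.le
  have hcongr : ∀ {z : ℝ → H1 L x₀ w} (hz : MemLp z 2 (volume.restrict (Ioo 0 T))),
      ∫ t in (0 : ℝ)..T, (hz.toLp : Lp (H1 L x₀ w) 2 (volume.restrict (Ioo 0 T))) t =
        ∫ t in (0 : ℝ)..T, z t := fun hz =>
    intervalIntegral_congr_of_ae hTm hz.coeFn_toLp
  have hint := tendsto_primitive_of_tendsto_Lp hT hv hTm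
  simp only [hcongr] at hint
  have hk : Tendsto (fun n => (hun n).fluxWeight hw) atTop (𝓝 (hu.fluxWeight hw)) :=
    IsComparableWeight.tendsto_mulOp_ratio hw hu hun hlim _
  have h1 := hk.inner (((gradOp : H1 L x₀ w →L[ℝ] L2 L).continuous.tendsto _).comp hint) (𝕜 := ℝ)
  have h3 := ((innerSL ℝ (memLp_one L).toLp).comp
    (toL2 : H1 L x₀ w →L[ℝ] L2 L)).continuous.tendsto _ |>.comp hint
  have h2 := ((innerSL ℝ (memLp_one L).toLp).continuous.tendsto _).comp (hy T hTm)
  rw [hu.cost_eq hT.le hw h.memLp h.eq_apply]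
  simp only [fun n => (hun n).cost_eq hT.le hw (hn n).memLp (hn n).eq_apply]
  exact ((((h1.sub_const Mf).pow 2).const_mul _).add (((h2.sub_const MT).pow 2).const_mul _)).add
    (((h3.sub_const M).pow 2).const_mul _)

end Cost

/-! ### Regularity of the states -/

/-- A square integrable function with values in a subspace almost everywhere is square integrable
as a function into the subspace. -/
theorem exists_memLp_subtype {X : Type*} [NormedAddCommGroup X] [NormedSpace ℝ X]
    {S : Submodule ℝ X} {μ : Measure ℝ} {p : ENNReal} {q : ℝ → X} (hq : MemLp q p μ)
    (h : ∀ᵐ t ∂μ, q t ∈ S) : ∃ w : ℝ → S, MemLp w p μ ∧ ∀ᵐ t ∂μ, (w t : X) = q t := by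
  classical
  set w : ℝ → S := fun t => if ht : q t ∈ S then ⟨q t, ht⟩ else 0 with hw
  have hwq : ∀ᵐ t ∂μ, (w t : X) = q t := by
    filter_upwards [h] with t ht
    simp only [hw, dif_pos ht]
  refine ⟨w, hq.mono ?_ ?_, hwq⟩
  · rw [← Topology.IsEmbedding.subtypeVal.aestronglyMeasurable_comp_iff]
    exact hq.1.congr (hwq.mono fun t ht => ht.symm)
  · filter_upwards [hwq] with t ht
    rw [← ht]; rfl

section Regularity

variable {T L x₀ C : ℝ} {u w : ℝ → ℝ}

theorem IsWeight.memLp_mul_spaceDeriv (hu : IsWeight L x₀ u) (p : H1 L x₀ u) :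
    MemLp (fun x => u x * spaceDeriv L x₀ (toL2 p) x) 2 (volume.restrict (Ioo 0 L)) := by
  have h1 : MemLp (fun x => √(u x)) ⊤ (volume.restrict (Ioo 0 L)) :=
    memLp_of_continuousOn (Real.continuous_sqrt.comp_continuousOn hu.continuousOn) ⊤
  refine (memLp_congr_ae ?_).1 (Lp.memLp (mulOp h1 (gradOp p)))
  filter_upwards [coeFn_mulOp h1 (gradOp p), coeFn_gradOp p, hu.ae_pos] with x e1 e2 e3
  rw [e1, e2, ← mul_assoc, Real.mul_self_sqrt e3.le]

variable [CompleteSpace (H1 L x₀ w)]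

/-- If `(u p_x)_x`, defined through the form of the equation, is represented by `h ∈ L²(0,L)`,
then `p` belongs to `H²_u(0,L)`. -/
theorem IsComparableWeight.mem_H2 (hw : IsWeight L x₀ w)
    (hu : IsComparableWeight L x₀ w C u) {p : H1 L x₀ w} {h : L2 L}
    (hp : hu.op hw p + (toL2 : H1 L x₀ w →L[ℝ] L2 L).adjoint h = 0) :
    WithLp.toLp 2 (hu.ofRef hw p, h) ∈ H2 L x₀ u := by
  refine ⟨hu.toIsWeight.memLp_mul_spaceDeriv _, fun φ h1 h2 h3 => ?_⟩
  obtain ⟨q, hq, hq'⟩ := hw.exists_test h1 h2 h3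
  have h4 : inner ℝ (hu.op hw p) q + inner ℝ h (toL2 q) = 0 := by
    rw [← ContinuousLinearMap.adjoint_inner_left, ← inner_add_left, hp, inner_zero_left]
  rw [IsComparableWeight.op, inner_diffusionOp_eq_integral hw, inner_L2_eq] at h4
  have e1 : ∫ x in Ioo 0 L, u x * spaceDeriv L x₀ (toL2 (hu.ofRef hw p)) x * deriv φ x =
      ∫ x in Ioo 0 L, u x * spaceDeriv L x₀ (toL2 p) x * spaceDeriv L x₀ (toL2 q) x := by
    rw [hu.toL2_ofRef]
    apply integral_congr_ae
    filter_upwards [hq'] with x hx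
    rw [hx]
  have e2 : ∫ x in Ioo 0 L, h x * φ x = ∫ x in Ioo 0 L, h x * toL2 q x := by
    apply integral_congr_ae
    filter_upwards [hq] with x hx
    rw [hx]
  refine e1.trans ((eq_neg_of_add_eq_zero_left h4).trans (congrArg Neg.neg e2.symm))

/-- A strong solution is a state with the higher regularity. -/
theorem IsStrongSol.isRegularState (hT : 0 < T) (hw : IsWeight L x₀ w)
    (hu : IsComparableWeight L x₀ w C u) {F : ℝ → L2 L}
    (hF : MemLp F 2 (volume.restrict (Ioo 0 T))) {v₀ : H1 L x₀ w} {v : ℝ → H1 L x₀ w}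
    {g : ℝ → L2 L} (h : IsStrongSol toL2 (hu.op hw) T F v₀ v g)
    (hv : MemLp v ⊤ (volume.restrict (Ioo 0 T))) {y : ℝ → L2 L}
    (hy : ∀ t ∈ Icc 0 T, y t = toL2 v₀ + ∫ s in (0 : ℝ)..t, g s) :
    IsRegularState T L x₀ u y := by
  have hvy : ∀ᵐ t ∂(volume.restrict (Ioo 0 T)), toL2 (hu.ofRef hw (v t)) = y t := by
    filter_upwards [h.eq_primitive, ae_restrict_mem measurableSet_Ioo] with t h1 ht
    rw [hu.toL2_ofRef, h1, hy t (Ioo_subset_Icc_self ht)]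
  refine ⟨⟨g, h.memLp_deriv, fun t ht => ?_⟩, ?_,
    ⟨fun t => hu.ofRef hw (v t), memLp_clm_comp _ hv, hvy⟩⟩
  · rw [hy t ht, hy 0 (left_mem_Icc.2 hT.le), intervalIntegral.integral_same, add_zero]
  · have hq1 : MemLp (fun t => hu.ofRef hw (v t)) 2 (volume.restrict (Ioo 0 T)) :=
      memLp_clm_comp _ h.memLp
    have hq2 : MemLp (fun t => g t - F t) 2 (volume.restrict (Ioo 0 T)) :=
      h.memLp_deriv.sub hF
    have hq : MemLp (fun t => WithLp.toLp 2 (hu.ofRef hw (v t), g t - F t)) 2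
        (volume.restrict (Ioo 0 T)) :=
      MemLp.of_fst_of_snd_prodLp ⟨hq1, hq2⟩
    obtain ⟨z, hz, hzq⟩ := exists_memLp_subtype (S := H2 L x₀ u) hq (by
      filter_upwards [h.equation] with t ht
      refine hu.mem_H2 hw ?_
      rw [map_sub, ← add_sub_assoc, add_comm, ht, sub_self])
    refine ⟨z, hz, ?_⟩
    filter_upwards [hzq, hvy] with t h1 h2
    rw [h1]
    exact h2

end Regularity

/-! ### Bounded weak derivatives and Lipschitz functions -/

section Lipschitz

variable {L : ℝ} {u : ℝ → ℝ}

theorem deriv_smoothTransition_eq_zero {r : ℝ} (h : r ∉ Ioo 0 1) :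
    deriv Real.smoothTransition r = 0 := by
  rw [mem_Ioo, not_and_or, not_lt, not_lt] at h
  rcases h with h | h
  · refine IsLocalMin.deriv_eq_zero (Eventually.of_forall fun x => ?_)
    rw [Real.smoothTransition.zero_of_nonpos h]
    exact Real.smoothTransition.nonneg x
  · refine IsLocalMax.deriv_eq_zero (Eventually.of_forall fun x => ?_)
    rw [Real.smoothTransition.one_of_one_le h]
    exact Real.smoothTransition.le_one x

theorem continuous_deriv_smoothTransition : Continuous (deriv Real.smoothTransition) :=
  Real.smoothTransition.contDiff.continuous_deriv (n := 1) (by simp)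

theorem hasDerivAt_smoothTransition_comp (ε s x : ℝ) :
    HasDerivAt (fun x => Real.smoothTransition (ε⁻¹ * (x - s)))
      (ε⁻¹ * deriv Real.smoothTransition (ε⁻¹ * (x - s))) x := by
  have h1 : HasDerivAt (fun x : ℝ => ε⁻¹ * (x - s)) (ε⁻¹ * 1) x :=
    ((hasDerivAt_id x).sub_const s).const_mul ε⁻¹
  have h2 : HasDerivAt Real.smoothTransition (deriv Real.smoothTransition (ε⁻¹ * (x - s)))
      (ε⁻¹ * (x - s)) :=
    ((Real.smoothTransition.contDiff (n := 1)).differentiable (by simp) _).hasDerivAt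
  have h3 := h2.comp x h1
  rw [mul_one, mul_comm] at h3
  exact h3

/-- The average of `u` against the derivative of a smooth step at `s` of width `ε`. -/
theorem integral_mul_deriv_step {ε s : ℝ} (hε : 0 < ε) (hs : 0 < s) (hsL : s + ε < L) :
    ∫ x in Ioo 0 L, u x * (ε⁻¹ * deriv Real.smoothTransition (ε⁻¹ * (x - s))) =
      ∫ r in (0 : ℝ)..1, u (ε * r + s) * deriv Real.smoothTransition r := by
  have h1 := intervalIntegral.integral_comp_mul_add (a := 0) (b := 1)
    (fun x => u x * deriv Real.smoothTransition (ε⁻¹ * (x - s))) hε.ne' s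
  have h2 : ∀ r, ε⁻¹ * (ε * r + s - s) = r := fun r => by field_simp; ring
  simp only [h2, mul_zero, zero_add, mul_one] at h1
  rw [h1, intervalIntegral.integral_of_le (by linarith), smul_eq_mul, ← integral_const_mul]
  have hsub : Ioc s (ε + s) ⊆ Ioo 0 L := fun x hx =>
    ⟨hs.trans hx.1, lt_of_le_of_lt hx.2 (by linarith)⟩
  rw [← setIntegral_eq_of_subset_of_forall_sdiff_eq_zero measurableSet_Ioo hsub fun x hx => ?_]
  · congr 1
    funext x
    ring
  · rw [deriv_smoothTransition_eq_zero fun h => hx.2 ?_]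
    · ring
    · have h3 := (inv_pos.2 hε)
      have h4 : ε * (ε⁻¹ * (x - s)) = x - s := mul_inv_cancel_left₀ hε.ne' _
      have h5 := mul_pos hε h.1
      have h6 := (mul_lt_mul_iff_right₀ hε).2 h.2
      rw [h4] at h5 h6
      constructor <;> linarith

theorem integral_deriv_smoothTransition :
    ∫ r in (0 : ℝ)..1, deriv Real.smoothTransition r = 1 := by
  rw [intervalIntegral.integral_deriv_eq_sub
    (fun x _ => (Real.smoothTransition.contDiff (n := 1)).differentiable (by simp) x)
    (continuous_deriv_smoothTransition.intervalIntegrable _ _),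
    Real.smoothTransition.one_of_one_le le_rfl, Real.smoothTransition.zero_of_nonpos le_rfl,
    sub_zero]

/-- A continuous function whose weak derivative is bounded by `K` is `K`-Lipschitz: the difference
of the averages of `u` near `s` and near `t` is the integral of the weak derivative against a
smoothed indicator function of `[s,t]`. -/
theorem abs_sub_le_of_hasWeakDeriv (hL : 0 < L) (hu : ContinuousOn u (Icc 0 L)) {ux : ℝ → ℝ}
    {K : ℝ} (hux : HasWeakDeriv L u ux)
    (hK : ∀ᵐ x ∂(volume.restrict (Ioo 0 L)), |ux x| ≤ K) {s t : ℝ} (hs : 0 < s) (hst : s ≤ t)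
    (ht : t < L) : |u s - u t| ≤ K * (t - s) := by
  have hK0 : 0 ≤ K := by
    have hne : (ae (volume.restrict (Ioo 0 L))).NeBot := by
      rw [ae_neBot, Ne, Measure.restrict_eq_zero, Real.volume_Ioo]
      simpa using hL
    obtain ⟨x, hx⟩ := hK.exists
    exact (abs_nonneg _).trans hx
  set v : ℝ → ℝ := IccExtend hL.le ((Icc 0 L).domRestrict u) with hv
  have hvc : Continuous v := (continuousOn_iff_continuous_domRestrict.1 hu).Icc_extend'
  have hvu : ∀ x ∈ Icc 0 L, v x = u x := fun x hx => IccExtend_of_mem hL.le _ hx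
  set G : ℝ → ℝ → ℝ := fun a ε => ∫ r in (0 : ℝ)..1, v (ε * r + a) *
    deriv Real.smoothTransition r with hG
  have hGc : ∀ a, Continuous (G a) := fun a => by
    apply intervalIntegral.continuous_parametric_intervalIntegral_of_continuous'
    have := continuous_deriv_smoothTransition
    fun_prop
  have hG0 : ∀ a, G a 0 = v a := fun a => by
    simp only [hG, zero_mul, zero_add, intervalIntegral.integral_const_mul,
      integral_deriv_smoothTransition, mul_one]
  have key : ∀ ε, 0 < ε → ε < L - t → |G s ε - G t ε| ≤ K * (t + ε - s) := fun ε hε hεL => by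
    set φ : ℝ → ℝ := fun x => Real.smoothTransition (ε⁻¹ * (x - s)) -
      Real.smoothTransition (ε⁻¹ * (x - t)) with hφ
    have hφd : ∀ x, HasDerivAt φ (ε⁻¹ * deriv Real.smoothTransition (ε⁻¹ * (x - s)) -
        ε⁻¹ * deriv Real.smoothTransition (ε⁻¹ * (x - t))) x := fun x =>
      (hasDerivAt_smoothTransition_comp ε s x).sub (hasDerivAt_smoothTransition_comp ε t x)
    have hφs : ContDiff ℝ (⊤ : ℕ∞) φ :=
      (Real.smoothTransition.contDiff.comp (contDiff_const.mul (contDiff_id.sub contDiff_const))).sub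
        (Real.smoothTransition.contDiff.comp (contDiff_const.mul (contDiff_id.sub contDiff_const)))
    have hφ0 : ∀ x, x ∉ Icc s (t + ε) → φ x = 0 := fun x hx => by
      rw [mem_Icc, not_and_or, not_le, not_le] at hx
      have hi := inv_pos.2 hε
      rcases hx with hx | hx
      · simp only [hφ]
        rw [Real.smoothTransition.zero_of_nonpos, Real.smoothTransition.zero_of_nonpos, sub_zero]
        · exact mul_nonpos_of_nonneg_of_nonpos hi.le (by linarith)
        · exact mul_nonpos_of_nonneg_of_nonpos hi.le (by linarith)
      · have h1 : ∀ a, a ≤ t → 1 ≤ ε⁻¹ * (x - a) := fun a ha => by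
          rw [← inv_mul_cancel₀ hε.ne']
          exact mul_le_mul_of_nonneg_left (by linarith) hi.le
        simp only [hφ]
        rw [Real.smoothTransition.one_of_one_le (h1 s hst),
          Real.smoothTransition.one_of_one_le (h1 t le_rfl), sub_self]
    have hsupp : Function.support φ ⊆ Icc s (t + ε) := fun x hx => by
      by_contra h
      exact hx (hφ0 x h)
    have hsub : Icc s (t + ε) ⊆ Ioo 0 L := fun x hx =>
      ⟨lt_of_lt_of_le hs hx.1, lt_of_le_of_lt hx.2 (by linarith)⟩
    have h1 := hux φ hφs (HasCompactSupport.of_support_subset_isCompact isCompact_Icc hsupp)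
      ((closure_minimal hsupp isClosed_Icc).trans hsub)
    have h2 : ∫ x in Ioo 0 L, u x * deriv φ x = G s ε - G t ε := by
      simp only [hG]
      rw [← integral_mul_deriv_step hε hs (by linarith : s + ε < L),
        ← integral_mul_deriv_step hε (hs.trans_le hst) (by linarith : t + ε < L), ← integral_sub]
      · apply setIntegral_congr_fun measurableSet_Ioo
        intro x hx
        simp only
        rw [(hφd x).deriv, hvu x (Ioo_subset_Icc_self hx)]
        ring
      · refine (memLp_of_continuousOn (Continuous.continuousOn ?_) 1).integrable le_rfl
        have := continuous_deriv_smoothTransition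
        fun_prop
      · refine (memLp_of_continuousOn (Continuous.continuousOn ?_) 1).integrable le_rfl
        have := continuous_deriv_smoothTransition
        fun_prop
    rw [← h2, h1, abs_neg]
    rw [setIntegral_eq_of_subset_of_forall_sdiff_eq_zero measurableSet_Ioo hsub fun x hx => by
      rw [hφ0 x hx.2, mul_zero]]
    rw [← Real.norm_eq_abs]
    refine (norm_setIntegral_le_of_norm_le_const_ae (C := K) ?_ ?_).trans (le_of_eq ?_)
    · rw [Real.volume_Icc]; exact ENNReal.ofReal_lt_top
    · filter_upwards [ae_restrict_of_ae_restrict_of_subset hsub hK] with x hx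
      rw [norm_mul, Real.norm_eq_abs, Real.norm_eq_abs]
      have h3 : |φ x| ≤ 1 := by
        have a1 := Real.smoothTransition.nonneg (ε⁻¹ * (x - s))
        have a2 := Real.smoothTransition.le_one (ε⁻¹ * (x - s))
        have a3 := Real.smoothTransition.nonneg (ε⁻¹ * (x - t))
        have a4 := Real.smoothTransition.le_one (ε⁻¹ * (x - t))
        rw [abs_le]
        constructor <;> simp only [hφ] <;> linarith
      calc |ux x| * |φ x| ≤ K * 1 := by gcongr
        _ = K := mul_one K
    · rw [measureReal_def, Real.volume_Icc, ENNReal.toReal_ofReal (by linarith)]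
  have hl : Tendsto (fun ε => |G s ε - G t ε|) (𝓝[>] 0) (𝓝 |u s - u t|) := by
    have := (((hGc s).sub (hGc t)).abs.tendsto 0).mono_left (nhdsWithin_le_nhds (s := Ioi 0))
    rw [Pi.sub_apply, hG0, hG0] at this
    rwa [hvu s ⟨hs.le, hst.trans ht.le⟩, hvu t ⟨(hs.trans_le hst).le, ht.le⟩] at this
  have hr : Tendsto (fun ε => K * (t + ε - s)) (𝓝[>] 0) (𝓝 (K * (t - s))) := by
    have h5 : Continuous fun ε : ℝ => K * (t + ε - s) := by fun_prop
    have := (h5.tendsto 0).mono_left (nhdsWithin_le_nhds (s := Ioi 0))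
    rwa [add_zero] at this
  refine le_of_tendsto_of_tendsto hl hr ?_
  filter_upwards [Ioo_mem_nhdsGT (by linarith : 0 < L - t)] with ε hε
  exact key ε hε.1 hε.2

theorem lipschitzOnWith_of_hasWeakDeriv (hL : 0 < L) (hu : ContinuousOn u (Icc 0 L)) {ux : ℝ → ℝ}
    {K : NNReal} (hux : HasWeakDeriv L u ux)
    (hK : ∀ᵐ x ∂(volume.restrict (Ioo 0 L)), |ux x| ≤ K) : LipschitzOnWith K u (Icc 0 L) := by
  rw [← closure_Ioo hL.ne] at hu ⊢
  refine LipschitzOnWith.closure hu (LipschitzOnWith.of_dist_le_mul fun x hx y hy => ?_)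
  rw [closure_Ioo hL.ne] at hu
  rw [Real.dist_eq, Real.dist_eq]
  rcases le_total x y with h | h
  · rw [abs_sub_comm x y, abs_of_nonneg (sub_nonneg.2 h)]
    exact abs_sub_le_of_hasWeakDeriv hL hu hux hK hx.1 h hy.2
  · rw [abs_of_nonneg (sub_nonneg.2 h), abs_sub_comm]
    exact abs_sub_le_of_hasWeakDeriv hL hu hux hK hy.1 h hx.2

/-- A Lipschitz function has a bounded weak derivative. -/
theorem exists_hasWeakDeriv_of_lipschitzWith {K : NNReal} (hL : 0 < L) (hu : LipschitzWith K u) :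
    ∃ ux : ℝ → ℝ, MemLp ux ⊤ (volume.restrict (Ioo 0 L)) ∧ HasWeakDeriv L u ux ∧
      ∀ᵐ x ∂(volume.restrict (Ioo 0 L)), |ux x| ≤ K := by
  have hb : ∀ x, |deriv u x| ≤ K := fun x => norm_deriv_le_of_lipschitz hu
  refine ⟨deriv u, memLp_top_of_bound (measurable_deriv u).aestronglyMeasurable K
    (Eventually.of_forall hb), fun φ h1 h2 h3 => ?_, Eventually.of_forall hb⟩
  have hz : ∀ x, x ∉ Ioo 0 L → φ x = 0 := fun x hx => image_eq_zero_of_notMem_tsupport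
    fun h => hx (h3 h)
  have h4 := AbsolutelyContinuousOnInterval.integral_mul_deriv_eq_deriv_mul (a := 0) (b := L)
    hu.lipschitzOnWith.absolutelyContinuousOnInterval
    (ContDiffOn.absolutelyContinuousOnInterval ((h1.contDiffOn (s := uIcc 0 L)).of_le (by simp)))
  rw [hz 0 (by simp), hz L (by simp), intervalIntegral_eq_integral_Ioo hL.le,
    intervalIntegral_eq_integral_Ioo hL.le] at h4
  rw [h4]
  ring

end Lipschitz

/-! ### Compactness of the admissible set and existence of a minimizer -/

section Compactness

variable {L : ℝ} {um uM : ℝ → ℝ} {u0 uL uinf : ℝ}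

/-- A function on `[0,L]`, extended constantly, is admissible when it is Lipschitz and satisfies
the pointwise constraints. -/
theorem IccExtend_mem_admissible (hL : 0 < L) {K : NNReal} {g : Icc (0 : ℝ) L → ℝ}
    (hg : LipschitzWith K g) (hb : ∀ x : Icc (0 : ℝ) L, um x ≤ g x ∧ g x ≤ uM x)
    (h0 : g ⟨0, left_mem_Icc.2 hL.le⟩ = u0) (h1 : g ⟨L, right_mem_Icc.2 hL.le⟩ = uL) :
    IccExtend hL.le g ∈ admissible L um uM u0 uL K := by
  have hlip : LipschitzWith K (IccExtend hL.le g) := by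
    have := hg.comp (LipschitzWith.projIcc hL.le)
    rwa [mul_one] at this
  refine ⟨hlip.continuous.continuousOn, memLp_of_continuousOn hlip.continuous.continuousOn ⊤,
    fun x hx => ?_, ?_, ?_, exists_hasWeakDeriv_of_lipschitzWith hL hlip⟩
  · rw [IccExtend_of_mem hL.le g hx]
    exact hb ⟨x, hx⟩
  · rw [IccExtend_of_mem hL.le g (left_mem_Icc.2 hL.le), h0]
  · rw [IccExtend_of_mem hL.le g (right_mem_Icc.2 hL.le), h1]

/-- The admissible set is sequentially compact for pointwise convergence, by the theorem of Arzelà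
and Ascoli. -/
theorem exists_subseq_tendsto_admissible (hL : 0 < L) (huinf : 0 ≤ uinf) {un : ℕ → ℝ → ℝ}
    (hun : ∀ n, un n ∈ admissible L um uM u0 uL uinf) :
    ∃ u ∈ admissible L um uM u0 uL uinf, ∃ φ : ℕ → ℕ, StrictMono φ ∧
      ∀ x ∈ Icc 0 L, Tendsto (fun n => un (φ n) x) atTop (𝓝 (u x)) := by
  lift uinf to NNReal using huinf
  have hlip : ∀ n, LipschitzWith uinf ((Icc 0 L).domRestrict (un n)) := fun n => by
    obtain ⟨hc, -, -, -, -, ux, -, hux, hK⟩ := hun n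
    exact (lipschitzOnWith_of_hasWeakDeriv hL hc hux hK).to_restrict
  set g : ℕ → BoundedContinuousFunction (Icc (0 : ℝ) L) ℝ := fun n =>
    BoundedContinuousFunction.mkOfCompact ⟨_, (hlip n).continuous⟩ with hg
  have hgn : ∀ n x, g n x = un n x := fun n x => rfl
  set z : Icc (0 : ℝ) L := ⟨0, left_mem_Icc.2 hL.le⟩ with hz
  set A : Set (BoundedContinuousFunction (Icc (0 : ℝ) L) ℝ) :=
    {h | LipschitzWith uinf h ∧ h z = u0} with hA
  have hcpt : IsCompact (closure A) := by
    refine BoundedContinuousFunction.arzela_ascoli (Metric.closedBall u0 (uinf * L))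
      (isCompact_closedBall _ _) A (fun h x hh => ?_) ?_
    · rw [Metric.mem_closedBall, ← hh.2]
      refine (hh.1.dist_le_mul x z).trans ?_
      gcongr
      rw [Subtype.dist_eq, Real.dist_eq, hz, sub_zero, abs_of_nonneg x.2.1]
      exact x.2.2
    · exact (LipschitzWith.uniformEquicontinuous _ uinf fun h => h.2.1).equicontinuous
  have hgA : ∀ n, g n ∈ closure A := fun n => subset_closure ⟨hlip n, (hun n).2.2.2.1⟩
  obtain ⟨h, -, φ, hφ, hlim⟩ := hcpt.tendsto_subseq hgA
  have hpt : ∀ x : Icc (0 : ℝ) L, Tendsto (fun n => un (φ n) x) atTop (𝓝 (h x)) := fun x =>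
    ((continuous_eval_const x).tendsto h).comp hlim
  refine ⟨IccExtend hL.le h, IccExtend_mem_admissible hL ?_ (fun x => ⟨?_, ?_⟩) ?_ ?_, φ, hφ,
    fun x hx => ?_⟩
  · refine LipschitzWith.of_dist_le_mul fun x y => ?_
    exact le_of_tendsto_of_tendsto ((hpt x).dist (hpt y)) tendsto_const_nhds
      (Eventually.of_forall fun n => (hlip (φ n)).dist_le_mul x y)
  · exact ge_of_tendsto (hpt x) (Eventually.of_forall fun n => ((hun (φ n)).2.2.1 x x.2).1)
  · exact le_of_tendsto (hpt x) (Eventually.of_forall fun n => ((hun (φ n)).2.2.1 x x.2).2)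
  · refine tendsto_nhds_unique (hpt _) ?_
    simp only [fun n => (hun n).2.2.2.1]
    exact tendsto_const_nhds
  · refine tendsto_nhds_unique (hpt _) ?_
    simp only [fun n => (hun n).2.2.2.2.1]
    exact tendsto_const_nhds
  · rw [IccExtend_of_mem hL.le h hx]
    exact hpt ⟨x, hx⟩

/-- All admissible coefficients are comparable with `um`. -/
theorem exists_isComparableWeight {x₀ : ℝ} {α : ℝ → ℝ} (hα : ContinuousOn α (Icc 0 L))
    (huMα : ∀ x ∈ Icc 0 L, uM x ≤ α x * um x)
    (hpos : ∀ x ∈ Icc 0 L, x ≠ x₀ → 0 < um x) (hnonneg : ∀ x ∈ Icc 0 L, 0 ≤ um x) :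
    ∃ C, 0 ≤ C ∧ ∀ u ∈ admissible L um uM u0 uL uinf, IsComparableWeight L x₀ um C u := by
  obtain ⟨C, hC⟩ := isCompact_Icc.exists_bound_of_continuousOn hα
  refine ⟨max C 0, le_max_right _ _, fun u hu => ⟨⟨hu.1, fun x hx hx0 => ?_⟩, fun x hx => ?_,
    fun x hx => ?_⟩⟩
  · exact (hpos x hx hx0).trans_le (hu.2.2.1 x hx).1
  · exact (hu.2.2.1 x hx).1
  · refine (hu.2.2.1 x hx).2.trans ((huMα x hx).trans ?_)
    exact mul_le_mul_of_nonneg_right ((le_abs_self _).trans ((hC x hx).trans (le_max_left _ _)))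
      (hnonneg x hx)

end Compactness

section Existence

variable {T L x₀ C : ℝ} {w u : ℝ → ℝ} [CompleteSpace (H1 L x₀ w)]

/-- The regularity of the state when the initial value belongs to `H¹_u(0,L)`. -/
theorem IsState.isRegularState (hT : 0 < T) (hw : IsWeight L x₀ w)
    (hu : IsComparableWeight L x₀ w C u) {f : ℝ × ℝ → ℝ} {F : ℝ → L2 L}
    (hF2 : MemLp F 2 (volume.restrict (Ioo 0 T)))
    (hF : ∀ᵐ t ∂(volume.restrict (Ioo 0 T)),
      F t =ᵐ[volume.restrict (Ioo 0 L)] fun x => f (t, x))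
    (p : H1 L x₀ u) {y : ℝ → L2 L} (h : IsState T L x₀ (toL2 p) f u y) :
    IsRegularState T L x₀ u y := by
  obtain ⟨v, g, hs, hv⟩ := (hu.isElliptic_op hw).exists_isStrongSol hT
    (adjoint_injective_of_denseRange hw.denseRange_toL2) (hu.toRef hw p) hF2
  obtain ⟨z, hz⟩ := h.isWeakSol hw hu hF2 hF
  rw [← hu.toL2_toRef hw] at hz
  exact hs.isRegularState hT hw hu hF2 hv (hz.unique (hu.isElliptic_op hw) hT hF2
    (hs.isWeakSol hT))

/-- The cost is attained on a set of coefficients that is sequentially compact for pointwise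
convergence. -/
theorem exists_forall_cost_le (hT : 0 < T) (hC : 0 ≤ C) (hw : IsWeight L x₀ w)
    {U : Set (ℝ → ℝ)} (hU : U.Nonempty) (hUw : ∀ u ∈ U, IsComparableWeight L x₀ w C u)
    (hcpt : ∀ un : ℕ → ℝ → ℝ, (∀ n, un n ∈ U) → ∃ u ∈ U, ∃ φ : ℕ → ℕ, StrictMono φ ∧
      ∀ x ∈ Icc 0 L, Tendsto (fun n => un (φ n) x) atTop (𝓝 (u x)))
    {F : ℝ → L2 L} (hF : MemLp F 2 (volume.restrict (Ioo 0 T))) (y₀ : L2 L)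
    {l1 l2 l3 : ℝ} (hl1 : 0 ≤ l1) (hl2 : 0 ≤ l2) (hl3 : 0 ≤ l3) (Mf MT M : ℝ) :
    ∃ (u : ℝ → ℝ) (hu : u ∈ U) (y : ℝ → L2 L) (v : ℝ → H1 L x₀ w),
      IsWeakSol toL2 ((hUw u hu).op hw) T F y₀ y v ∧
      ∀ (u' : ℝ → ℝ) (hu' : u' ∈ U) (y' : ℝ → L2 L) (v' : ℝ → H1 L x₀ w),
        IsWeakSol toL2 ((hUw u' hu').op hw) T F y₀ y' v' →
          cost T L x₀ l1 l2 l3 Mf MT M u y ≤ cost T L x₀ l1 l2 l3 Mf MT M u' y' := by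
  choose Y V hYV using fun u : U => ((hUw u.1 u.2).isElliptic_op hw).exists_isEnergySol hT
    hw.denseRange_toL2 y₀ hF
  set J : U → ℝ := fun u => cost T L x₀ l1 l2 l3 Mf MT M u (Y u) with hJ
  have hJ0 : ∀ u, 0 ≤ J u := fun u => by
    simp only [hJ, cost]
    positivity
  have hbdd : BddBelow (range J) := ⟨0, by rintro _ ⟨u, rfl⟩; exact hJ0 u⟩
  have : Nonempty U := hU.to_subtype
  obtain ⟨s, -, hs, hsm⟩ := exists_seq_tendsto_sInf (range_nonempty J) hbdd
  choose un hun using hsm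
  obtain ⟨u, hu, φ, hφ, hlim⟩ := hcpt (fun n => un n) fun n => (un n).2
  have hconv : Tendsto (fun n => J (un (φ n))) atTop (𝓝 (J ⟨u, hu⟩)) :=
    IsComparableWeight.tendsto_cost hT hC hw (hUw u hu) (fun n => hUw _ (un (φ n)).2) hlim hF
      (hYV ⟨u, hu⟩) (fun n => hYV (un (φ n))) l1 l2 l3 Mf MT M
  have hmin : J ⟨u, hu⟩ = sInf (range J) := by
    refine tendsto_nhds_unique hconv ?_
    simp only [hun]
    exact hs.comp hφ.tendsto_atTop
  refine ⟨u, hu, Y ⟨u, hu⟩, V ⟨u, hu⟩, (hYV ⟨u, hu⟩).toIsWeakSol, fun u' hu' y' v' h' => ?_⟩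
  have hle : J ⟨u, hu⟩ ≤ J ⟨u', hu'⟩ := hmin ▸ csInf_le hbdd ⟨_, rfl⟩
  refine hle.trans (le_of_eq ?_)
  -- the states of `u'` agree on `[0,T]`, hence have the same cost
  have huniq := h'.unique ((hUw u' hu').isElliptic_op hw) hT hF (hYV ⟨u', hu'⟩).toIsWeakSol
  have hi : ∀ G : L2 L → ℝ, ∫ t in Ioo 0 T, G (Y ⟨u', hu'⟩ t) = ∫ t in Ioo 0 T, G (y' t) :=
    fun G => setIntegral_congr_fun measurableSet_Ioo fun t ht => by
      simp only [huniq (Ioo_subset_Icc_self ht)]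
  simp only [hJ, cost]
  rw [hi fun q => ∫ x in Ioo 0 L, u' x * spaceDeriv L x₀ q x, hi fun q => ∫ x in Ioo 0 L, q x,
    huniq (right_mem_Icc.2 hT.le)]

end Existence

end DegenerateDiffusion

end

theorem theorem2p5
    -- the domain, the degeneracy point and the data of the state equation
    (T L x₀ : ℝ) (hT : 0 < T) (hL : 0 < L) (hx₀ : x₀ ∈ Ioo 0 L)
    (y₀ : L2 L)
    (hy₀ : ∀ᵐ x ∂(volume.restrict (Ioo 0 L)), 0 ≤ y₀ x)
    (f : ℝ × ℝ → ℝ)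
    (hf : MemLp f 2
      (volume.restrict (Ioo 0 T ×ˢ Ioo 0 L)))
    (hf0 : ∀ᵐ p ∂(volume.restrict (Ioo 0 T ×ˢ Ioo 0 L)), 0 ≤ f p)
    -- the data of the admissible set
    (um uM α : ℝ → ℝ) (u0 uL uinf : ℝ) (huinf : 0 ≤ uinf)
    (hum : ContinuousOn um (Icc 0 L)) (huM : ContinuousOn uM (Icc 0 L))
    (hα : ContinuousOn α (Icc 0 L)) (hα1 : ∀ x ∈ Icc 0 L, 1 ≤ α x)
    (huMα : ∀ x ∈ Icc 0 L, uM x ≤ α x * um x)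
    (hpos : ∀ x ∈ Icc 0 L, x ≠ x₀ → 0 < um x ∧ um x < uM x)
    (hum0 : um x₀ = 0) (huM0 : uM x₀ = 0)
    (hdeg : ∫⁻ x in Ioo 0 L, ENNReal.ofReal (1 / uM x) = ⊤)
    (hU : (admissible L um uM u0 uL uinf).Nonempty)
    -- the data of the cost functional
    (l1 l2 l3 Mf MT M : ℝ) (hl1 : 0 ≤ l1) (hl2 : 0 ≤ l2) (hl3 : 0 ≤ l3)
    (hl : 0 < l1 ∨ 0 < l2 ∨ 0 < l3) (hMf : 0 ≤ Mf) (hMT : 0 ≤ MT) (hM : 0 ≤ M) :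
    -- each admissible coefficient has exactly one state, so that the cost is well defined
    (∀ v ∈ admissible L um uM u0 uL uinf,
      (∃ z, IsState T L x₀ y₀ f v z) ∧
      ∀ z z', IsState T L x₀ y₀ f v z →
        IsState T L x₀ y₀ f v z' → EqOn z z' (Icc 0 T)) ∧
    -- the minimum of the cost is attained, with the stated regularity of the state
    ∃ u ∈ admissible L um uM u0 uL uinf,
      ∃ y, IsState T L x₀ y₀ f u y ∧
        (∀ v ∈ admissible L um uM u0 uL uinf,
          ∀ z, IsState T L x₀ y₀ f v z →
            cost T L x₀ l1 l2 l3 Mf MT M u y ≤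
              cost T L x₀ l1 l2 l3 Mf MT M v z) ∧
        ((∃ p : H1 L x₀ u, toL2 p = y₀) →
          IsRegularState T L x₀ u y) := by
  have hnonneg : ∀ x ∈ Icc 0 L, 0 ≤ um x := fun x hx => by
    by_cases h : x = x₀
    · rw [h, hum0]
    · exact (hpos x hx h).1.le
  have hw : IsWeight L x₀ um := ⟨hum, fun x hx h => (hpos x hx h).1⟩
  obtain ⟨C, hC, hcomp⟩ := exists_isComparableWeight (u0 := u0) (uL := uL) (uinf := uinf) hα huMα
    hw.pos hnonneg
  have := hw.completeSpace_H1 hx₀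
  rw [Measure.volume_eq_prod, ← Measure.prod_restrict] at hf
  obtain ⟨F, hF2, hF⟩ := exists_memLp_curry hf
  refine ⟨fun v hv => ⟨?_, fun z z' hz hz' => ?_⟩, ?_⟩
  · obtain ⟨y, v', h⟩ := ((hcomp v hv).isElliptic_op hw).exists_isEnergySol hT
      hw.denseRange_toL2 y₀ hF2
    exact ⟨y, h.toIsWeakSol.isState hT hw (hcomp v hv) hF2 hF⟩
  · obtain ⟨_, h⟩ := hz.isWeakSol hw (hcomp v hv) hF2 hF
    obtain ⟨_, h'⟩ := hz'.isWeakSol hw (hcomp v hv) hF2 hF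
    exact h.unique ((hcomp v hv).isElliptic_op hw) hT hF2 h'
  · obtain ⟨u, hu, y, v, hy, hmin⟩ := exists_forall_cost_le hT hC hw hU hcomp
      (fun un hun => exists_subseq_tendsto_admissible hL huinf hun) hF2 y₀ hl1 hl2 hl3 Mf MT M
    have hstate := hy.isState hT hw (hcomp u hu) hF2 hF
    refine ⟨u, hu, y, hstate, fun u' hu' z hz => ?_, ?_⟩
    · obtain ⟨v', hv'⟩ := hz.isWeakSol hw (hcomp u' hu') hF2 hF
      exact hmin u' hu' z v' hv'
    · rintro ⟨p, rfl⟩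
      exact hstate.isRegularState hT hw (hcomp u hu) hF2 hF p
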